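/- **Conventions.** Let $\mathbb D\subset\mathbb C$ be the closed unit disk, $\mathbb S$ its boundary circle, $\omega=dx\wedge dy$, $\mathbb D^*=\mathbb D\setminus(\mathbb S\cup\{0\})$, $\mu_\omega$ the measure on $\mathbb D^*$ defined by $\omega$, and $W=\{(z,z')\in\mathbb D^*\times\mathbb D^*: z\neq z'\}$. Let $\tilde D$ be the universal covering space of $\mathbb D^*$, with covering automorphisms generated by $T$ (one counterclockwise turn). *Radial foliations.* A ray is a simple oriented curve of $\mathbb D^*$ that tends to $0$ in the past and to $\mathbb S$ in the future; a radial foliation $\mathcal F$ is an oriented topological foliation of $\mathbb D^*$ all of whose leaves are rays. A lift $\tilde\phi$ of a ray separates $\tilde D$ into a left component $L(\tilde\phi)$ and a right component $R(\tilde\phi)$. Lifted leaves are ordered by $\tilde\phi\preceq\tilde\phi'\iff R(\tilde\phi)\subset R(\tilde\phi')$, and $\tilde\phi_{\tilde z}$ denotes the lifted leaf through $\tilde z$. For $\tilde z\ne\tilde z'$ in $\tilde D$ let $\theta_{\tilde z,\tilde z'}(\mathcal F)\in\mathbb Z/4\mathbb Z$ be: $0$ if $\tilde z'$ comes after $\tilde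 z$ on the same lifted leaf; $1$ if $\tilde\phi_{\tilde z'}\succ\tilde\phi_{\tilde z}$; $2$ if $\tilde z'$ comes before $\tilde z$ on the same lifted leaf; $3$ if $\tilde\phi_{\tilde z'}\prec\tilde\phi_{\tilde z}$. *The function $\lambda_{f,\mathcal F}$.* Let $f$ be a homeomorphism of $\mathbb D^*$ isotopic to the identity. Choose an identity isotopy $(g_s)_{s\in[0,1]}$ of $f$ in $\mathbb D^*$ with lifted identity isotopy $(\tilde g_s)$. For $(z,z')\in W$ choose lifts $\tilde z,\tilde z'$. For each $k\in\mathbb Z$ lift the path $s\mapsto\theta_{\tilde z,T^k\tilde z'}(g_s^{-1}(\mathcal F))=\theta_{\tilde g_s(\tilde z),\tilde g_s(T^k\tilde z')}(\mathcal F)$ to a path $s\mapsto\hat\theta_k(s)\in\mathbb Z$ that is continuous for the digital line topology, the one generated by the sets $\{2j+1\}$ and $\{2j-1,2j,2j+1\}$. Put $$\lambda_{f,\mathcal F}(z,z')=\sum_{k\in\mathbb Z}\lambda(\hat\theta_k(0),\hat\theta_k(1)),$$ where $\lambda(a,a)=0$, $\lambda(a,b)=\#\big((a,b)\cap4\mathbb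 Z\big)+\tfrac12\#\big(\{a,b\}\cap4\mathbb Z\big)$ if $a<b$, and $\lambda(a,b)=-\lambda(b,a)$ if $a>b$. The sum is finite and does not depend on the choices. *The functions $m_{\tilde f,\phi}$ and $\Lambda_{\tilde f,\mathcal F,\phi}$.* Let $\tilde f$ be a lift of $f$ to $\tilde D$ and $\phi$ a leaf of $\mathcal F$, with a lift $\tilde\phi$. For $z\in\mathbb D^*$ let $\tilde z$ be the lift of $z$ in $\overline{L(\tilde\phi)}\cap R(T(\tilde\phi))$. Then $m_{\tilde f,\phi}(z)$ is the integer $m$ such that $\tilde f(\tilde z)\in\overline{L(T^m(\tilde\phi))}\cap R(T^{m+1}(\tilde\phi))$, and $\Lambda_{\tilde f,\mathcal F,\phi}(z,z')=\lambda_{f,\mathcal F}(z,z')+m_{\tilde f,\phi}(z)$. *The Calabi invariant.* Let $I=(f_s)_{s\in[0,1]}$ be an identity isotopy, in the group of homeomorphisms of $\mathbb D$, of a symplectic $C^1$ diffeomorphism $f$ of $\mathbb D$. Then $$\widetilde{\mathrm{Cal}}(I)=\iint_{z\ne z'}\mathrm{ang}_I(z,z')\,\omega(z)\,\omega(z'),$$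 where $2\pi\,\mathrm{ang}_I(z,z')$ is the counterclockwise variation of the angle of $f_s(z')-f_s(z)$, $s\in[0,1]$, for distinct $z,z'\in\mathbb D$. It depends only on the homotopy class $[I]$. **Proposition.** Let $f$ be a $C^1$ diffeomorphism of $\mathbb D$ that preserves $\omega$ and fixes $0$. Let $I$ be an identity isotopy of $f$. Let $\tilde f$ be the lift of $f_{|\mathbb D^*}$ to $\tilde D$ naturally defined by $[I]$, that is, by lifting to $\tilde D$ an isotopy homotopic to $I$ relative to the endpoints that fixes $0$. Let $\mathcal F$ be a radial foliation and $\phi$ a leaf of $\mathcal F$ such that $m_{\tilde f,\phi}$ is $\mu_\omega$-integrable and $\lambda_{f,\mathcal F}$ is $\mu_\omega\times\mu_\omega$-integrable. Then $$\widetilde{\mathrm{Cal}}(I)=\int_W\Lambda_{\tilde f,\mathcal F,\phi}\,d\mu_\omega\times d\mu_\omega .$$ Moreover, let $I'=(f'_s)$ be a Hamiltonian isotopy homotopic to $I$ relative to the endpoints: a path of symplectic $C^1$ diffeomorphisms of $\mathbb D$ starting at the identity, with $\frac{d}{ds}f'_s=X_s\circ f'_s$ for a time dependent divergence free $C^1$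 vector field $X_s$, and with $C^2$ functions $H_s$ vanishing on $\mathbb S$ such that $dH_s(z)\,v=\omega(v,X_s(z))$. Then $$-2\int_0^1\Big(\int_{\mathbb D}H_s\,\omega\Big)ds=\int_W\Lambda_{\tilde f,\mathcal F,\phi}\,d\mu_\omega\times d\mu_\omega .$$ -/

import Mathlib

open Set Filter Topology MeasureTheory
open scoped Real

noncomputable section

namespace CalabiRadial

/-! ### The disk, its area form, symplectic diffeomorphisms and isotopies -/

/-- The closed unit disk `𝔻` of the Euclidean plane. -/
def disk : Set ℂ := Metric.closedBall 0 1

/-- The open disk without its centre, `𝔻* = 𝔻 \ (𝕊 ∪ {0})`. -/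
def diskStar : Set ℂ := {z | 0 < ‖z‖ ∧ ‖z‖ < 1}

/-- The area form `ω = dx ∧ dy`. -/
def omega (u v : ℂ) : ℝ := u.re * v.im - u.im * v.re

/-- `f` restricts to a `C¹` diffeomorphism of the closed disk that preserves `ω`.  The values of `f`
outside the disk play no role. -/
structure IsSymplecticDiffeo (f : ℂ → ℂ) : Prop where
  bijOn : BijOn f disk disk
  contDiffOn : ContDiffOn ℝ 1 f disk
  contDiffOn_inv : ∃ g : ℂ → ℂ, InvOn g f disk disk ∧ ContDiffOn ℝ 1 g disk
  symplectic : ∀ z ∈ disk, ∀ u v : ℂ,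
    omega (fderivWithin ℝ f disk z u) (fderivWithin ℝ f disk z v) = omega u v

/-- `(I s)`, `s ∈ [0,1]`, is a continuous path of homeomorphisms of the closed disk from the
identity to `f` (the disk being compact, a continuous bijection is a homeomorphism and joint
continuity is continuity for the `C⁰` topology; such homeomorphisms preserve the orientation, being
isotopic to the identity). -/
structure IsIdentityIsotopy (I : ℝ → ℂ → ℂ) (f : ℂ → ℂ) : Prop where
  continuousOn : ContinuousOn (fun p : ℝ × ℂ => I p.1 p.2) (Icc 0 1 ×ˢ disk)
  bijOn : ∀ s ∈ Icc (0 : ℝ) 1, BijOn (I s) disk disk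
  start : ∀ z ∈ disk, I 0 z = z
  finish : ∀ z ∈ disk, I 1 z = f z

/-- The paths `I` and `J` of homeomorphisms of the closed disk are homotopic relative to their
endpoints. -/
def IsotopyHomotopic (I J : ℝ → ℂ → ℂ) : Prop :=
  ∃ K : ℝ → ℝ → ℂ → ℂ,
    ContinuousOn (fun p : ℝ × ℝ × ℂ => K p.1 p.2.1 p.2.2) (Icc 0 1 ×ˢ Icc 0 1 ×ˢ disk) ∧
    (∀ r ∈ Icc (0 : ℝ) 1, ∀ s ∈ Icc (0 : ℝ) 1, BijOn (K r s) disk disk) ∧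
    (∀ s ∈ Icc (0 : ℝ) 1, ∀ z ∈ disk, K 0 s z = I s z ∧ K 1 s z = J s z) ∧
    (∀ r ∈ Icc (0 : ℝ) 1, ∀ z ∈ disk, K r 0 z = I 0 z ∧ K r 1 z = I 1 z)

/-! ### The Calabi invariant of an isotopy -/

/-- `θ` is a continuous determination of the argument along the path `γ : [0,1] → ℂ \ {0}`. -/
def IsArgLift (γ : ℝ → ℂ) (θ : ℝ → ℝ) : Prop :=
  ContinuousOn θ (Icc 0 1) ∧
    ∀ s ∈ Icc (0 : ℝ) 1, γ s = (‖γ s‖ : ℂ) * Complex.exp ((θ s : ℂ) * Complex.I)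

open Classical in
/-- The variation of the angle, in turns and counted counterclockwise, along a continuous path
`γ : [0,1] → ℂ \ {0}`, that is `(1 / 2π) ∫_γ dθ`. -/
def angleVariation (γ : ℝ → ℂ) : ℝ :=
  if h : ∃ θ, IsArgLift γ θ then (h.choose 1 - h.choose 0) / (2 * π) else 0

/-- `ang_I (z, z')`: the variation of the angle of the vector `I_s(z') - I_s(z)`. -/
def ang (I : ℝ → ℂ → ℂ) (z z' : ℂ) : ℝ := angleVariation fun s => I s z' - I s z

/-- The Calabi invariant of an isotopy as a mean variation of angle:
`∬ ang_I (z, z') ω(z) ω(z')` over the pairs of distinct points of the disk. -/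
def calabi (I : ℝ → ℂ → ℂ) : ℝ :=
  ∫ p in {p : ℂ × ℂ | p.1 ∈ disk ∧ p.2 ∈ disk ∧ p.1 ≠ p.2}, ang I p.1 p.2
    ∂((volume : Measure ℂ).prod (volume : Measure ℂ))

/-- `J` is a Hamiltonian isotopy: a path of symplectic diffeomorphisms of the disk, starting at the
identity, that integrates the time dependent divergence free `C¹` vector field `X`, where `X_s` has
the Hamiltonian function `H_s`, which is `C²`, vanishes on the unit circle and satisfies
`dH_s(z) v = ω(v, X_s(z))`. -/
structure IsHamiltonianIsotopy (J X : ℝ → ℂ → ℂ) (H : ℝ → ℂ → ℝ) : Prop where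
  symplectic : ∀ s ∈ Icc (0 : ℝ) 1, IsSymplecticDiffeo (J s)
  start : ∀ z ∈ disk, J 0 z = z
  field_continuousOn : ContinuousOn (fun p : ℝ × ℂ => X p.1 p.2) (Icc 0 1 ×ˢ disk)
  field_contDiffOn : ∀ s ∈ Icc (0 : ℝ) 1, ContDiffOn ℝ 1 (X s) disk
  field_fderiv_continuousOn :
    ContinuousOn (fun p : ℝ × ℂ => fderivWithin ℝ (X p.1) disk p.2) (Icc 0 1 ×ˢ disk)
  field_div : ∀ s ∈ Icc (0 : ℝ) 1, ∀ z ∈ disk,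
    (fderivWithin ℝ (X s) disk z 1).re + (fderivWithin ℝ (X s) disk z Complex.I).im = 0
  flow : ∀ s ∈ Icc (0 : ℝ) 1, ∀ z ∈ disk,
    HasDerivWithinAt (fun t => J t z) (X s (J s z)) (Icc 0 1) s
  ham_contDiffOn : ∀ s ∈ Icc (0 : ℝ) 1, ContDiffOn ℝ 2 (H s) disk
  ham_boundary : ∀ s ∈ Icc (0 : ℝ) 1, ∀ z : ℂ, ‖z‖ = 1 → H s z = 0
  ham_fderiv : ∀ s ∈ Icc (0 : ℝ) 1, ∀ z ∈ disk, ∀ v : ℂ,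
    fderivWithin ℝ (H s) disk z v = omega v (X s z)

/-- The Calabi invariant of a Hamiltonian isotopy with Hamiltonian functions `H_s`, in the
normalization for which the rotation isotopy `(R_{sα})` of total angle `2πα` has invariant `π² α`:
with the sign convention `dH_s = ω(·, X_s)` that isotopy has `H_s = πα (|z|² - 1)`, whose integral
over the disk is `-π² α / 2`. -/
def hamiltonianCalabi (H : ℝ → ℂ → ℝ) : ℝ :=
  -2 * ∫ s in (0 : ℝ)..1, ∫ z in disk, H s z

/-! ### The universal covering space of the punctured disk -/

/-- The universal covering space of `𝔻*`, realized as `{Re ζ < 0}` with covering map `exp`. -/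
def cover : Set ℂ := {ζ | ζ.re < 0}

/-- The power `T ^ k` of the generating covering automorphism `T`. -/
def deck (k : ℤ) (ζ : ℂ) : ℂ := ζ + 2 * π * k * Complex.I

/-- `gt` is the identity isotopy of the universal covering space that lifts the isotopy `g`
of `𝔻*`. -/
structure IsLiftedIsotopy (g gt : ℝ → ℂ → ℂ) : Prop where
  continuousOn : ContinuousOn (fun p : ℝ × ℂ => gt p.1 p.2) (Icc 0 1 ×ˢ cover)
  mapsTo : ∀ s ∈ Icc (0 : ℝ) 1, MapsTo (gt s) cover cover
  start : ∀ ζ ∈ cover, gt 0 ζ = ζ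
  lift : ∀ s ∈ Icc (0 : ℝ) 1, ∀ ζ ∈ cover, Complex.exp (gt s ζ) = g s (Complex.exp ζ)

/-- `ft` is the lift of `f|𝔻*` naturally defined by the homotopy class of the isotopy `I` of `f`:
it is the end of the lifted isotopy of any isotopy of `f` in that class that fixes `0`. -/
def IsNaturalLift (I : ℝ → ℂ → ℂ) (f ft : ℂ → ℂ) : Prop :=
  ∃ J Jt : ℝ → ℂ → ℂ, IsIdentityIsotopy J f ∧ (∀ s ∈ Icc (0 : ℝ) 1, J s 0 = 0) ∧
    IsotopyHomotopic I J ∧ IsLiftedIsotopy J Jt ∧ ∀ ζ ∈ cover, ft ζ = Jt 1 ζ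

/-! ### Radial foliations -/

/-- `γ` parametrizes an oriented ray: a simple curve of `𝔻*` that tends to `0` in the past and to the
unit circle in the future. -/
structure IsRay (γ : ℝ → ℂ) : Prop where
  continuous : Continuous γ
  injective : Function.Injective γ
  mem : ∀ t, γ t ∈ diskStar
  past : Tendsto γ atBot (𝓝 0)
  future : Tendsto (fun t => ‖γ t‖) atTop (𝓝 1)

/-- A radial foliation: an oriented topological foliation of `𝔻*` all of whose leaves are rays.
Every point has a flow box, that is a chart onto `ℝ × ℝ` in which each horizontal line, oriented
from left to right, is an oriented piece of a leaf. -/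
structure RadialFoliation where
  leaves : Set (Set ℂ)
  exists_ray : ∀ φ ∈ leaves, ∃ γ, IsRay γ ∧ range γ = φ
  partition : ∀ z ∈ diskStar, ∃! φ, φ ∈ leaves ∧ z ∈ φ
  flow_box : ∀ z ∈ diskStar, ∃ e : OpenPartialHomeomorph ℂ (ℝ × ℝ),
    z ∈ e.source ∧ e.source ⊆ diskStar ∧ e.target = univ ∧
      ∀ y : ℝ, ∃ γ : ℝ → ℂ, IsRay γ ∧ range γ ∈ leaves ∧
        ∃ u : ℝ → ℝ, StrictMono u ∧ ∀ x : ℝ, e.symm (x, y) = γ (u x)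

/-- `γt` parametrizes a lift to the universal covering space of a ray, with its orientation. -/
structure IsLiftedRay (γt : ℝ → ℂ) : Prop where
  continuous : Continuous γt
  mem : ∀ t, γt t ∈ cover
  isRay : IsRay fun t => Complex.exp (γt t)

/-- `φt` is a lift of the ray `φ` to the universal covering space. -/
def IsLiftOfRay (φt φ : Set ℂ) : Prop :=
  ∃ γt, IsLiftedRay γt ∧ range γt = φt ∧ Complex.exp '' φt = φ

/-- The component `L(φt)` of the complement of a lifted ray that lies on its left.  A lifted ray runs
from `Re ζ = -∞` to `Re ζ = 0` and meets each vertical line in a compact set; on its left lie the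
points `ζ + iy` with `y` large. -/
def leftSide (φt : Set ℂ) : Set ℂ :=
  {ζ ∈ cover \ φt | ∀ᶠ y : ℝ in atTop, JoinedIn (cover \ φt) ζ (ζ + y * Complex.I)}

/-- The component `R(φt)` of the complement of a lifted ray that lies on its right. -/
def rightSide (φt : Set ℂ) : Set ℂ :=
  {ζ ∈ cover \ φt | ∀ᶠ y : ℝ in atTop, JoinedIn (cover \ φt) ζ (ζ - y * Complex.I)}

/-- The strict order `φt ≺ φt'` on lifted leaves. -/
def LeafLT (φt φt' : Set ℂ) : Prop := rightSide φt ⊆ rightSide φt' ∧ φt ≠ φt'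

/-- The leaf through `ζ` of the lift of the foliation `F` (the unique lift of a leaf of `F` that
contains `ζ`, written as a union). -/
def RadialFoliation.liftedLeaf (F : RadialFoliation) (ζ : ℂ) : Set ℂ :=
  ⋃₀ {φt | ζ ∈ φt ∧ ∃ φ ∈ F.leaves, IsLiftOfRay φt φ}

/-- `ζ <_F ζ'`: the two points are on the same leaf of the lifted foliation and `ζ'` comes after
`ζ`. -/
def RadialFoliation.PointLT (F : RadialFoliation) (ζ ζ' : ℂ) : Prop :=
  ∃ γt, IsLiftedRay γt ∧ (range fun t => Complex.exp (γt t)) ∈ F.leaves ∧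
    ∃ s t : ℝ, s < t ∧ γt s = ζ ∧ γt t = ζ'

open Classical in
/-- The discretized angle `θ_{ζ,ζ'}(F) ∈ ℤ/4ℤ` for distinct points `ζ`, `ζ'` of the universal covering
space: `0` if `ζ' > ζ`, `1` if the leaf of `ζ'` is above that of `ζ`, `2` if `ζ' < ζ`, and `3` if the
leaf of `ζ'` is below that of `ζ`. -/
def RadialFoliation.theta (F : RadialFoliation) (ζ ζ' : ℂ) : ZMod 4 :=
  if F.PointLT ζ ζ' then 0
  else if LeafLT (F.liftedLeaf ζ) (F.liftedLeaf ζ') then 1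
  else if F.PointLT ζ' ζ then 2
  else 3

/-! ### The function `λ_{f,F}` -/

/-- The digital line topology on `ℤ`. -/
abbrev digitalLine : TopologicalSpace ℤ :=
  TopologicalSpace.generateFrom
    {U | ∃ k : ℤ, U = {2 * k + 1} ∨ U = {2 * k - 1, 2 * k, 2 * k + 1}}

/-- The algebraic number of crossings of `4ℤ` when going from `k` to `l`, an endpoint in `4ℤ` being
counted one half. -/
def crossing (k l : ℤ) : ℝ :=
  if k = l then 0
  else if k < l then
    (((Finset.Ioo k l).filter fun j => (4 : ℤ) ∣ j).card : ℝ) +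
      ((({k, l} : Finset ℤ).filter fun j => (4 : ℤ) ∣ j).card : ℝ) / 2
  else
    -(((Finset.Ioo l k).filter fun j => (4 : ℤ) ∣ j).card : ℝ) -
      ((({l, k} : Finset ℤ).filter fun j => (4 : ℤ) ∣ j).card : ℝ) / 2

/-- `(g s)`, `s ∈ [0,1]`, is a continuous path of homeomorphisms of `𝔻*` from the identity to `f`
(a continuous bijection of the surface `𝔻*` is a homeomorphism, and the inverses depend continuously
on `s`, by invariance of domain). -/
structure IsIdentityIsotopyStar (g : ℝ → ℂ → ℂ) (f : ℂ → ℂ) : Prop where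
  continuousOn : ContinuousOn (fun p : ℝ × ℂ => g p.1 p.2) (Icc 0 1 ×ˢ diskStar)
  bijOn : ∀ s ∈ Icc (0 : ℝ) 1, BijOn (g s) diskStar diskStar
  start : ∀ z ∈ diskStar, g 0 z = z
  finish : ∀ z ∈ diskStar, g 1 z = f z

/-- `θh` is a lift `[0,1] → ℤ`, continuous for the digital line topology, of the path
`s ↦ θ_{ζ,ζ'}(g_s⁻¹(F)) = θ_{gt_s(ζ), gt_s(ζ')}(F)`, where `gt` lifts the isotopy `g`. -/
def IsThetaLift (F : RadialFoliation) (gt : ℝ → ℂ → ℂ) (ζ ζ' : ℂ) (θh : ℝ → ℤ) : Prop :=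
  @ContinuousOn ℝ ℤ _ digitalLine θh (Icc 0 1) ∧
    ∀ s ∈ Icc (0 : ℝ) 1, (θh s : ZMod 4) = F.theta (gt s ζ) (gt s ζ')

/-- `v = ∑_k λ(ζ, T^k(ζ'), F, f⁻¹(F))`, where `ζ`, `ζ'` lift `z`, `z'` and where
`λ(ζ, T^k(ζ'), F, f⁻¹(F))` is the algebraic number of crossings of `4ℤ` by a lift of the discretized
angle `θ_{ζ, T^k(ζ')}` along the path of foliations `g_s⁻¹(F)` from `F` to `f⁻¹(F)` given by an
identity isotopy `g` of `f` in `𝔻*`.  The value depends neither on the isotopy nor on the lifts, and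
only finitely many terms do not vanish. -/
def IsLambdaValue (F : RadialFoliation) (f : ℂ → ℂ) (z z' : ℂ) (v : ℝ) : Prop :=
  ∃ g gt : ℝ → ℂ → ℂ, IsIdentityIsotopyStar g f ∧ IsLiftedIsotopy g gt ∧
    ∃ ζ ∈ cover, ∃ ζ' ∈ cover, Complex.exp ζ = z ∧ Complex.exp ζ' = z' ∧
      ∃ θh : ℤ → ℝ → ℤ, (∀ k, IsThetaLift F gt ζ (deck k ζ') (θh k)) ∧
        (Function.support fun k => crossing (θh k 0) (θh k 1)).Finite ∧
        v = ∑ᶠ k : ℤ, crossing (θh k 0) (θh k 1)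

open Classical in
/-- `λ_{f,F}(z, z') = λ(z, z', F, f⁻¹(F))`, for distinct points `z`, `z'` of `𝔻*`. -/
def lam (F : RadialFoliation) (f : ℂ → ℂ) (z z' : ℂ) : ℝ :=
  if h : ∃ v, IsLambdaValue F f z z' v then h.choose else 0

/-! ### The displacement function and `Λ` -/

/-- The half-open strip of the universal covering space between `T^k(φt)` and `T^(k+1)(φt)`. -/
def strip (φt : Set ℂ) (k : ℤ) : Set ℂ :=
  closure (leftSide (deck k '' φt)) ∩ rightSide (deck (k + 1) '' φt)

/-- `m` is the displacement at `z` of the lift `ft` with respect to the ray `φ`. -/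
def IsDisplacement (ft : ℂ → ℂ) (φ : Set ℂ) (z : ℂ) (m : ℤ) : Prop :=
  ∃ φt, IsLiftOfRay φt φ ∧ ∃ ζ, Complex.exp ζ = z ∧ ζ ∈ strip φt 0 ∧ ft ζ ∈ strip φt m

open Classical in
/-- The displacement function `m_{ft,φ}`. -/
def displacement (ft : ℂ → ℂ) (φ : Set ℂ) (z : ℂ) : ℤ :=
  if h : ∃ m, IsDisplacement ft φ z m then h.choose else 0

/-- `Λ_{ft,F,φ}(z, z') = λ_{f,F}(z, z') + m_{ft,φ}(z)`. -/
def Lam (F : RadialFoliation) (φ : Set ℂ) (f ft : ℂ → ℂ) (z z' : ℂ) : ℝ :=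
  lam F f z z' + displacement ft φ z

/-- The finite measure `μ_ω` on `𝔻*` defined by the area form. -/
def muOmega : Measure ℂ := (volume : Measure ℂ).restrict diskStar

/-- `W`: the pairs of distinct points of `𝔻*`. -/
def pairs : Set (ℂ × ℂ) := {p | p.1 ∈ diskStar ∧ p.2 ∈ diskStar ∧ p.1 ≠ p.2}

end CalabiRadial

end

/-!
# The Calabi invariant as the mean of `Λ` for a radial foliation

Let `J` be the isotopy in the class of `I` that fixes `0` and let `T = f × f` act on the pairs of
distinct points of the punctured disk. The first formula holds because `Λ` and `ang J` are
cohomologous (`Lam_eq`): `Λ = ang J + U - U ∘ T` for a measurable function `U`, which need not be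
integrable.

To find `U`, write `J_s(z') - J_s(z) = -J_s(z) (1 - J_s(z') / J_s(z))`. The variation of the angle
of the first factor is the displacement of the lift, hence `m_{ft,φ}(z)` up to a coboundary: the
index of the strip between translates of a lift of `φ`, corrected by the argument, is a function
`sheet` on `𝔻*` (`displacement_eq`). For the second factor, the foliation provides a branch of the
argument of `1 - z' / z` on the pairs such that `z'` does not come after `z` on the same leaf:
continue it along the leaf of `z'` from the centre, where it is `0` (`branch`). This branch is
continuous (`eventually_branch_eq`), since it can also be computed by pushing `z` along its leaf to
the circle. Its jump across the leaf of `z` is one turn; giving it the mean value there yields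
`beta`, which jumps by one half each time a lift of `z'` arrives on the half-leaf after a lift of
`z`, or leaves it (`PointLT.eventually_beta`). This is how the crossings of `4ℤ` by the discretized
angles are counted, so that `λ` is the variation of the angle of `1 - z' / z` up to the coboundary
of `beta` (`lam_eq`). The size of the jumps follows from the symmetry properties of the branch alone
(`Between.defect_eq`). Behind this are the facts that a lifted leaf separates the cover
(`Curve.mem_side_or`, `IsLiftedRay.disjoint_sides`), that leaves are ordered as they are met by a
transversal (`exists_box_below`), and that the variation of the angle of `1 - z' / z` along an
isotopy of `𝔻*` depends on its end only (`IsIdentityIsotopyStar.angleVariation_eq`).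

As `f` is a `C¹` diffeomorphism, `ang J` is bounded (`IsIdentityIsotopy.exists_bound_ang`). Hence
`U - U ∘ T` is integrable, and its integral vanishes because `T` preserves a finite measure, as is seen
by truncating `U` (`integral_coboundary`). So `Λ` and `ang J` have the same integral, and `ang` is
invariant under homotopy.

For a Hamiltonian isotopy the angle of `J_s(z') - J_s(z)` varies at the rate
`Im ((X_s(w') - X_s(w)) / (w' - w))`, where `w = J_s(z)` and `w' = J_s(z')`. By Fubini's theorem and the invariance of the
area, the Calabi invariant is `1 / 2π` times the integral of these rates over the pairs `(w, w')`;
each of the two ends contributes equally, and the Cauchy transform of the area, `∫ dA(w) / (w' - w) = π conj w'`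
(`integral_cauchy`), turns the integral into `2π ∫ ω(w, X_s(w)) = 2π ∫ dH_s(w) w`. An integration by
parts along the rays from the centre gives `-4π ∫ H_s` (`integral_fderivWithin_self`).
-/

noncomputable section

namespace CalabiRadial

/-! ### Continuous logarithms and the variation of the angle along a path -/

/-- A nowhere vanishing continuous function on a simply connected space has a continuous
logarithm. -/
theorem exists_continuous_log {E : Type*} [TopologicalSpace E] [SimplyConnectedSpace E]
    [LocallyPathConnectedSpace E] {g : E → ℂ} (hg : Continuous g) (h0 : ∀ x, g x ≠ 0) :
    ∃ L : E → ℂ, Continuous L ∧ ∀ x, Complex.exp (L x) = g x := by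
  obtain ⟨a⟩ : Nonempty E := inferInstance
  obtain ⟨F, ⟨-, hF⟩, -⟩ := Complex.isCoveringMapOn_exp.existsUnique_continuousMap_lifts
    (⟨g, hg⟩ : C(E, ℂ)) (a₀ := a) (e₀ := Complex.log (g a)) (by simp [Complex.exp_log (h0 a)])
    (fun x => by simpa using h0 x)
  exact ⟨F, F.continuous, fun x => congrFun hF x⟩

theorem eq_of_continuousOn_of_int {X : Type*} [TopologicalSpace X] {s : Set X}
    (hs : IsPreconnected s) {f : X → ℝ} (hf : ContinuousOn f s)
    (hint : ∀ x ∈ s, ∃ n : ℤ, f x = n) {x y : X} (hx : x ∈ s) (hy : y ∈ s) : f x = f y := by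
  have h1 : ContinuousOn (fun x => round (f x)) s := by
    rw [Int.isClosedEmbedding_coe_real.isInducing.continuousOn_iff]
    refine hf.congr fun x hx => ?_
    obtain ⟨n, hn⟩ := hint x hx
    simp [hn]
  have h2 : round (f x) = round (f y) := hs.constant h1 hx hy
  obtain ⟨n, hn⟩ := hint x hx
  obtain ⟨m, hm⟩ := hint y hy
  rw [hn, hm] at h2 ⊢
  simpa using h2

/-- Two continuous logarithms of the same function on a connected set differ by a constant. -/
theorem exists_int_of_exp_eq {X : Type*} [TopologicalSpace X] {s : Set X}
    (hs : IsPreconnected s) {L M : X → ℂ} (hL : ContinuousOn L s) (hM : ContinuousOn M s)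
    (h : ∀ x ∈ s, Complex.exp (L x) = Complex.exp (M x)) :
    ∃ n : ℤ, ∀ x ∈ s, L x = M x + n * (2 * π * Complex.I) := by
  rcases s.eq_empty_or_nonempty with rfl | ⟨a, ha⟩
  · exact ⟨0, by simp⟩
  have key : ∀ x ∈ s, ∃ n : ℤ, L x = M x + n * (2 * π * Complex.I) := fun x hx =>
    Complex.exp_eq_exp_iff_exists_int.1 (h x hx)
  have him : ∀ x ∈ s, ∀ n : ℤ, L x = M x + n * (2 * π * Complex.I) →
      ((L x).im - (M x).im) / (2 * π) = n := by
    intro x hx n hn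
    rw [hn]
    have := Real.pi_pos
    simp
  obtain ⟨n, hn⟩ := key a ha
  refine ⟨n, fun x hx => ?_⟩
  obtain ⟨m, hm⟩ := key x hx
  have := eq_of_continuousOn_of_int hs (f := fun x => ((L x).im - (M x).im) / (2 * π))
    (by
      refine ContinuousOn.div_const (ContinuousOn.sub ?_ ?_) _
      · exact Complex.continuous_im.comp_continuousOn hL
      · exact Complex.continuous_im.comp_continuousOn hM)
    (fun x hx => by
      obtain ⟨n, hn⟩ := key x hx
      exact ⟨n, him x hx n hn⟩) hx ha
  simp only [him x hx m hm, him a ha n hn] at this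
  have : m = n := by exact_mod_cast this
  rw [hm, this]

/-- As long as the exponential of a continuous function stays in the right half plane, its imaginary
part stays in one interval of length `π`. -/
theorem exists_int_of_re_exp_pos {X : Type*} [TopologicalSpace X] {s : Set X}
    (hs : IsPreconnected s) {L : X → ℂ} (hL : ContinuousOn L s)
    (h : ∀ x ∈ s, 0 < (Complex.exp (L x)).re) :
    ∃ n : ℤ, ∀ x ∈ s, |(L x).im - 2 * π * n| < π / 2 := by
  obtain ⟨n, hn⟩ := exists_int_of_exp_eq hs (M := fun x => Complex.log (Complex.exp (L x))) hL
    (ContinuousOn.clog (Complex.continuous_exp.comp_continuousOn hL)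
      fun x hx => Or.inl (h x hx))
    (fun x hx => by rw [Complex.exp_log (Complex.exp_ne_zero _)])
  refine ⟨n, fun x hx => ?_⟩
  have h1 : (L x).im - 2 * π * n = (Complex.exp (L x)).arg := by
    conv_lhs => rw [hn x hx]
    simp [Complex.log_im]
    ring
  rw [h1]
  exact Complex.abs_arg_lt_pi_div_two_iff.2 (Or.inl (h x hx))

theorem exists_log_Icc {γ : ℝ → ℂ} (hγ : ContinuousOn γ (Icc 0 1))
    (h0 : ∀ s ∈ Icc (0 : ℝ) 1, γ s ≠ 0) :
    ∃ L : ℝ → ℂ, ContinuousOn L (Icc 0 1) ∧ ∀ s ∈ Icc (0 : ℝ) 1, Complex.exp (L s) = γ s := by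
  obtain ⟨L, hL, h⟩ := exists_continuous_log (g := IccExtend zero_le_one (Icc (0 : ℝ) 1 |>.domRestrict γ))
    (continuousOn_iff_continuous_domRestrict.1 hγ).Icc_extend' (fun x => h0 _ (projIcc 0 1 _ x).2)
  refine ⟨L, hL.continuousOn, fun s hs => ?_⟩
  rw [h, IccExtend_of_mem _ _ hs]
  rfl

/-- A continuous logarithm of a map of the square: the map is first extended to the plane by retracting
the plane onto the square. -/
theorem exists_log_square {H : ℝ → ℝ → ℂ}
    (hH : ContinuousOn (fun p : ℝ × ℝ => H p.1 p.2) (Icc 0 1 ×ˢ Icc 0 1))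
    (h0 : ∀ r ∈ Icc (0 : ℝ) 1, ∀ s ∈ Icc (0 : ℝ) 1, H r s ≠ 0) :
    ∃ L : ℝ × ℝ → ℂ, Continuous L ∧
      ∀ r ∈ Icc (0 : ℝ) 1, ∀ s ∈ Icc (0 : ℝ) 1, Complex.exp (L (r, s)) = H r s := by
  let q : ℝ → ℝ := fun x => (projIcc 0 1 zero_le_one x : ℝ)
  have hq : Continuous q := continuous_subtype_val.comp continuous_projIcc
  have hqm : ∀ x, q x ∈ Icc (0 : ℝ) 1 := fun x => (projIcc 0 1 zero_le_one x).2
  obtain ⟨L, hL, h⟩ := exists_continuous_log (g := fun p : ℝ × ℝ => H (q p.1) (q p.2))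
    (hH.comp_continuous (f := fun p : ℝ × ℝ => (q p.1, q p.2)) (by fun_prop)
      (fun p => ⟨hqm _, hqm _⟩))
    (fun p => h0 _ (hqm _) _ (hqm _))
  refine ⟨L, hL, fun r hr s hs => ?_⟩
  rw [h]
  have e : ∀ x ∈ Icc (0 : ℝ) 1, q x = x := fun x hx => by
    simp only [q, projIcc_of_mem zero_le_one hx]
  simp only [e r hr, e s hs]

theorem isArgLift_of_log {γ : ℝ → ℂ} {L : ℝ → ℂ} (hL : ContinuousOn L (Icc 0 1))
    (h : ∀ s ∈ Icc (0 : ℝ) 1, Complex.exp (L s) = γ s) : IsArgLift γ fun s => (L s).im := by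
  refine ⟨Complex.continuous_im.comp_continuousOn hL, fun s hs => ?_⟩
  rw [← h s hs, Complex.norm_exp, Complex.ofReal_exp, ← Complex.exp_add, Complex.re_add_im]

theorem angleVariation_of_isArgLift {γ : ℝ → ℂ} {θ : ℝ → ℝ} (hθ : IsArgLift γ θ)
    (h0 : ∀ s ∈ Icc (0 : ℝ) 1, γ s ≠ 0) : angleVariation γ = (θ 1 - θ 0) / (2 * π) := by
  have h : ∃ θ, IsArgLift γ θ := ⟨θ, hθ⟩
  rw [angleVariation, dif_pos h]
  have hc := h.choose_spec
  set θ' := h.choose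
  obtain ⟨n, hn⟩ := exists_int_of_exp_eq (s := Icc (0 : ℝ) 1) isPreconnected_Icc
    (L := fun s => (θ' s : ℂ) * Complex.I) (M := fun s => (θ s : ℂ) * Complex.I)
    ((Complex.continuous_ofReal.comp_continuousOn hc.1).mul continuousOn_const)
    ((Complex.continuous_ofReal.comp_continuousOn hθ.1).mul continuousOn_const)
    (fun s hs => by
      have h1 := hc.2 s hs
      have h2 := hθ.2 s hs
      have h3 : (‖γ s‖ : ℂ) ≠ 0 := by simpa using h0 s hs
      exact mul_left_cancel₀ h3 (h1.symm.trans h2))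
  have key : ∀ s ∈ Icc (0 : ℝ) 1, θ' s = θ s + n * (2 * π) := fun s hs => by
    have := congrArg Complex.im (hn s hs)
    simpa using this
  rw [key 1 (by simp), key 0 (by simp)]
  ring

theorem angleVariation_of_log {γ : ℝ → ℂ} {L : ℝ → ℂ} (hL : ContinuousOn L (Icc 0 1))
    (h : ∀ s ∈ Icc (0 : ℝ) 1, Complex.exp (L s) = γ s) :
    angleVariation γ = ((L 1).im - (L 0).im) / (2 * π) :=
  angleVariation_of_isArgLift (isArgLift_of_log hL h)
    (fun s hs => by rw [← h s hs]; exact Complex.exp_ne_zero _)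

theorem angleVariation_congr {γ δ : ℝ → ℂ} (h : EqOn γ δ (Icc 0 1)) :
    angleVariation γ = angleVariation δ := by
  have : IsArgLift γ = IsArgLift δ := by
    funext θ
    refine propext ⟨fun ⟨h1, h2⟩ => ⟨h1, fun s hs => ?_⟩, fun ⟨h1, h2⟩ => ⟨h1, fun s hs => ?_⟩⟩
    · rw [← h hs]; exact h2 s hs
    · rw [h hs]; exact h2 s hs
  unfold angleVariation
  rw [this]

theorem angleVariation_const {c : ℂ} (hc : c ≠ 0) : angleVariation (fun _ => c) = 0 := by
  rw [angleVariation_of_log (L := fun _ => Complex.log c) continuousOn_const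
    (fun s _ => Complex.exp_log hc)]
  simp

theorem angleVariation_mul {γ δ : ℝ → ℂ} (hγ : ContinuousOn γ (Icc 0 1))
    (hγ0 : ∀ s ∈ Icc (0 : ℝ) 1, γ s ≠ 0) (hδ : ContinuousOn δ (Icc 0 1))
    (hδ0 : ∀ s ∈ Icc (0 : ℝ) 1, δ s ≠ 0) :
    angleVariation (fun s => γ s * δ s) = angleVariation γ + angleVariation δ := by
  obtain ⟨L, hL, h⟩ := exists_log_Icc hγ hγ0
  obtain ⟨M, hM, h'⟩ := exists_log_Icc hδ hδ0
  rw [angleVariation_of_log hL h, angleVariation_of_log hM h',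
    angleVariation_of_log (L := fun s => L s + M s) (hL.add hM)
      (fun s hs => by rw [Complex.exp_add, h s hs, h' s hs])]
  simp only [Complex.add_im]
  ring

theorem angleVariation_of_slitPlane {γ : ℝ → ℂ} (hγ : ContinuousOn γ (Icc 0 1))
    (h : ∀ s ∈ Icc (0 : ℝ) 1, γ s ∈ Complex.slitPlane) :
    angleVariation γ = ((γ 1).arg - (γ 0).arg) / (2 * π) := by
  rw [angleVariation_of_log (L := fun s => Complex.log (γ s)) (hγ.clog h)
    (fun s hs => Complex.exp_log (Complex.slitPlane_ne_zero (h s hs)))]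
  simp [Complex.log_im]

/-- The variation of the angle along the boundary of a square vanishes if the map does not vanish on
the square. -/
theorem angleVariation_square {H : ℝ → ℝ → ℂ}
    (hH : ContinuousOn (fun p : ℝ × ℝ => H p.1 p.2) (Icc 0 1 ×ˢ Icc 0 1))
    (h0 : ∀ r ∈ Icc (0 : ℝ) 1, ∀ s ∈ Icc (0 : ℝ) 1, H r s ≠ 0) :
    angleVariation (H 0) + angleVariation (fun r => H r 1) =
      angleVariation (fun r => H r 0) + angleVariation (H 1) := by
  obtain ⟨L, hL, h⟩ := exists_log_square hH h0
  rw [angleVariation_of_log (L := fun s => L (0, s)) (by fun_prop) (fun s hs => h 0 (by simp) s hs),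
    angleVariation_of_log (L := fun s => L (1, s)) (by fun_prop) (fun s hs => h 1 (by simp) s hs),
    angleVariation_of_log (L := fun s => L (s, 0)) (by fun_prop) (fun s hs => h s hs 0 (by simp)),
    angleVariation_of_log (L := fun s => L (s, 1)) (by fun_prop) (fun s hs => h s hs 1 (by simp))]
  ring

/-- `a` is an argument of `w`, measured in turns. -/
def IsTurn (a : ℝ) (w : ℂ) : Prop :=
  ∃ c : ℝ, 0 < c ∧ w = c * Complex.exp (2 * π * a * Complex.I)

theorem IsTurn.mul {a b : ℝ} {w v : ℂ} (h : IsTurn a w) (h' : IsTurn b v) :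
    IsTurn (a + b) (w * v) := by
  obtain ⟨c, hc, rfl⟩ := h
  obtain ⟨d, hd, rfl⟩ := h'
  refine ⟨c * d, mul_pos hc hd, ?_⟩
  push_cast
  rw [mul_add, add_mul, Complex.exp_add]
  ring

theorem IsTurn.sub_int {a b : ℝ} {w : ℂ} (h : IsTurn a w) (h' : IsTurn b w) :
    ∃ n : ℤ, a = b + n := by
  obtain ⟨c, hc, rfl⟩ := h
  obtain ⟨d, hd, h⟩ := h'
  have hn := congrArg norm h
  have e : ∀ x : ℝ, (2 * π * x * Complex.I : ℂ) = ((2 * π * x : ℝ) : ℂ) * Complex.I := by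
    intro x; push_cast; ring
  rw [norm_mul, norm_mul, e, e, Complex.norm_exp_ofReal_mul_I, Complex.norm_exp_ofReal_mul_I] at hn
  simp only [Complex.norm_real, Real.norm_eq_abs, abs_of_pos hc, abs_of_pos hd, mul_one] at hn
  subst hn
  obtain ⟨n, hn⟩ := Complex.exp_eq_exp_iff_exists_int.1
    (mul_left_cancel₀ (by exact_mod_cast hc.ne') h)
  refine ⟨n, ?_⟩
  have h2 := congrArg Complex.im hn
  simp at h2
  have := Real.pi_pos
  have h3 : (2 * π) * a = (2 * π) * (b + n) := by linarith
  exact mul_left_cancel₀ (by positivity) h3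

theorem isTurn_exp (ζ : ℂ) : IsTurn (ζ.im / (2 * π)) (Complex.exp ζ) := by
  refine ⟨Real.exp ζ.re, Real.exp_pos _, ?_⟩
  have : (2 * π * ((ζ.im / (2 * π) : ℝ) : ℂ) * Complex.I : ℂ) = ζ.im * Complex.I := by
    push_cast
    have : (π : ℂ) ≠ 0 := by exact_mod_cast Real.pi_ne_zero
    field_simp
  rw [this, Complex.ofReal_exp, ← Complex.exp_add, Complex.re_add_im]

theorem isTurn_half_neg_one : IsTurn (1 / 2) (-1) :=
  ⟨1, one_pos, by
    have : (2 * π * ((1 / 2 : ℝ) : ℂ) * Complex.I : ℂ) = π * Complex.I := by push_cast; ring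
    rw [this, Complex.exp_pi_mul_I]; simp⟩

theorem isTurn_angleVariation {γ : ℝ → ℂ} (hγ : ContinuousOn γ (Icc 0 1))
    (h0 : ∀ s ∈ Icc (0 : ℝ) 1, γ s ≠ 0) : IsTurn (angleVariation γ) (γ 1 / γ 0) := by
  obtain ⟨L, hL, h⟩ := exists_log_Icc hγ h0
  rw [angleVariation_of_log hL h, ← h 0 (by simp), ← h 1 (by simp), ← Complex.exp_sub,
    ← Complex.sub_im]
  exact isTurn_exp _

/-- A bound for the variation of the angle in terms of a modulus of continuity. -/
theorem abs_angleVariation_le {γ : ℝ → ℂ} (hγ : ContinuousOn γ (Icc 0 1)) (N : ℕ) (hN : 0 < N)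
    (h : ∀ s ∈ Icc (0 : ℝ) 1, ∀ t ∈ Icc (0 : ℝ) 1, |s - t| ≤ 1 / N → ‖γ s - γ t‖ < ‖γ s‖) :
    |angleVariation γ| ≤ N := by
  have hN' : (0 : ℝ) < N := by exact_mod_cast hN
  have h0 : ∀ s ∈ Icc (0 : ℝ) 1, γ s ≠ 0 := fun s hs => by
    have := h s hs s hs (by simp)
    simpa using this
  obtain ⟨L, hL, hLγ⟩ := exists_log_Icc hγ h0
  have hp := Real.pi_pos
  -- On each of the `N` subintervals the path stays in a half plane, so its angle varies by at most `π`.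
  have step : ∀ i : ℕ, i ≤ N → |(L (i / N)).im - (L 0).im| ≤ i * π := by
    intro i
    induction i with
    | zero => simp
    | succ i ih =>
      intro hi
      have h1 := ih (by omega)
      have hi' : (i : ℝ) + 1 ≤ N := by exact_mod_cast hi
      have hsub : Icc (i / N : ℝ) ((i + 1) / N) ⊆ Icc 0 1 := by
        apply Icc_subset_Icc
        · positivity
        · rw [div_le_one hN']; exact hi'
      have hmi : (i / N : ℝ) ∈ Icc (i / N : ℝ) ((i + 1) / N) := ⟨le_rfl, by gcongr; linarith⟩
      have hmi' : ((i + 1) / N : ℝ) ∈ Icc (i / N : ℝ) ((i + 1) / N) := ⟨by gcongr; linarith, le_rfl⟩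
      obtain ⟨n, hn⟩ := exists_int_of_re_exp_pos (s := Icc (i / N : ℝ) ((i + 1) / N))
        isPreconnected_Icc (L := fun t => L t - L (i / N))
        ((hL.mono hsub).sub continuousOn_const)
        (fun t ht => by
          have h2 := h _ (hsub hmi) t (hsub ht) (by
            rw [abs_sub_comm, abs_of_nonneg (by linarith [ht.1])]
            have := ht.2
            rw [add_div] at this
            linarith)
          have hne := h0 _ (hsub hmi)
          rw [Complex.exp_sub, hLγ _ (hsub ht), hLγ _ (hsub hmi)]
          have h3 : ‖1 - γ t / γ (i / N)‖ < 1 := by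
            rw [← div_self hne, ← sub_div, norm_div, div_lt_one (norm_pos_iff.2 hne)]
            exact h2
          have h4 := (Complex.abs_re_le_norm _).trans_lt h3
          rw [abs_lt] at h4
          simp only [Complex.sub_re, Complex.one_re] at h4
          linarith)
      have h2 := hn _ hmi
      have h3 := hn _ hmi'
      simp only [Complex.sub_im, sub_self, Complex.zero_im] at h2 h3
      push_cast
      rw [abs_lt] at h2 h3
      rw [abs_le] at h1 ⊢
      constructor <;> linarith
  have := step N le_rfl
  rw [div_self hN'.ne'] at this
  rw [angleVariation_of_log hL hLγ, abs_div, abs_of_pos (by positivity : 0 < 2 * π),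
    div_le_iff₀ (by positivity)]
  nlinarith

/-! ### Rays, lifted rays and lifted leaves -/

/-- The image of a closed set of times is closed at the points near which the curve passes during a
compact interval of times only. -/
theorem mem_image_of_mem_closure {γ : ℝ → ℂ} (hγ : Continuous γ) {S : Set ℝ} (hS : IsClosed S)
    {w : ℂ} {O : Set ℂ} (hO : O ∈ 𝓝 w) {a b : ℝ} (hab : ∀ t, γ t ∈ O → t ∈ Icc a b)
    (hw : w ∈ closure (γ '' S)) : w ∈ γ '' S := by
  have hc : IsCompact (γ '' (S ∩ Icc a b)) := (isCompact_Icc.inter_left hS).image hγ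
  have : w ∈ closure (γ '' (S ∩ Icc a b)) := by
    rw [mem_closure_iff_nhds] at hw ⊢
    intro t ht
    obtain ⟨x, ⟨hx1, hx2⟩, y, hy, rfl⟩ := hw (t ∩ O) (inter_mem ht hO)
    exact ⟨_, hx1, y, ⟨hy, hab _ hx2⟩, rfl⟩
  rw [hc.isClosed.closure_eq] at this
  exact image_mono inter_subset_left this

theorem exp_mem_diskStar {ζ : ℂ} : Complex.exp ζ ∈ diskStar ↔ ζ ∈ cover := by
  simp [diskStar, cover, Complex.norm_exp]

theorem log_mem_cover {z : ℂ} (hz : z ∈ diskStar) : Complex.log z ∈ cover := by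
  rw [← exp_mem_diskStar, Complex.exp_log (norm_pos_iff.1 hz.1)]
  exact hz

theorem ne_zero_of_mem_diskStar {z : ℂ} (hz : z ∈ diskStar) : z ≠ 0 := norm_pos_iff.1 hz.1

theorem isOpen_diskStar : IsOpen diskStar :=
  (isOpen_lt continuous_const continuous_norm).inter (isOpen_lt continuous_norm continuous_const)

theorem isOpen_cover : IsOpen cover := isOpen_lt Complex.continuous_re continuous_const

/-- A ray is proper in `𝔻*`: it visits the neighbourhood of a point during a compact time interval. -/
theorem IsRay.exists_Icc {γ : ℝ → ℂ} (h : IsRay γ) {w : ℂ} (hw : w ∈ diskStar) :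
    ∃ O ∈ 𝓝 w, ∃ a b : ℝ, ∀ t, γ t ∈ O → t ∈ Icc a b := by
  have h1 : ∀ᶠ t in atBot, ‖γ t‖ < ‖w‖ / 2 := by
    have := h.past.norm
    rw [norm_zero] at this
    exact this.eventually_lt_const (by linarith [hw.1])
  have h2 : ∀ᶠ t in atTop, (1 + ‖w‖) / 2 < ‖γ t‖ :=
    h.future.eventually_const_lt (by linarith [hw.2])
  obtain ⟨a, ha⟩ := eventually_atBot.1 h1
  obtain ⟨b, hb⟩ := eventually_atTop.1 h2
  refine ⟨{v | ‖w‖ / 2 < ‖v‖ ∧ ‖v‖ < (1 + ‖w‖) / 2}, ?_, a, b, fun t ht => ⟨?_, ?_⟩⟩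
  · refine IsOpen.mem_nhds ((isOpen_lt continuous_const continuous_norm).inter
      (isOpen_lt continuous_norm continuous_const)) ⟨?_, ?_⟩ <;>
    · linarith [hw.1, hw.2]
  · by_contra hc
    exact (ha t (not_le.1 hc).le).not_gt ht.1
  · by_contra hc
    exact (hb t (not_le.1 hc).le).not_gt ht.2

/-- A ray is an embedding: a time parameter of a continuous map into a ray is continuous. -/
theorem IsRay.continuous_of_comp {X : Type*} [TopologicalSpace X] {γ : ℝ → ℂ} (h : IsRay γ)
    {p : X → ℂ} (hp : Continuous p) {u : X → ℝ} (hu : ∀ x, p x = γ (u x)) : Continuous u := by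
  have key : ∀ S : Set ℝ, IsClosed S → IsClosed (u ⁻¹' S) := by
    intro S hS
    refine isClosed_of_closure_subset fun x hx => ?_
    have h1 : p x ∈ closure (γ '' S) := by
      refine closure_mono ?_ (image_closure_subset_closure_image hp (mem_image_of_mem p hx))
      rintro _ ⟨y, hy, rfl⟩
      exact ⟨u y, hy, (hu y).symm⟩
    obtain ⟨O, hO, a, b, hab⟩ := h.exists_Icc (h.mem (u x))
    rw [hu] at h1
    obtain ⟨s, hs, he⟩ := mem_image_of_mem_closure h.continuous hS hO hab h1
    rw [h.injective he] at hs
    exact hs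
  exact continuous_iff_isClosed.2 key

/-- Two parametrizations of a ray differ by an increasing change of parameter. -/
theorem IsRay.exists_reparam {γ δ : ℝ → ℂ} (hγ : IsRay γ) (hδ : IsRay δ)
    (h : range δ ⊆ range γ) : ∃ u : ℝ → ℝ, StrictMono u ∧ Continuous u ∧ ∀ t, δ t = γ (u t) := by
  choose u hu using fun t => h (mem_range_self (f := δ) t)
  have huc : Continuous u := hγ.continuous_of_comp hδ.continuous (fun t => (hu t).symm)
  have hinj : Function.Injective u := fun s t hst => hδ.injective (by rw [← hu, ← hu, hst])
  rcases huc.strictMono_of_inj hinj with hm | hm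
  · exact ⟨u, hm, huc, fun t => (hu t).symm⟩
  -- A decreasing change of parameter would keep the past of `δ` away from `0`.
  · exfalso
    have h2 : ∀ᶠ t in atTop, 1 / 2 < ‖γ t‖ := hγ.future.eventually_const_lt (by norm_num)
    obtain ⟨b, hb⟩ := eventually_atTop.1 h2
    obtain ⟨m, hm', hmin⟩ := (isCompact_Icc (a := min (u 0) b) (b := b)).exists_isMinOn
      (nonempty_Icc.2 (min_le_right _ _)) (hγ.continuous.norm.continuousOn)
    have hpos : 0 < min (1 / 2) ‖γ m‖ := lt_min (by norm_num) (hγ.mem m).1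
    have h1 : ∀ᶠ t in atBot, ‖δ t‖ < min (1 / 2) ‖γ m‖ := by
      have := hδ.past.norm
      rw [norm_zero] at this
      exact this.eventually_lt_const hpos
    obtain ⟨t, ht, ht0⟩ := (h1.and (eventually_le_atBot 0)).exists
    have hut : u 0 ≤ u t := hm.antitone ht0
    rw [← hu t] at ht
    rcases le_total b (u t) with hbt | hbt
    · exact absurd (hb _ hbt) (by linarith [min_le_left (1 / 2) ‖γ m‖])
    · have := hmin (⟨(min_le_left _ _).trans hut, hbt⟩ : u t ∈ Icc (min (u 0) b) b)
      simp only [mem_ofPred_eq] at this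
      linarith [min_le_right (1 / 2) ‖γ m‖]

theorem exists_continuous_log_through {E : Type*} [TopologicalSpace E] [SimplyConnectedSpace E]
    [LocallyPathConnectedSpace E] {g : E → ℂ} (hg : Continuous g) (h0 : ∀ x, g x ≠ 0) {a : E}
    {ζ : ℂ} (hζ : Complex.exp ζ = g a) :
    ∃ L : E → ℂ, Continuous L ∧ (∀ x, Complex.exp (L x) = g x) ∧ L a = ζ := by
  obtain ⟨L, hL, h⟩ := exists_continuous_log hg h0
  obtain ⟨n, hn⟩ := Complex.exp_eq_exp_iff_exists_int.1 (hζ.trans (h a).symm)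
  refine ⟨fun x => L x + n * (2 * π * Complex.I), by fun_prop, fun x => ?_, hn.symm⟩
  rw [Complex.exp_add, Complex.exp_int_mul_two_pi_mul_I, mul_one, h]

theorem eq_of_exp_eq {E : Type*} [TopologicalSpace E] [PreconnectedSpace E] {L M : E → ℂ}
    (hL : Continuous L) (hM : Continuous M) (h : ∀ x, Complex.exp (L x) = Complex.exp (M x)) {a : E}
    (ha : L a = M a) : L = M := by
  obtain ⟨n, hn⟩ := exists_int_of_exp_eq isPreconnected_univ hL.continuousOn hM.continuousOn
    (fun x _ => h x)
  have h1 := hn a (mem_univ _)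
  rw [ha] at h1
  have h2 : (n : ℂ) * (2 * π * Complex.I) = 0 := by linear_combination -h1
  funext x
  rw [hn x (mem_univ _), h2, add_zero]

theorem IsRay.exists_lift {γ : ℝ → ℂ} (h : IsRay γ) {t : ℝ} {ζ : ℂ} (hζ : Complex.exp ζ = γ t) :
    ∃ γt, IsLiftedRay γt ∧ (∀ s, Complex.exp (γt s) = γ s) ∧ γt t = ζ := by
  obtain ⟨L, hL, he, ha⟩ := exists_continuous_log_through h.continuous
    (fun x => ne_zero_of_mem_diskStar (h.mem x)) hζ
  refine ⟨L, ⟨hL, fun t => ?_, ?_⟩, he, ha⟩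
  · rw [← exp_mem_diskStar, he]; exact h.mem t
  · simpa only [he] using h

theorem IsLiftedRay.re_eq {γ : ℝ → ℂ} (t : ℝ) :
    (γ t).re = Real.log ‖Complex.exp (γ t)‖ := by
  rw [Complex.norm_exp, Real.log_exp]

theorem IsLiftedRay.tendsto_re_atBot {γ : ℝ → ℂ} (h : IsLiftedRay γ) :
    Tendsto (fun t => (γ t).re) atBot atBot := by
  have h1 : Tendsto (fun t => ‖Complex.exp (γ t)‖) atBot (𝓝[>] 0) := by
    refine tendsto_nhdsWithin_iff.2 ⟨?_, Eventually.of_forall fun t => (h.isRay.mem t).1⟩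
    simpa using h.isRay.past.norm
  simp only [IsLiftedRay.re_eq]
  exact Real.tendsto_log_nhdsGT_zero.comp h1

theorem IsLiftedRay.tendsto_re_atTop {γ : ℝ → ℂ} (h : IsLiftedRay γ) :
    Tendsto (fun t => (γ t).re) atTop (𝓝 0) := by
  have := (Real.continuousAt_log one_ne_zero).tendsto.comp h.isRay.future
  rw [Real.log_one] at this
  simp only [IsLiftedRay.re_eq]
  exact this

theorem IsLiftedRay.injective {γ : ℝ → ℂ} (h : IsLiftedRay γ) : Function.Injective γ :=
  fun s t hst => h.isRay.injective (by simp only [hst])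

/-- A lifted ray is proper: it meets a vertical strip in a compact set. -/
theorem IsLiftedRay.exists_Icc {γ : ℝ → ℂ} (h : IsLiftedRay γ) (c : ℝ) {d : ℝ} (hd : d < 0) :
    ∃ a b : ℝ, ∀ t, c ≤ (γ t).re → (γ t).re ≤ d → t ∈ Icc a b := by
  obtain ⟨a, ha⟩ := eventually_atBot.1 (h.tendsto_re_atBot.eventually_lt_atBot c)
  obtain ⟨b, hb⟩ := eventually_atTop.1 (h.tendsto_re_atTop.eventually_const_lt hd)
  refine ⟨a, b, fun t h1 h2 => ⟨?_, ?_⟩⟩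
  · by_contra hc
    exact (ha t (not_le.1 hc).le).not_ge h1
  · by_contra hc
    exact (hb t (not_le.1 hc).le).not_ge h2

theorem IsLiftedRay.mem_image_of_mem_closure {γ : ℝ → ℂ} (h : IsLiftedRay γ) {S : Set ℝ}
    (hS : IsClosed S) {ζ : ℂ} (hζ : ζ ∈ cover) (hc : ζ ∈ closure (γ '' S)) : ζ ∈ γ '' S := by
  have hζ' : ζ.re < 0 := hζ
  obtain ⟨a, b, hab⟩ := h.exists_Icc (ζ.re - 1) (d := ζ.re / 2) (by linarith)
  refine CalabiRadial.mem_image_of_mem_closure h.continuous hS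
    (O := {w | ζ.re - 1 < w.re ∧ w.re < ζ.re / 2}) ?_ (fun t ht => hab t ht.1.le ht.2.le) hc
  refine IsOpen.mem_nhds ((isOpen_lt continuous_const Complex.continuous_re).inter
      (isOpen_lt Complex.continuous_re continuous_const)) ⟨?_, ?_⟩ <;>
    · linarith

theorem exp_deck (k : ℤ) (ζ : ℂ) : Complex.exp (deck k ζ) = Complex.exp ζ := by
  have : deck k ζ = ζ + k * (2 * π * Complex.I) := by simp only [deck]; ring
  rw [this, Complex.exp_add, Complex.exp_int_mul_two_pi_mul_I, mul_one]

theorem exists_deck_of_exp_eq {ζ ζ' : ℂ} (h : Complex.exp ζ' = Complex.exp ζ) :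
    ∃ k, ζ' = deck k ζ := by
  obtain ⟨n, hn⟩ := Complex.exp_eq_exp_iff_exists_int.1 h
  exact ⟨n, by rw [hn, deck]; ring⟩

@[simp] theorem deck_re (k : ℤ) (ζ : ℂ) : (deck k ζ).re = ζ.re := by simp [deck]

@[simp] theorem deck_im (k : ℤ) (ζ : ℂ) : (deck k ζ).im = ζ.im + 2 * π * k := by simp [deck]

theorem deck_deck (k l : ℤ) (ζ : ℂ) : deck k (deck l ζ) = deck (k + l) ζ := by
  simp only [deck]; push_cast; ring

@[simp] theorem deck_zero (ζ : ℂ) : deck 0 ζ = ζ := by simp [deck]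

theorem deck_mem_cover {k : ℤ} {ζ : ℂ} : deck k ζ ∈ cover ↔ ζ ∈ cover := by simp [cover]

theorem continuous_deck (k : ℤ) : Continuous (deck k) := by unfold deck; fun_prop

theorem deck_injective (k : ℤ) : Function.Injective (deck k) := fun a b h => by
  simpa [deck] using h

theorem deck_image_eq_preimage (k : ℤ) (s : Set ℂ) : deck k '' s = deck (-k) ⁻¹' s :=
  congrFun (image_eq_preimage_of_inverse (fun x => by simp [deck_deck])
    (fun x => by simp [deck_deck])) s

/-- A parametrized leaf of the lifted foliation. -/
def RadialFoliation.Curve (F : RadialFoliation) (γ : ℝ → ℂ) : Prop :=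
  IsLiftedRay γ ∧ (range fun t => Complex.exp (γ t)) ∈ F.leaves

variable {F : RadialFoliation}

theorem RadialFoliation.exists_curve (F : RadialFoliation) {ζ : ℂ} (hζ : ζ ∈ cover) :
    ∃ γ t, F.Curve γ ∧ γ t = ζ := by
  obtain ⟨φ, ⟨hφ, hz⟩, -⟩ := F.partition _ (exp_mem_diskStar.2 hζ)
  obtain ⟨γ, hγ, rfl⟩ := F.exists_ray φ hφ
  obtain ⟨t, ht⟩ := hz
  obtain ⟨γt, h1, h2, h3⟩ := hγ.exists_lift ht.symm
  exact ⟨γt, t, ⟨h1, by simpa only [h2] using hφ⟩, h3⟩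

theorem RadialFoliation.leaf_unique {φ ψ : Set ℂ} (hφ : φ ∈ F.leaves) (hψ : ψ ∈ F.leaves) {z : ℂ}
    (h : z ∈ φ) (h' : z ∈ ψ) : φ = ψ := by
  obtain ⟨γ, hγ, rfl⟩ := F.exists_ray φ hφ
  obtain ⟨t, rfl⟩ := h
  exact (F.partition _ (hγ.mem t)).unique ⟨hφ, mem_range_self t⟩ ⟨hψ, h'⟩

/-- Two parametrized leaves with a common point differ by an increasing change of parameter. -/
theorem RadialFoliation.Curve.exists_reparam {γ δ : ℝ → ℂ} (hγ : F.Curve γ) (hδ : F.Curve δ)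
    {s t : ℝ} (h : γ s = δ t) :
    ∃ u : ℝ → ℝ, StrictMono u ∧ Continuous u ∧ ∀ t, δ t = γ (u t) := by
  have he := F.leaf_unique hγ.2 hδ.2 (z := Complex.exp (γ s)) ⟨s, rfl⟩ ⟨t, by simp only [h]⟩
  obtain ⟨u, hu, huc, h1⟩ := hγ.1.isRay.exists_reparam hδ.1.isRay he.ge
  have hs : u t = s := hγ.1.isRay.injective (by rw [← h1 t]; simp only [h])
  have := eq_of_exp_eq hδ.1.continuous (hγ.1.continuous.comp huc) h1 (a := t)
    (by simp only [Function.comp, hs, h])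
  exact ⟨u, hu, huc, fun t => congrFun this t⟩

theorem RadialFoliation.Curve.range_eq {γ δ : ℝ → ℂ} (hγ : F.Curve γ) (hδ : F.Curve δ)
    {s t : ℝ} (h : γ s = δ t) : range γ = range δ := by
  apply Subset.antisymm
  · obtain ⟨u, -, -, hu⟩ := hδ.exists_reparam hγ h.symm
    rintro _ ⟨t, rfl⟩
    exact ⟨u t, (hu t).symm⟩
  · obtain ⟨u, -, -, hu⟩ := hγ.exists_reparam hδ h
    rintro _ ⟨t, rfl⟩
    exact ⟨u t, (hu t).symm⟩

theorem IsLiftOfRay.exists_curve {φt φ : Set ℂ} (hφ : φ ∈ F.leaves) (h : IsLiftOfRay φt φ) :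
    ∃ γ, F.Curve γ ∧ range γ = φt := by
  obtain ⟨γ, hγ, rfl, rfl⟩ := h
  exact ⟨γ, ⟨hγ, by rw [← range_comp] at hφ; exact hφ⟩, rfl⟩

theorem RadialFoliation.Curve.isLiftOfRay {γ : ℝ → ℂ} (hγ : F.Curve γ) :
    IsLiftOfRay (range γ) (range fun t => Complex.exp (γ t)) :=
  ⟨γ, hγ.1, rfl, by rw [← range_comp]; rfl⟩

theorem RadialFoliation.Curve.liftedLeaf_eq {γ : ℝ → ℂ} (hγ : F.Curve γ) (t : ℝ) :
    F.liftedLeaf (γ t) = range γ := by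
  apply Subset.antisymm
  · refine sUnion_subset ?_
    rintro φt ⟨ht, φ, hφ, hl⟩
    obtain ⟨δ, hδ, rfl⟩ := hl.exists_curve hφ
    obtain ⟨s, hs⟩ := ht
    exact (hδ.range_eq hγ hs).le
  · exact subset_sUnion_of_mem ⟨mem_range_self t, _, hγ.2, hγ.isLiftOfRay⟩

theorem RadialFoliation.exists_curve_eq (F : RadialFoliation) {ζ : ℂ} (hζ : ζ ∈ cover) :
    ∃ γ t, F.Curve γ ∧ γ t = ζ ∧ F.liftedLeaf ζ = range γ := by
  obtain ⟨γ, t, hγ, rfl⟩ := F.exists_curve hζ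
  exact ⟨γ, t, hγ, rfl, hγ.liftedLeaf_eq t⟩

theorem RadialFoliation.mem_liftedLeaf (F : RadialFoliation) {ζ : ℂ} (hζ : ζ ∈ cover) :
    ζ ∈ F.liftedLeaf ζ := by
  obtain ⟨γ, t, -, h, h'⟩ := F.exists_curve_eq hζ
  rw [h']
  exact ⟨t, h⟩

theorem RadialFoliation.liftedLeaf_subset (F : RadialFoliation) (ζ : ℂ) :
    F.liftedLeaf ζ ⊆ cover := by
  refine sUnion_subset ?_
  rintro φt ⟨-, φ, hφ, γ, hγ, rfl, -⟩
  rintro _ ⟨t, rfl⟩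
  exact hγ.mem t

theorem RadialFoliation.liftedLeaf_eq_of_mem {ζ ζ' : ℂ} (hζ : ζ ∈ cover)
    (h : ζ' ∈ F.liftedLeaf ζ) : F.liftedLeaf ζ' = F.liftedLeaf ζ := by
  obtain ⟨γ, t, hγ, rfl, h'⟩ := F.exists_curve_eq hζ
  rw [h'] at h ⊢
  obtain ⟨s, rfl⟩ := h
  exact hγ.liftedLeaf_eq s

theorem IsLiftedRay.deck {γ : ℝ → ℂ} (h : IsLiftedRay γ) (k : ℤ) :
    IsLiftedRay fun t => deck k (γ t) :=
  ⟨(continuous_deck k).comp h.continuous, fun t => deck_mem_cover.2 (h.mem t), by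
    simpa only [exp_deck] using h.isRay⟩

theorem RadialFoliation.Curve.deck {γ : ℝ → ℂ} (hγ : F.Curve γ) (k : ℤ) :
    F.Curve fun t => deck k (γ t) :=
  ⟨hγ.1.deck k, by simpa only [exp_deck] using hγ.2⟩

theorem RadialFoliation.liftedLeaf_deck (F : RadialFoliation) (k : ℤ) {ζ : ℂ} (hζ : ζ ∈ cover) :
    F.liftedLeaf (deck k ζ) = deck k '' F.liftedLeaf ζ := by
  obtain ⟨γ, t, hγ, rfl, h'⟩ := F.exists_curve_eq hζ
  rw [h', (hγ.deck k).liftedLeaf_eq t, ← range_comp]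
  rfl

theorem RadialFoliation.Curve.pointLT_iff {γ : ℝ → ℂ} (hγ : F.Curve γ) {s : ℝ} {ζ : ℂ} :
    F.PointLT (γ s) ζ ↔ ∃ t, s < t ∧ γ t = ζ := by
  constructor
  · rintro ⟨δ, hδ, hδF, a, b, hab, ha, rfl⟩
    have hδ' : F.Curve δ := ⟨hδ, hδF⟩
    obtain ⟨u, hu, -, h⟩ := hγ.exists_reparam hδ' ha.symm
    have : u a = s := hγ.1.injective (by rw [← h, ha])
    exact ⟨u b, this ▸ hu hab, (h b).symm⟩
  · rintro ⟨t, hst, rfl⟩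
    exact ⟨γ, hγ.1, hγ.2, s, t, hst, rfl, rfl⟩

theorem RadialFoliation.Curve.pointLT_iff_lt {γ : ℝ → ℂ} (hγ : F.Curve γ) {s t : ℝ} :
    F.PointLT (γ s) (γ t) ↔ s < t := by
  rw [hγ.pointLT_iff]
  exact ⟨fun ⟨r, h, e⟩ => hγ.1.injective e ▸ h, fun h => ⟨t, h, rfl⟩⟩

theorem RadialFoliation.PointLT.exists_curve {ζ ζ' : ℂ} (h : F.PointLT ζ ζ') :
    ∃ γ s t, F.Curve γ ∧ s < t ∧ γ s = ζ ∧ γ t = ζ' := by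
  obtain ⟨γ, h1, h2, s, t, h3, h4, h5⟩ := h
  exact ⟨γ, s, t, ⟨h1, h2⟩, h3, h4, h5⟩

theorem RadialFoliation.PointLT.left_mem {ζ ζ' : ℂ} (h : F.PointLT ζ ζ') : ζ ∈ cover := by
  obtain ⟨γ, s, t, hγ, -, rfl, -⟩ := h.exists_curve
  exact hγ.1.mem s

theorem RadialFoliation.PointLT.right_mem {ζ ζ' : ℂ} (h : F.PointLT ζ ζ') : ζ' ∈ cover := by
  obtain ⟨γ, s, t, hγ, -, -, rfl⟩ := h.exists_curve
  exact hγ.1.mem t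

theorem RadialFoliation.PointLT.trans {a b c : ℂ} (h : F.PointLT a b) (h' : F.PointLT b c) :
    F.PointLT a c := by
  obtain ⟨γ, s, t, hγ, hst, rfl, rfl⟩ := h.exists_curve
  obtain ⟨r, hr, rfl⟩ := hγ.pointLT_iff.1 h'
  exact hγ.pointLT_iff_lt.2 (hst.trans hr)

theorem RadialFoliation.pointLT_irrefl (a : ℂ) : ¬ F.PointLT a a := fun h => by
  obtain ⟨γ, s, t, hγ, hst, rfl, he⟩ := h.exists_curve
  exact hst.ne' (hγ.1.injective he)

theorem RadialFoliation.PointLT.mem_liftedLeaf {ζ ζ' : ℂ} (h : F.PointLT ζ ζ') :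
    ζ' ∈ F.liftedLeaf ζ := by
  obtain ⟨γ, s, t, hγ, -, rfl, rfl⟩ := h.exists_curve
  rw [hγ.liftedLeaf_eq]
  exact mem_range_self t

theorem RadialFoliation.PointLT.mem_liftedLeaf' {ζ ζ' : ℂ} (h : F.PointLT ζ ζ') :
    ζ ∈ F.liftedLeaf ζ' := by
  obtain ⟨γ, s, t, hγ, -, rfl, rfl⟩ := h.exists_curve
  rw [hγ.liftedLeaf_eq]
  exact mem_range_self s

theorem RadialFoliation.pointLT_or {ζ ζ' : ℂ} (hζ : ζ ∈ cover) (h : ζ' ∈ F.liftedLeaf ζ) :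
    F.PointLT ζ ζ' ∨ ζ' = ζ ∨ F.PointLT ζ' ζ := by
  obtain ⟨γ, t, hγ, rfl, h'⟩ := F.exists_curve_eq hζ
  rw [h'] at h
  obtain ⟨s, rfl⟩ := h
  rcases lt_trichotomy t s with h | rfl | h
  · exact Or.inl (hγ.pointLT_iff_lt.2 h)
  · exact Or.inr (Or.inl rfl)
  · exact Or.inr (Or.inr (hγ.pointLT_iff_lt.2 h))

theorem RadialFoliation.PointLT.deck {ζ ζ' : ℂ} (h : F.PointLT ζ ζ') (k : ℤ) :
    F.PointLT (deck k ζ) (deck k ζ') := by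
  obtain ⟨γ, s, t, hγ, hst, rfl, rfl⟩ := h.exists_curve
  exact (hγ.deck k).pointLT_iff_lt.2 hst

/-! ### The two sides of a lifted ray -/

/-- The left (`σ = 1`) or right (`σ = -1`) side of a lifted ray. -/
def side (σ : ℝ) (φt : Set ℂ) : Set ℂ :=
  {ζ ∈ cover \ φt | ∀ᶠ y : ℝ in atTop, JoinedIn (cover \ φt) ζ (ζ + (σ * y : ℝ) * Complex.I)}

theorem leftSide_eq (φt : Set ℂ) : leftSide φt = side 1 φt := by simp [leftSide, side]

theorem rightSide_eq (φt : Set ℂ) : rightSide φt = side (-1) φt := by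
  simp [rightSide, side, sub_eq_add_neg]

theorem side_subset {σ : ℝ} {φt : Set ℂ} : side σ φt ⊆ cover \ φt := fun _ h => h.1

theorem IsLiftedRay.isOpen_compl {γ : ℝ → ℂ} (h : IsLiftedRay γ) : IsOpen (cover \ range γ) := by
  have : cover \ range γ = cover \ closure (range γ) := by
    ext ζ
    refine ⟨fun ⟨h1, h2⟩ => ⟨h1, fun h3 => h2 ?_⟩, fun ⟨h1, h2⟩ => ⟨h1, fun h3 => h2 (subset_closure h3)⟩⟩
    rw [← image_univ] at h3 ⊢
    exact h.mem_image_of_mem_closure isClosed_univ h1 h3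
  rw [this]
  exact isOpen_cover.sdiff isClosed_closure

theorem convex_cover : Convex ℝ cover := convex_halfSpace_re_lt 0

theorem IsLiftedRay.exists_im_bound {γ : ℝ → ℂ} (h : IsLiftedRay γ) (c : ℝ) {d : ℝ} (hd : d < 0) :
    ∃ M : ℝ, 0 ≤ M ∧ ∀ t, c ≤ (γ t).re → (γ t).re ≤ d → |(γ t).im| ≤ M := by
  obtain ⟨a, b, hab⟩ := h.exists_Icc c hd
  obtain ⟨M, hM⟩ := (isCompact_Icc (a := a) (b := b)).exists_bound_of_continuousOn
    (Complex.continuous_im.comp h.continuous).continuousOn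
  exact ⟨max M 0, le_max_right _ _, fun t h1 h2 => (hM t (hab t h1 h2)).trans (le_max_left _ _)⟩

/-- Far above (or below) a lifted ray, points over a compact interval of real parts are joined in
the complement of the ray without leaving that interval. -/
theorem IsLiftedRay.exists_joinedIn_far {γ : ℝ → ℂ} (h : IsLiftedRay γ) {σ : ℝ} (hσ : |σ| = 1) (c : ℝ)
    {d : ℝ} (hd : d < 0) : ∃ M : ℝ, 0 ≤ M ∧ ∀ ζ ζ' : ℂ, ζ.re ∈ Icc c d → ζ'.re ∈ Icc c d →
      M < σ * ζ.im → M < σ * ζ'.im →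
        JoinedIn ((cover \ range γ) ∩ {w | w.re ∈ Icc c d}) ζ ζ' := by
  obtain ⟨M, hM0, hM⟩ := h.exists_im_bound c hd
  refine ⟨M, hM0, fun ζ ζ' h1 h2 h3 h4 => JoinedIn.of_segment_subset ?_⟩
  have hconv : Convex ℝ (Complex.reLm ⁻¹' Icc c d ∩ (σ • Complex.imLm) ⁻¹' Ioi M) :=
    ((convex_Icc c d).linear_preimage _).inter ((convex_Ioi M).linear_preimage _)
  refine (hconv.segment_subset (x := ζ) (y := ζ') ⟨h1, h3⟩ ⟨h2, h4⟩).trans ?_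
  rintro w ⟨hw1, hw2⟩
  refine ⟨⟨?_, ?_⟩, hw1⟩
  · exact lt_of_le_of_lt hw1.2 hd
  · rintro ⟨t, rfl⟩
    have h5 := hM t hw1.1 hw1.2
    have h6 : M < σ * (γ t).im := hw2
    have h7 : σ * (γ t).im ≤ |(γ t).im| := by
      calc σ * (γ t).im ≤ |σ * (γ t).im| := le_abs_self _
        _ = _ := by rw [abs_mul, hσ, one_mul]
    linarith

/-- Points far above (or below) a lifted ray over a compact interval of real parts are on the expected
side. -/
theorem IsLiftedRay.exists_mem_side {γ : ℝ → ℂ} (h : IsLiftedRay γ) {σ : ℝ} (hσ : |σ| = 1) (c : ℝ)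
    {d : ℝ} (hd : d < 0) :
    ∃ M : ℝ, 0 ≤ M ∧ ∀ ζ : ℂ, ζ.re ∈ Icc c d → M < σ * ζ.im → ζ ∈ side σ (range γ) := by
  obtain ⟨M, hM0, hM⟩ := h.exists_joinedIn_far hσ c hd
  have hσ2 : σ * σ = 1 := by rw [← abs_mul_abs_self, hσ, one_mul]
  refine ⟨M, hM0, fun ζ h1 h2 => ⟨(hM ζ ζ h1 h1 h2 h2).source_mem.1, ?_⟩⟩
  filter_upwards [eventually_ge_atTop 0] with y hy
  refine (hM ζ _ h1 (by simpa using h1) h2 ?_).mono inter_subset_left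
  have : (ζ + (σ * y : ℝ) * Complex.I).im = ζ.im + σ * y := by simp
  rw [this, mul_add, ← mul_assoc, hσ2]
  linarith

theorem IsLiftedRay.side_nonempty {γ : ℝ → ℂ} (h : IsLiftedRay γ) {σ : ℝ} (hσ : |σ| = 1) :
    (side σ (range γ)).Nonempty := by
  obtain ⟨M, -, hM⟩ := h.exists_mem_side hσ (-1) (d := -1) (by norm_num)
  have hσ2 : σ * σ = 1 := by rw [← abs_mul_abs_self, hσ, one_mul]
  refine ⟨⟨-1, σ * (M + 1)⟩, hM _ (by simp) ?_⟩
  simp only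
  rw [← mul_assoc, hσ2]
  linarith

theorem IsLiftedRay.eventually_joinedIn {γ : ℝ → ℂ} (h : IsLiftedRay γ) {σ : ℝ} (hσ : |σ| = 1)
    {ζ ζ' : ℂ} (hζ : ζ ∈ cover) (hζ' : ζ' ∈ cover) : ∀ᶠ y : ℝ in atTop,
      JoinedIn (cover \ range γ) (ζ + (σ * y : ℝ) * Complex.I) (ζ' + (σ * y : ℝ) * Complex.I) := by
  obtain ⟨M, hM0, hM⟩ := h.exists_joinedIn_far hσ (min ζ.re ζ'.re) (d := max ζ.re ζ'.re)
    (max_lt hζ hζ')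
  have hσ2 : σ * σ = 1 := by rw [← abs_mul_abs_self, hσ, one_mul]
  have key : ∀ w : ℂ, ∀ y, M + |w.im| < y → M < σ * (w + (σ * y : ℝ) * Complex.I).im := by
    intro w y hy
    have e : (w + (σ * y : ℝ) * Complex.I).im = w.im + σ * y := by simp
    rw [e, mul_add, ← mul_assoc, hσ2]
    have h7 : -(σ * w.im) ≤ |w.im| := by
      calc -(σ * w.im) ≤ |σ * w.im| := neg_le_abs _
        _ = _ := by rw [abs_mul, hσ, one_mul]
    linarith
  filter_upwards [eventually_gt_atTop (M + |ζ.im|), eventually_gt_atTop (M + |ζ'.im|)] with y h1 h2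
  exact (hM _ _ (by simp) (by simp) (key _ _ h1) (key _ _ h2)).mono inter_subset_left

theorem IsLiftedRay.mem_side_of_joinedIn {γ : ℝ → ℂ} (h : IsLiftedRay γ) {σ : ℝ} (hσ : |σ| = 1)
    {ζ ζ' : ℂ} (hζ : ζ ∈ side σ (range γ)) (hj : JoinedIn (cover \ range γ) ζ ζ') :
    ζ' ∈ side σ (range γ) := by
  refine ⟨hj.target_mem, ?_⟩
  filter_upwards [hζ.2, h.eventually_joinedIn hσ hj.source_mem.1 hj.target_mem.1] with y h1 h2
  exact (hj.symm.trans h1).trans h2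

theorem joinedIn_of_mem_ball {S : Set ℂ} {ζ w w' : ℂ} {r : ℝ} (hr : Metric.ball ζ r ⊆ S)
    (hw : w ∈ Metric.ball ζ r) (hw' : w' ∈ Metric.ball ζ r) : JoinedIn S w w' :=
  JoinedIn.of_segment_subset (((convex_ball ζ r).segment_subset hw hw').trans hr)

/-- A union of path components of an open set is relatively clopen. -/
theorem isOpen_of_joinedIn {S C : Set ℂ} (hS : IsOpen S) (hCS : C ⊆ S)
    (hC : ∀ ζ ∈ C, ∀ ζ', JoinedIn S ζ ζ' → ζ' ∈ C) : IsOpen C ∧ closure C ∩ S ⊆ C := by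
  constructor
  · rw [Metric.isOpen_iff]
    intro ζ hζ
    obtain ⟨r, hr, hb⟩ := Metric.isOpen_iff.1 hS ζ (hCS hζ)
    exact ⟨r, hr, fun w hw => hC ζ hζ w (joinedIn_of_mem_ball hb (Metric.mem_ball_self hr) hw)⟩
  · rintro ζ ⟨h1, h2⟩
    obtain ⟨r, hr, hb⟩ := Metric.isOpen_iff.1 hS ζ h2
    obtain ⟨w, hw, hw'⟩ := mem_closure_iff_nhds.1 h1 _ (Metric.ball_mem_nhds ζ hr)
    exact hC w hw' ζ (joinedIn_of_mem_ball hb hw (Metric.mem_ball_self hr))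

theorem IsLiftedRay.isOpen_side {γ : ℝ → ℂ} (h : IsLiftedRay γ) {σ : ℝ} (hσ : |σ| = 1) :
    IsOpen (side σ (range γ)) :=
  (isOpen_of_joinedIn h.isOpen_compl side_subset
    fun _ hζ _ hj => h.mem_side_of_joinedIn hσ hζ hj).1

theorem exists_int_of_re_mul_exp_pos {X : Type*} [TopologicalSpace X] {s : Set X}
    (hs : IsPreconnected s) {L : X → ℂ} (hL : Continuous L) (a : ℝ)
    (h : ∀ x ∈ s, 0 < (Complex.exp (L x + (2 * π * a : ℝ) * Complex.I)).re) :
    ∃ n : ℤ, ∀ x ∈ s, |(L x).im / (2 * π) + a - n| < 1 / 4 := by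
  obtain ⟨n, hn⟩ := exists_int_of_re_exp_pos hs
    (L := fun x => L x + (2 * π * a : ℝ) * Complex.I) (by fun_prop) h
  refine ⟨n, fun x hx => ?_⟩
  have hp := Real.pi_pos
  have h1 := hn x hx
  have h2 : (L x + (2 * π * a : ℝ) * Complex.I).im - 2 * π * n =
      (2 * π) * ((L x).im / (2 * π) + a - n) := by
    have e : (L x + (2 * π * a : ℝ) * Complex.I).im = (L x).im + 2 * π * a := by simp
    rw [e]
    field_simp
  rw [h2, abs_mul, abs_of_pos (by positivity : 0 < 2 * π)] at h1
  nlinarith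

/-- Two paths of the square, one joining the vertical sides and the other the horizontal sides,
meet: here in the form that a path from top to bottom and a path from left to right cannot have a
nowhere vanishing difference. -/
theorem false_of_crossing {G : ℝ → ℝ → ℂ}
    (hG : ContinuousOn (fun p : ℝ × ℝ => G p.1 p.2) (Icc 0 1 ×ˢ Icc 0 1))
    (h0 : ∀ r ∈ Icc (0 : ℝ) 1, ∀ s ∈ Icc (0 : ℝ) 1, G r s ≠ 0)
    (hl : ∀ s ∈ Icc (0 : ℝ) 1, (G 0 s).re < 0) (hr : ∀ s ∈ Icc (0 : ℝ) 1, 0 < (G 1 s).re)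
    (hb : ∀ r ∈ Icc (0 : ℝ) 1, (G r 0).im < 0) (ht : ∀ r ∈ Icc (0 : ℝ) 1, 0 < (G r 1).im) :
    False := by
  obtain ⟨L, hL, h⟩ := exists_log_square hG h0
  have hm0 : (0 : ℝ) ∈ Icc (0 : ℝ) 1 := by simp
  have hm1 : (1 : ℝ) ∈ Icc (0 : ℝ) 1 := by simp
  have e4 : Complex.exp ((2 * π * (1 / 4) : ℝ) * Complex.I) = Complex.I := by
    rw [show ((2 * π * (1 / 4) : ℝ) : ℂ) * Complex.I = π / 2 * Complex.I by push_cast; ring]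
    exact Complex.exp_pi_div_two_mul_I
  have e2 : Complex.exp ((2 * π * (1 / 2) : ℝ) * Complex.I) = -1 := by
    rw [show ((2 * π * (1 / 2) : ℝ) : ℂ) * Complex.I = π * Complex.I by push_cast; ring]
    exact Complex.exp_pi_mul_I
  have e3 : Complex.exp ((2 * π * (-(1 / 4)) : ℝ) * Complex.I) = -Complex.I := by
    rw [show ((2 * π * (-(1 / 4)) : ℝ) : ℂ) * Complex.I = -π / 2 * Complex.I by push_cast; ring]
    exact Complex.exp_neg_pi_div_two_mul_I
  -- On each side of the square the argument, in turns, is confined to an interval of length `1/2` around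
  -- an integer `n i` plus the direction of the side; going round, the `n i` cannot match.
  obtain ⟨n1, h1⟩ := exists_int_of_re_mul_exp_pos (s := Icc (0 : ℝ) 1) isPreconnected_Icc
    (L := fun s => L (1, s)) (by fun_prop) 0 (fun s hs => by
      simpa [h 1 hm1 s hs] using hr s hs)
  obtain ⟨n2, h2⟩ := exists_int_of_re_mul_exp_pos (s := Icc (0 : ℝ) 1) isPreconnected_Icc
    (L := fun r => L (r, 0)) (by fun_prop) (1 / 4) (fun r hs => by
      rw [Complex.exp_add, h r hs 0 hm0, e4]
      simpa using hb r hs)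
  obtain ⟨n3, h3⟩ := exists_int_of_re_mul_exp_pos (s := Icc (0 : ℝ) 1) isPreconnected_Icc
    (L := fun s => L (0, s)) (by fun_prop) (1 / 2) (fun s hs => by
      rw [Complex.exp_add, h 0 hm0 s hs, e2]
      simpa using hl s hs)
  obtain ⟨n4, h4⟩ := exists_int_of_re_mul_exp_pos (s := Icc (0 : ℝ) 1) isPreconnected_Icc
    (L := fun r => L (r, 1)) (by fun_prop) (-(1 / 4)) (fun r hs => by
      rw [Complex.exp_add, h r hs 1 hm1, e3]
      simpa using ht r hs)
  have a1 := h1 0 hm0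
  have a2 := h2 1 hm1
  have a3 := h2 0 hm0
  have a4 := h3 0 hm0
  have a5 := h3 1 hm1
  have a6 := h4 0 hm0
  have a7 := h4 1 hm1
  have a8 := h1 1 hm1
  rw [abs_lt] at a1 a2 a3 a4 a5 a6 a7 a8
  -- Comparing at the four corners gives `n1 ≤ n4 < n3 ≤ n2 ≤ n1`.
  have b1 : n2 < n1 + 1 := by
    have : (n2 : ℝ) < n1 + 1 := by linarith
    exact_mod_cast this
  have b2 : n3 < n2 + 1 := by
    have : (n3 : ℝ) < n2 + 1 := by linarith
    exact_mod_cast this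
  have b3 : n4 < n3 := by
    have : (n4 : ℝ) < n3 := by linarith
    exact_mod_cast this
  have b4 : n1 < n4 + 1 := by
    have : (n1 : ℝ) < n4 + 1 := by linarith
    exact_mod_cast this
  omega

/-- The two sides of a lifted ray are disjoint. -/
theorem IsLiftedRay.disjoint_sides {γ : ℝ → ℂ} (h : IsLiftedRay γ) :
    Disjoint (side 1 (range γ)) (side (-1) (range γ)) := by
  rw [Set.disjoint_left]
  intro ζ h1 h2
  have hζc : ζ.re < 0 := h1.1.1
  obtain ⟨M1, hM10, hM1⟩ := h.exists_joinedIn_far (σ := 1) (by simp) ζ.re hζc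
  obtain ⟨M2, hM20, hM2⟩ := h.exists_joinedIn_far (σ := -1) (by simp) ζ.re hζc
  obtain ⟨y₀, ⟨hy1, hy2⟩, hy₀⟩ := ((h1.2.and h2.2).and
    (eventually_gt_atTop (M1 + M2 + |ζ.im|))).exists
  obtain ⟨p, hp⟩ := hy1.symm.trans hy2
  -- The path `p` stays over a compact interval `[c, d]` of real parts.
  obtain ⟨c, hc⟩ : ∃ c, ∀ t, c ≤ (p t).re := by
    obtain ⟨t, -, ht⟩ := isCompact_univ.exists_isMinOn univ_nonempty
      (Complex.continuous_re.comp p.continuous).continuousOn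
    exact ⟨(p t).re, fun s => ht (mem_univ s)⟩
  obtain ⟨d, hd, hcd⟩ : ∃ d < 0, ∀ t, (p t).re ∈ Icc c d := by
    obtain ⟨t, -, ht⟩ := isCompact_univ.exists_isMaxOn univ_nonempty
      (Complex.continuous_re.comp p.continuous).continuousOn
    exact ⟨(p t).re, (hp t).1, fun s => ⟨hc s, ht (mem_univ s)⟩⟩
  set S := (cover \ range γ) ∩ {w : ℂ | w.re ∈ Icc c d} with hS
  have hj0 : JoinedIn S (ζ + (1 * y₀ : ℝ) * Complex.I) (ζ + (-1 * y₀ : ℝ) * Complex.I) :=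
    ⟨p, fun t => ⟨hp t, hcd t⟩⟩
  have hζre : ζ.re ∈ Icc c d := by simpa using hcd 0
  obtain ⟨t0, t1, h01, ht0, ht1⟩ : ∃ t0 t1, t0 ≤ t1 ∧ (γ t0).re < c ∧ d < (γ t1).re := by
    obtain ⟨t0, e0, e1⟩ := ((h.tendsto_re_atBot.eventually_lt_atBot c).and
      (eventually_le_atBot 0)).exists
    obtain ⟨t1, e2, e3⟩ := ((h.tendsto_re_atTop.eventually_const_lt hd).and
      (eventually_ge_atTop 0)).exists
    exact ⟨t0, t1, e1.trans e3, e0, e2⟩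
  obtain ⟨B, hB⟩ := (isCompact_Icc (a := t0) (b := t1)).exists_bound_of_continuousOn
    (Complex.continuous_im.comp h.continuous).continuousOn
  -- Prolong `p` vertically beyond the part of the ray that matters.
  set y₁ := max y₀ (B + |ζ.im| + 1)
  have hy₁ : y₀ ≤ y₁ := le_max_left _ _
  have hy₁' : B + |ζ.im| < y₁ := lt_of_lt_of_le (by linarith) (le_max_right _ _)
  have hsub : ((cover \ range γ) ∩ {w : ℂ | w.re ∈ Icc ζ.re ζ.re}) ⊆ S := fun w hw =>
    ⟨hw.1, ⟨hζre.1.trans hw.2.1, hw.2.2.trans hζre.2⟩⟩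
  have hab := neg_abs_le ζ.im
  have hab' := le_abs_self ζ.im
  have hj1 : JoinedIn S (ζ + (1 * y₁ : ℝ) * Complex.I) (ζ + (1 * y₀ : ℝ) * Complex.I) :=
    (hM1 _ _ (by simp) (by simp) (by simp; linarith) (by simp; linarith)).mono hsub
  have hj2 : JoinedIn S (ζ + (-1 * y₀ : ℝ) * Complex.I) (ζ + (-1 * y₁ : ℝ) * Complex.I) :=
    (hM2 _ _ (by simp) (by simp) (by simp; linarith) (by simp; linarith)).mono hsub
  obtain ⟨q, hq⟩ := (hj1.trans hj0).trans hj2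
  have hqe : ∀ s ∈ Icc (0 : ℝ) 1, q.extend s ∈ S := fun s hs => by
    rw [q.extend_apply hs]; exact hq _
  have hseg : ∀ r ∈ Icc (0 : ℝ) 1, t0 + r * (t1 - t0) ∈ Icc t0 t1 := fun r hr =>
    ⟨by nlinarith [hr.1], by nlinarith [hr.2]⟩
  refine false_of_crossing (G := fun r s => γ (t0 + r * (t1 - t0)) - q.extend s) ?_ ?_ ?_ ?_ ?_ ?_
  · exact ((h.continuous.comp (by fun_prop)).sub (q.continuous_extend.comp continuous_snd)).continuousOn
  · intro r hr s hs h0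
    exact (hqe s hs).1.2 ⟨_, sub_eq_zero.1 h0⟩
  · intro s hs
    have := (hqe s hs).2.1
    simp only [zero_mul, add_zero, Complex.sub_re]
    linarith
  · intro s hs
    have := (hqe s hs).2.2
    simp only [one_mul, add_sub_cancel, Complex.sub_re]
    linarith
  · intro r hr
    have := (abs_le.1 (hB _ (hseg r hr))).2
    simp only [Function.comp] at this
    simp
    linarith
  · intro r hr
    have := (abs_le.1 (hB _ (hseg r hr))).1
    simp only [Function.comp] at this
    simp
    linarith

variable {F : RadialFoliation}

/-! ### Flow boxes of the lifted foliation -/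

/-- A flow box of the lifted foliation, parametrized by the plane. -/
structure RadialFoliation.IsBox (F : RadialFoliation) (b : ℝ × ℝ → ℂ) : Prop where
  continuous : Continuous b
  injective : Function.Injective b
  isOpenMap : IsOpenMap b
  pointLT : ∀ y x x', x < x' → F.PointLT (b (x, y)) (b (x', y))

theorem RadialFoliation.IsBox.mem {b : ℝ × ℝ → ℂ} (hb : F.IsBox b) (p : ℝ × ℝ) : b p ∈ cover :=
  (hb.pointLT p.2 p.1 (p.1 + 1) (by linarith)).left_mem

theorem eq_of_exp_eq_of_norm_lt {ζ ζ' : ℂ} (h : Complex.exp ζ = Complex.exp ζ')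
    (hn : ‖ζ - ζ'‖ < 2) : ζ = ζ' := by
  obtain ⟨k, rfl⟩ := exists_deck_of_exp_eq h
  have h1 := (Complex.abs_im_le_norm _).trans_lt hn
  simp only [Complex.sub_im, deck_im, add_sub_cancel_left] at h1
  have hk : k = 0 := by
    by_contra hk
    have h2 : (1 : ℝ) ≤ |(k : ℝ)| := by
      rw [← Int.cast_abs]
      exact_mod_cast Int.one_le_abs hk
    rw [abs_mul, abs_of_pos (by positivity)] at h1
    nlinarith [Real.pi_gt_three]
  rw [hk, deck_zero]

theorem RadialFoliation.exists_box (F : RadialFoliation) {ζ : ℂ} (hζ : ζ ∈ cover) :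
    ∃ b p, F.IsBox b ∧ b p = ζ := by
  obtain ⟨e, hze, hes, het, hleaf⟩ := F.flow_box _ (exp_mem_diskStar.2 hζ)
  have hcont : Continuous e.symm := by
    have := e.continuousOn_symm
    rwa [het, continuousOn_univ] at this
  have hmem : ∀ p, e.symm p ∈ diskStar := fun p => hes (e.map_target (by rw [het]; trivial))
  obtain ⟨b, hbc, hbe, hbp⟩ := exists_continuous_log_through hcont
    (fun p => ne_zero_of_mem_diskStar (hmem p)) (a := e (Complex.exp ζ)) (ζ := ζ)
    (by rw [e.left_inv hze])
  have hinj : Function.Injective b := fun p q hpq => by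
    have : e.symm p = e.symm q := by rw [← hbe, ← hbe, hpq]
    exact e.symm.injOn (by rw [e.symm_source, het]; trivial) (by rw [e.symm_source, het]; trivial) this
  refine ⟨b, _, ⟨hbc, hinj, ?_, ?_⟩, hbp⟩
  -- The lift is open because `exp` is a local homeomorphism.
  · rw [isOpenMap_iff_nhds_le]
    intro p
    rw [Filter.le_map_iff]
    intro O hO
    obtain ⟨O', hO', hO'o, hp⟩ := mem_nhds_iff.1 hO
    set A := b ⁻¹' Metric.ball (b p) 1 ∩ O' with hA
    have hAo : IsOpen A := (Metric.isOpen_ball.preimage hbc).inter hO'o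
    have hAo' : IsOpen (e.symm '' A) :=
      e.isOpen_image_symm_of_subset_target hAo (by rw [het]; exact subset_univ _)
    have h1 : Complex.exp ⁻¹' (e.symm '' A) ∈ 𝓝 (b p) := by
      refine Complex.continuous_exp.continuousAt.preimage_mem_nhds (hAo'.mem_nhds ?_)
      rw [hbe]
      exact ⟨p, ⟨Metric.mem_ball_self one_pos, hp⟩, rfl⟩
    filter_upwards [h1, Metric.ball_mem_nhds (b p) one_pos] with w hw hw'
    obtain ⟨q, hq, hqw⟩ := hw
    refine ⟨q, hO' hq.2, ?_⟩
    refine eq_of_exp_eq_of_norm_lt (by rw [hbe, hqw]) ?_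
    have h2 : dist (b q) (b p) < 1 := hq.1
    have h3 : dist w (b p) < 1 := hw'
    rw [← dist_eq_norm]
    linarith [dist_triangle_right (b q) w (b p)]
  -- A horizontal line is carried to a lift of a leaf, by uniqueness of lifts.
  · intro y x x' hx
    obtain ⟨γ, hγ, hγF, u, hu, h⟩ := hleaf y
    have huc : Continuous u := hγ.continuous_of_comp (p := fun x => e.symm (x, y)) (by fun_prop) h
    obtain ⟨γt, hγt, hγe, h0⟩ := hγ.exists_lift (t := u 0) (ζ := b (0, y)) (by rw [hbe, h])
    have := eq_of_exp_eq (L := fun x => b (x, y)) (M := fun x => γt (u x)) (by fun_prop)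
      (hγt.continuous.comp huc) (fun x => by rw [hbe, hγe, h]) (a := 0) h0.symm
    have hc : F.Curve γt := ⟨hγt, by simpa only [hγe] using hγF⟩
    rw [congrFun this x, congrFun this x']
    exact hc.pointLT_iff_lt.2 (hu hx)

theorem RadialFoliation.IsBox.exists_param {b : ℝ × ℝ → ℂ} (hb : F.IsBox b) {γ : ℝ → ℂ}
    (hγ : F.Curve γ) {x₀ y t : ℝ} (h : γ t = b (x₀, y)) :
    ∃ v : ℝ → ℝ, StrictMono v ∧ Continuous v ∧ v x₀ = t ∧ ∀ x, b (x, y) = γ (v x) := by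
  have : ∀ x, ∃ s, b (x, y) = γ s := by
    intro x
    have hm : b (x, y) ∈ F.liftedLeaf (γ t) := by
      rw [h]
      rcases lt_trichotomy x x₀ with hx | rfl | hx
      · exact (hb.pointLT y x x₀ hx).mem_liftedLeaf'
      · exact F.mem_liftedLeaf (hb.mem _)
      · exact (hb.pointLT y x₀ x hx).mem_liftedLeaf
    rw [hγ.liftedLeaf_eq] at hm
    obtain ⟨s, hs⟩ := hm
    exact ⟨s, hs.symm⟩
  choose v hv using this
  refine ⟨v, fun x x' hx => ?_, ?_, ?_, hv⟩
  · have := hb.pointLT y x x' hx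
    rwa [hv, hv, hγ.pointLT_iff_lt] at this
  · exact hγ.1.isRay.continuous_of_comp (p := fun x => Complex.exp (b (x, y)))
      (Complex.continuous_exp.comp (hb.continuous.comp (by fun_prop))) (fun x => by simp only [hv])
  · exact hγ.1.injective (by rw [← hv, h])

theorem exists_rect {x₀ y₀ : ℝ} {O : Set (ℝ × ℝ)} (hO : O ∈ 𝓝 (x₀, y₀)) :
    ∃ ε > 0, ∀ x y, |x - x₀| < ε → |y - y₀| < ε → (x, y) ∈ O := by
  obtain ⟨ε, hε, h⟩ := Metric.mem_nhds_iff.1 hO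
  refine ⟨ε, hε, fun x y hx hy => h ?_⟩
  rw [Metric.mem_ball, Prod.dist_eq, max_lt_iff]
  exact ⟨hx, hy⟩

/-- A small flow box around a point of a leaf meets this leaf along a single plaque. -/
theorem RadialFoliation.IsBox.exists_plaque {b : ℝ × ℝ → ℂ} (hb : F.IsBox b) {γ : ℝ → ℂ}
    (hγ : F.Curve γ) {x₀ y₀ t : ℝ} (h : γ t = b (x₀, y₀)) :
    ∃ ε > 0, ∀ x y, |x - x₀| < ε → |y - y₀| < ε → (b (x, y) ∈ range γ ↔ y = y₀) := by
  obtain ⟨v, hv, hvc, hv0, hbv⟩ := hb.exists_param hγ h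
  set S := Iic (v (x₀ - 1)) ∪ Ici (v (x₀ + 1))
  have hS : IsClosed S := isClosed_Iic.union isClosed_Ici
  have hV : (closure (γ '' S))ᶜ ∈ 𝓝 (b (x₀, y₀)) := by
    refine isClosed_closure.isOpen_compl.mem_nhds fun hc => ?_
    obtain ⟨s, hs, he⟩ := hγ.1.mem_image_of_mem_closure hS (hb.mem _) hc
    rw [← h] at he
    rw [hγ.1.injective he, ← hv0] at hs
    rcases hs with hs | hs
    · exact absurd (hv.le_iff_le.1 hs) (by linarith)
    · exact absurd (hv.le_iff_le.1 hs) (by linarith)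
  obtain ⟨ε, hε, hO⟩ := exists_rect (hb.continuous.continuousAt.preimage_mem_nhds hV)
  refine ⟨ε, hε, fun x y hx hy => ⟨?_, ?_⟩⟩
  · rintro ⟨s, hs⟩
    have hsS : s ∉ S := fun hsS => hO x y hx hy (hs ▸ subset_closure (mem_image_of_mem γ hsS))
    simp only [S, mem_union, mem_Iic, mem_Ici, not_or, not_le] at hsS
    obtain ⟨x', -, hx'⟩ := intermediate_value_Ioo (by linarith : x₀ - 1 ≤ x₀ + 1) hvc.continuousOn hsS
    have : b (x, y) = b (x', y₀) := by rw [hbv, hx', hs]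
    exact (Prod.ext_iff.1 (hb.injective this)).2
  · rintro rfl
    exact ⟨v x, (hbv x).symm⟩

theorem RadialFoliation.IsBox.mem_nhds {b : ℝ × ℝ → ℂ} (hb : F.IsBox b) {x₀ y₀ ε : ℝ} (hε : 0 < ε) :
    b '' {p | |p.1 - x₀| < ε ∧ |p.2 - y₀| < ε} ∈ 𝓝 (b (x₀, y₀)) := by
  refine (hb.isOpenMap _ ?_).mem_nhds ⟨_, by simpa using hε, rfl⟩
  exact (isOpen_lt (continuous_fst.sub continuous_const).abs continuous_const).inter
    (isOpen_lt (continuous_snd.sub continuous_const).abs continuous_const)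

theorem joinedIn_image_of_convex {b : ℝ × ℝ → ℂ} (hb : Continuous b) {R : Set (ℝ × ℝ)}
    (hR : Convex ℝ R) {S : Set ℂ} (hS : b '' R ⊆ S) {p q : ℝ × ℝ} (hp : p ∈ R) (hq : q ∈ R) :
    JoinedIn S (b p) (b q) :=
  (((hR.isPathConnected ⟨p, hp⟩).image hb).joinedIn _ (mem_image_of_mem b hp) _
    (mem_image_of_mem b hq)).mono hS

theorem abs_sub_lt_iff_mem_Ioo {x a ε : ℝ} : |x - a| < ε ↔ x ∈ Ioo (a - ε) (a + ε) := by
  rw [abs_lt, mem_Ioo]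
  constructor <;> rintro ⟨h1, h2⟩ <;> constructor <;> linarith

/-- A union of components of the complement of a leaf that meets a small flow box contains its upper
half or its lower half. -/
theorem RadialFoliation.IsBox.half_subset {b : ℝ × ℝ → ℂ} (hb : F.IsBox b) {γ : ℝ → ℂ}
    {x₀ y₀ ε : ℝ} (hε : ∀ x y, |x - x₀| < ε → |y - y₀| < ε → (b (x, y) ∈ range γ ↔ y = y₀))
    {C : Set ℂ} (hCS : C ⊆ cover \ range γ)
    (hC : ∀ ζ ∈ C, ∀ ζ', JoinedIn (cover \ range γ) ζ ζ' → ζ' ∈ C)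
    {x y : ℝ} (hx : |x - x₀| < ε) (hy : |y - y₀| < ε) (hm : b (x, y) ∈ C) :
    (∀ x y, |x - x₀| < ε → y ∈ Ioo y₀ (y₀ + ε) → b (x, y) ∈ C) ∨
      (∀ x y, |x - x₀| < ε → y ∈ Ioo (y₀ - ε) y₀ → b (x, y) ∈ C) := by
  have hne : y ≠ y₀ := fun h => (hCS hm).2 ((hε x y hx hy).2 h)
  have hy' := abs_sub_lt_iff_mem_Ioo.1 hy
  rcases lt_or_gt_of_ne hne with hlt | hlt
  · right
    intro x' y' hx' hy''
    refine hC _ hm _ (joinedIn_image_of_convex hb.continuous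
      (R := Ioo (x₀ - ε) (x₀ + ε) ×ˢ Ioo (y₀ - ε) y₀) ((convex_Ioo _ _).prod (convex_Ioo _ _)) ?_
      ⟨abs_sub_lt_iff_mem_Ioo.1 hx, hy'.1, hlt⟩ ⟨abs_sub_lt_iff_mem_Ioo.1 hx', hy''⟩)
    rintro _ ⟨⟨u, v⟩, ⟨hu, hv⟩, rfl⟩
    refine ⟨hb.mem _, fun hc => ?_⟩
    have := (hε u v (abs_sub_lt_iff_mem_Ioo.2 hu)
      (abs_sub_lt_iff_mem_Ioo.2 ⟨hv.1, by linarith [hv.2, hv.1]⟩)).1 hc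
    exact absurd this hv.2.ne
  · left
    intro x' y' hx' hy''
    refine hC _ hm _ (joinedIn_image_of_convex hb.continuous
      (R := Ioo (x₀ - ε) (x₀ + ε) ×ˢ Ioo y₀ (y₀ + ε)) ((convex_Ioo _ _).prod (convex_Ioo _ _)) ?_
      ⟨abs_sub_lt_iff_mem_Ioo.1 hx, hlt, hy'.2⟩ ⟨abs_sub_lt_iff_mem_Ioo.1 hx', hy''⟩)
    rintro _ ⟨⟨u, v⟩, ⟨hu, hv⟩, rfl⟩
    refine ⟨hb.mem _, fun hc => ?_⟩
    have := (hε u v (abs_sub_lt_iff_mem_Ioo.2 hu)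
      (abs_sub_lt_iff_mem_Ioo.2 ⟨by linarith [hv.2, hv.1], hv.2⟩)).1 hc
    exact absurd this hv.1.ne'

/-- Every point of a leaf is adherent to each component of its complement. -/
theorem RadialFoliation.Curve.subset_closure {γ : ℝ → ℂ} (hγ : F.Curve γ) {C : Set ℂ}
    (hne : C.Nonempty) (hCS : C ⊆ cover \ range γ)
    (hC : ∀ ζ ∈ C, ∀ ζ', JoinedIn (cover \ range γ) ζ ζ' → ζ' ∈ C) (t : ℝ) : γ t ∈ closure C := by
  obtain ⟨hCo, hCc⟩ := isOpen_of_joinedIn hγ.1.isOpen_compl hCS hC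
  -- If `C` is adherent to no point of the leaf, it is closed in the cover, which is connected.
  have hex : ∃ t, γ t ∈ closure C := by
    by_contra hcon
    push Not at hcon
    have h1 : cover ⊆ C := by
      refine convex_cover.isPreconnected.subset_of_closure_inter_subset hCo ?_ ?_
      · obtain ⟨ζ, hζ⟩ := hne
        exact ⟨ζ, (hCS hζ).1, hζ⟩
      · rintro ζ ⟨h1, h2⟩
        exact hCc ⟨h1, h2, fun ⟨t, ht⟩ => hcon t (ht ▸ h1)⟩
    exact (hCS (h1 (hγ.1.mem 0))).2 (mem_range_self 0)
  -- A flow box in which `C` is adherent to one point of the plaque has `C` on one whole side of it.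
  have hclopen : IsClopen {t | γ t ∈ closure C} := by
    refine ⟨isClosed_closure.preimage hγ.1.continuous, ?_⟩
    rw [isOpen_iff_mem_nhds]
    intro t ht
    obtain ⟨b, ⟨x₀, y₀⟩, hb, hbp⟩ := F.exists_box (hγ.1.mem t)
    obtain ⟨ε, hε, hpl⟩ := hb.exists_plaque hγ hbp.symm
    obtain ⟨v, hv, hvc, hv0, hbv⟩ := hb.exists_param hγ hbp.symm
    obtain ⟨_, ⟨⟨x, y⟩, ⟨hx, hy⟩, rfl⟩, hm⟩ := mem_closure_iff_nhds.1 ht _ (hbp ▸ hb.mem_nhds hε)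
    have hcl : ∀ x, |x - x₀| < ε → b (x, y₀) ∈ closure C := by
      intro x' hx'
      rcases hb.half_subset hpl hCS hC hx hy hm with h | h
      · have h2 : Tendsto (fun y => b (x', y)) (𝓝[>] y₀) (𝓝 (b (x', y₀))) :=
          ((hb.continuous.comp (by fun_prop : Continuous fun y : ℝ => (x', y))).tendsto y₀).mono_left
            nhdsWithin_le_nhds
        refine mem_closure_of_tendsto h2 ?_
        filter_upwards [Ioo_mem_nhdsGT (by linarith : y₀ < y₀ + ε)] with y hy using h x' y hx' hy
      · have h2 : Tendsto (fun y => b (x', y)) (𝓝[<] y₀) (𝓝 (b (x', y₀))) :=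
          ((hb.continuous.comp (by fun_prop : Continuous fun y : ℝ => (x', y))).tendsto y₀).mono_left
            nhdsWithin_le_nhds
        refine mem_closure_of_tendsto h2 ?_
        filter_upwards [Ioo_mem_nhdsLT (by linarith : y₀ - ε < y₀)] with y hy using h x' y hx' hy
    have h3 : Ioo (v (x₀ - ε)) (v (x₀ + ε)) ∈ 𝓝 t := by
      rw [← hv0]
      exact Ioo_mem_nhds (hv (by linarith)) (hv (by linarith))
    filter_upwards [h3] with s hs
    obtain ⟨x', hx', rfl⟩ := intermediate_value_Ioo (by linarith : x₀ - ε ≤ x₀ + ε) hvc.continuousOn hs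
    show γ (v x') ∈ closure C
    rw [← hbv]
    exact hcl x' (abs_sub_lt_iff_mem_Ioo.2 hx')
  obtain ⟨t₁, ht₁⟩ := hex
  have := hclopen.eq_univ ⟨t₁, ht₁⟩
  exact (this ▸ mem_univ t : t ∈ {t | γ t ∈ closure C})

theorem RadialFoliation.Curve.subset_closure_side {γ : ℝ → ℂ} (hγ : F.Curve γ) {σ : ℝ}
    (hσ : |σ| = 1) (t : ℝ) : γ t ∈ closure (side σ (range γ)) :=
  hγ.subset_closure (hγ.1.side_nonempty hσ) side_subset
    (fun _ hζ _ hj => hγ.1.mem_side_of_joinedIn hσ hζ hj) t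

theorem RadialFoliation.IsBox.half_subset' {b : ℝ × ℝ → ℂ} (hb : F.IsBox b) {γ : ℝ → ℂ}
    (hγ : F.Curve γ) {x₀ y₀ t ε : ℝ} (h : γ t = b (x₀, y₀)) (hε0 : 0 < ε)
    (hε : ∀ x y, |x - x₀| < ε → |y - y₀| < ε → (b (x, y) ∈ range γ ↔ y = y₀))
    {C : Set ℂ} (hne : C.Nonempty) (hCS : C ⊆ cover \ range γ)
    (hC : ∀ ζ ∈ C, ∀ ζ', JoinedIn (cover \ range γ) ζ ζ' → ζ' ∈ C) :
    (∀ x y, |x - x₀| < ε → y ∈ Ioo y₀ (y₀ + ε) → b (x, y) ∈ C) ∨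
      (∀ x y, |x - x₀| < ε → y ∈ Ioo (y₀ - ε) y₀ → b (x, y) ∈ C) := by
  obtain ⟨_, ⟨⟨x, y⟩, ⟨hx, hy⟩, rfl⟩, hm⟩ := mem_closure_iff_nhds.1
    (hγ.subset_closure hne hCS hC t) _ (h ▸ hb.mem_nhds hε0)
  exact hb.half_subset hε hCS hC hx hy hm

/-- A small flow box around a point of a leaf: its upper and lower halves lie on different sides of
the leaf. -/
theorem RadialFoliation.IsBox.exists_sides {b : ℝ × ℝ → ℂ} (hb : F.IsBox b) {γ : ℝ → ℂ}
    (hγ : F.Curve γ) {x₀ y₀ t : ℝ} (h : γ t = b (x₀, y₀)) :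
    ∃ ε > 0, (∀ x y, |x - x₀| < ε → |y - y₀| < ε → (b (x, y) ∈ range γ ↔ y = y₀)) ∧
      ∃ σ : ℝ, (σ = 1 ∨ σ = -1) ∧
      (∀ x y, |x - x₀| < ε → y ∈ Ioo y₀ (y₀ + ε) → b (x, y) ∈ side σ (range γ)) ∧
      (∀ x y, |x - x₀| < ε → y ∈ Ioo (y₀ - ε) y₀ → b (x, y) ∈ side (-σ) (range γ)) := by
  obtain ⟨ε, hε, hpl⟩ := hb.exists_plaque hγ h
  refine ⟨ε, hε, hpl, ?_⟩
  have key : ∀ σ : ℝ, |σ| = 1 → _ := fun σ hσ => hb.half_subset' hγ h hε hpl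
    (hγ.1.side_nonempty hσ) side_subset (fun _ hζ _ hj => hγ.1.mem_side_of_joinedIn hσ hζ hj)
  have hd := Set.disjoint_left.1 hγ.1.disjoint_sides
  have h0 : |x₀ - x₀| < ε := by simpa using hε
  rcases key 1 (by simp) with h1 | h1 <;> rcases key (-1) (by simp) with h2 | h2
  · have hm : y₀ + ε / 2 ∈ Ioo y₀ (y₀ + ε) := ⟨by linarith, by linarith⟩
    exact absurd (h2 _ _ h0 hm) (hd (h1 _ _ h0 hm))
  · exact ⟨1, Or.inl rfl, h1, h2⟩
  · exact ⟨-1, Or.inr rfl, h2, by simpa using h1⟩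
  · have hm : y₀ - ε / 2 ∈ Ioo (y₀ - ε) y₀ := ⟨by linarith, by linarith⟩
    exact absurd (h2 _ _ h0 hm) (hd (h1 _ _ h0 hm))

/-- A leaf of the lifted foliation separates: every point off the leaf is on one of its sides. -/
theorem RadialFoliation.Curve.mem_side_or {γ : ℝ → ℂ} (hγ : F.Curve γ) {ζ : ℂ}
    (hζ : ζ ∈ cover \ range γ) : ζ ∈ side 1 (range γ) ∨ ζ ∈ side (-1) (range γ) := by
  obtain ⟨b, ⟨x₀, y₀⟩, hb, hbp⟩ := F.exists_box (hγ.1.mem 0)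
  obtain ⟨ε, hε, hpl, σ, hσ, h1, h2⟩ := hb.exists_sides hγ hbp.symm
  have h0 : |x₀ - x₀| < ε := by simpa using hε
  have hC := hb.half_subset' hγ hbp.symm hε hpl
    (C := {w | JoinedIn (cover \ range γ) ζ w}) ⟨ζ, JoinedIn.refl hζ⟩
    (fun w hw => hw.target_mem) (fun w hw w' hj => JoinedIn.trans hw hj)
  have key : ∀ τ : ℝ, (τ = 1 ∨ τ = -1) → ∀ w, JoinedIn (cover \ range γ) ζ w →
      w ∈ side τ (range γ) → ζ ∈ side 1 (range γ) ∨ ζ ∈ side (-1) (range γ) := by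
    rintro τ (rfl | rfl) w hj hw
    · exact Or.inl (hγ.1.mem_side_of_joinedIn (by simp) hw hj.symm)
    · exact Or.inr (hγ.1.mem_side_of_joinedIn (by simp) hw hj.symm)
  rcases hC with h | h
  · have hm : y₀ + ε / 2 ∈ Ioo y₀ (y₀ + ε) := ⟨by linarith, by linarith⟩
    exact key σ hσ _ (h _ _ h0 hm) (h1 _ _ h0 hm)
  · have hm : y₀ - ε / 2 ∈ Ioo (y₀ - ε) y₀ := ⟨by linarith, by linarith⟩
    exact key (-σ) (by rcases hσ with rfl | rfl <;> simp) _ (h _ _ h0 hm) (h2 _ _ h0 hm)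

/-! ### The order on the lifted leaves -/

theorem RadialFoliation.Curve.range_subset_side {γ δ : ℝ → ℂ} (hγ : F.Curve γ) (hδ : F.Curve δ)
    {σ : ℝ} (hσ : |σ| = 1) {t : ℝ} (h : δ t ∈ side σ (range γ)) : range δ ⊆ side σ (range γ) := by
  have hd : range δ ⊆ cover \ range γ := by
    rintro _ ⟨s, rfl⟩
    refine ⟨hδ.1.mem s, fun ⟨r, hr⟩ => h.1.2 ?_⟩
    rw [hγ.range_eq hδ hr]
    exact mem_range_self t
  have hp : IsPathConnected (range δ) := isPathConnected_range hδ.1.continuous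
  intro w hw
  exact hγ.1.mem_side_of_joinedIn hσ h ((hp.joinedIn _ (mem_range_self t) _ hw).mono hd)

theorem RadialFoliation.Curve.side_mono {γ δ : ℝ → ℂ} (hγ : F.Curve γ)
    {σ : ℝ} (hσ : σ = 1 ∨ σ = -1) (h : range δ ⊆ side σ (range γ)) :
    side (-σ) (range γ) ⊆ side (-σ) (range δ) := by
  have hσ' : |(-σ)| = 1 := by rcases hσ with rfl | rfl <;> simp
  have hd : side (-σ) (range γ) ⊆ cover \ range δ := by
    intro w hw
    refine ⟨hw.1.1, fun hw' => ?_⟩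
    have := Set.disjoint_left.1 hγ.1.disjoint_sides
    rcases hσ with rfl | rfl
    · exact this (h hw') hw
    · exact this (by simpa using hw) (h hw')
  intro ζ hζ
  refine ⟨hd hζ, ?_⟩
  filter_upwards [hζ.2] with y hy
  have h1 : pathComponentIn (cover \ range γ) ζ ⊆ side (-σ) (range γ) := fun w hw =>
    hγ.1.mem_side_of_joinedIn hσ' hζ hw
  exact ((isPathConnected_pathComponentIn hζ.1).joinedIn ζ (JoinedIn.refl hζ.1) _ hy).mono
    (h1.trans hd)

/-- If one leaf is on the left of another, the latter is on the right of the former. -/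
theorem RadialFoliation.Curve.side_symm {γ δ : ℝ → ℂ} (hγ : F.Curve γ) (hδ : F.Curve δ)
    {σ : ℝ} (hσ : σ = 1 ∨ σ = -1) {t : ℝ} (h : δ t ∈ side σ (range γ)) (s : ℝ) :
    γ s ∈ side (-σ) (range δ) := by
  have hσ1 : |σ| = 1 := by rcases hσ with rfl | rfl <;> simp
  have hσ' : |(-σ)| = 1 := by rcases hσ with rfl | rfl <;> simp
  have hsub := hγ.range_subset_side hδ hσ1 h
  have hcl := closure_mono (hγ.side_mono hσ hsub) (hγ.subset_closure_side hσ' s)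
  have hmem : γ s ∈ cover \ range δ :=
    ⟨hγ.1.mem s, fun hc => (hsub hc).1.2 (mem_range_self s)⟩
  have hn : γ s ∉ side σ (range δ) := fun hc => by
    obtain ⟨w, hw, hw'⟩ := mem_closure_iff_nhds.1 hcl _ ((hδ.1.isOpen_side hσ1).mem_nhds hc)
    have := Set.disjoint_left.1 hδ.1.disjoint_sides
    rcases hσ with rfl | rfl
    · exact this hw hw'
    · exact this (by simpa using hw') hw
  rcases hσ with rfl | rfl
  · exact (hδ.mem_side_or hmem).resolve_left hn
  · simpa using (hδ.mem_side_or hmem).resolve_right hn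

/-- The leaf of `ζ` is strictly below the leaf of `ζ'`. -/
def RadialFoliation.Below (F : RadialFoliation) (ζ ζ' : ℂ) : Prop :=
  ζ' ∈ cover ∧ ζ ∈ side (-1) (F.liftedLeaf ζ')

theorem RadialFoliation.Below.left_mem {ζ ζ' : ℂ} (h : F.Below ζ ζ') : ζ ∈ cover := h.2.1.1

theorem RadialFoliation.Below.right_mem {ζ ζ' : ℂ} (h : F.Below ζ ζ') : ζ' ∈ cover := h.1

theorem RadialFoliation.below_iff {ζ ζ' : ℂ} :
    F.Below ζ ζ' ↔ ζ ∈ cover ∧ ζ' ∈ side 1 (F.liftedLeaf ζ) := by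
  constructor
  · intro h
    have h0 := h.left_mem
    obtain ⟨γ, s, hγ, rfl, e⟩ := F.exists_curve_eq h0
    obtain ⟨δ, t, hδ, rfl, e'⟩ := F.exists_curve_eq h.1
    refine ⟨h0, ?_⟩
    have h2 := h.2
    rw [e'] at h2
    rw [e]
    simpa using hδ.side_symm hγ (σ := -1) (Or.inr rfl) h2 t
  · rintro ⟨h0, h⟩
    have h1 := h.1.1
    obtain ⟨γ, s, hγ, rfl, e⟩ := F.exists_curve_eq h0
    obtain ⟨δ, t, hδ, rfl, e'⟩ := F.exists_curve_eq h1
    refine ⟨h1, ?_⟩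
    rw [e] at h
    rw [e']
    exact hγ.side_symm hδ (σ := 1) (Or.inl rfl) h s

theorem RadialFoliation.below_or {ζ ζ' : ℂ} (hζ : ζ ∈ cover) (hζ' : ζ' ∈ cover)
    (h : ζ' ∉ F.liftedLeaf ζ) : F.Below ζ ζ' ∨ F.Below ζ' ζ := by
  obtain ⟨γ, s, hγ, rfl, e⟩ := F.exists_curve_eq hζ
  rw [e] at h
  rcases hγ.mem_side_or ⟨hζ', h⟩ with h1 | h1
  · exact Or.inl (below_iff.2 ⟨hζ, by rwa [e]⟩)
  · exact Or.inr ⟨hζ, by rwa [e]⟩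

theorem RadialFoliation.Below.notMem {ζ ζ' : ℂ} (h : F.Below ζ ζ') : ζ' ∉ F.liftedLeaf ζ :=
  (below_iff.1 h).2.1.2

theorem RadialFoliation.Below.notMem' {ζ ζ' : ℂ} (h : F.Below ζ ζ') : ζ ∉ F.liftedLeaf ζ' :=
  h.2.1.2

theorem RadialFoliation.Below.not_symm {ζ ζ' : ℂ} (h : F.Below ζ ζ') : ¬ F.Below ζ' ζ := by
  intro h'
  have h0 := h.left_mem
  obtain ⟨γ, s, hγ, rfl, e⟩ := F.exists_curve_eq h0
  have h1 := (below_iff.1 h).2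
  have h2 := h'.2
  rw [e] at h1 h2
  exact Set.disjoint_left.1 hγ.1.disjoint_sides h1 h2

theorem RadialFoliation.below_irrefl (ζ : ℂ) : ¬ F.Below ζ ζ := fun h => h.not_symm h

theorem RadialFoliation.Below.congr_right {ζ ζ' ζ'' : ℂ} (h : F.Below ζ ζ')
    (h' : ζ'' ∈ F.liftedLeaf ζ') : F.Below ζ ζ'' :=
  ⟨F.liftedLeaf_subset _ h', by rw [F.liftedLeaf_eq_of_mem h.1 h']; exact h.2⟩

theorem RadialFoliation.Below.congr_left {ζ ζ' ζ'' : ℂ} (h : F.Below ζ ζ')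
    (h' : ζ'' ∈ F.liftedLeaf ζ) : F.Below ζ'' ζ' :=
  below_iff.2 ⟨F.liftedLeaf_subset _ h', by
    rw [F.liftedLeaf_eq_of_mem h.left_mem h']; exact (below_iff.1 h).2⟩

theorem RadialFoliation.Below.side_subset {ζ ζ' : ℂ} (h : F.Below ζ ζ') :
    side (-1) (F.liftedLeaf ζ) ⊆ side (-1) (F.liftedLeaf ζ') := by
  have h0 := h.left_mem
  have h1 := (below_iff.1 h).2
  obtain ⟨γ, s, hγ, rfl, e⟩ := F.exists_curve_eq h0
  obtain ⟨δ, t, hδ, rfl, e'⟩ := F.exists_curve_eq h.1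
  rw [e] at h1 ⊢
  rw [e']
  exact hγ.side_mono (Or.inl rfl) (hγ.range_subset_side hδ (by simp) h1)

theorem RadialFoliation.Below.trans {a b c : ℂ} (h : F.Below a b) (h' : F.Below b c) :
    F.Below a c := ⟨h'.1, h'.side_subset h.2⟩

theorem RadialFoliation.leafLT_iff {ζ ζ' : ℂ} (hζ : ζ ∈ cover) (hζ' : ζ' ∈ cover) :
    LeafLT (F.liftedLeaf ζ) (F.liftedLeaf ζ') ↔ F.Below ζ ζ' := by
  unfold LeafLT
  rw [rightSide_eq, rightSide_eq]
  constructor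
  · rintro ⟨h1, h2⟩
    by_cases hm : ζ' ∈ F.liftedLeaf ζ
    · exact absurd (F.liftedLeaf_eq_of_mem hζ hm).symm h2
    · refine (F.below_or hζ hζ' hm).resolve_right fun hc => ?_
      exact (h1 hc.2).1.2 (F.mem_liftedLeaf hζ')
  · intro h
    exact ⟨h.side_subset, fun he => h.notMem (he ▸ F.mem_liftedLeaf hζ')⟩

theorem RadialFoliation.isOpen_below_left (ζ' : ℂ) : IsOpen {ζ | F.Below ζ ζ'} := by
  by_cases h : ζ' ∈ cover
  · obtain ⟨γ, s, hγ, rfl, e⟩ := F.exists_curve_eq h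
    have : {ζ | F.Below ζ (γ s)} = side (-1) (range γ) := by
      ext ζ
      exact ⟨fun hz => e ▸ hz.2, fun hz => ⟨h, e ▸ hz⟩⟩
    rw [this]
    exact hγ.1.isOpen_side (by simp)
  · convert isOpen_empty
    ext ζ
    exact ⟨fun hz => (h hz.1).elim, fun hz => hz.elim⟩

theorem RadialFoliation.isOpen_below_right (ζ : ℂ) : IsOpen {ζ' | F.Below ζ ζ'} := by
  by_cases h : ζ ∈ cover
  · obtain ⟨γ, s, hγ, rfl, e⟩ := F.exists_curve_eq h
    have : {ζ' | F.Below (γ s) ζ'} = side 1 (range γ) := by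
      ext ζ
      rw [← e]
      exact ⟨fun hz => (below_iff.1 hz).2, fun hz => below_iff.2 ⟨h, hz⟩⟩
    rw [this]
    exact hγ.1.isOpen_side (by simp)
  · convert isOpen_empty
    ext ζ
    exact ⟨fun hz => (h hz.left_mem).elim, fun hz => hz.elim⟩

theorem JoinedIn.deck {S : Set ℂ} {ζ ζ' : ℂ} (h : JoinedIn S ζ ζ') (k : ℤ) :
    JoinedIn (deck k '' S) (deck k ζ) (deck k ζ') := by
  obtain ⟨p, hp⟩ := h
  exact ⟨p.map (continuous_deck k), fun t => mem_image_of_mem _ (hp t)⟩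

theorem deck_image_compl (k : ℤ) (φ : Set ℂ) : deck k '' (cover \ φ) = cover \ (deck k '' φ) := by
  rw [image_sdiff (deck_injective k), deck_image_eq_preimage k cover]
  congr 1
  ext ζ
  exact deck_mem_cover

theorem deck_image_side_subset (k : ℤ) (σ : ℝ) (φ : Set ℂ) :
    deck k '' side σ φ ⊆ side σ (deck k '' φ) := by
  rintro _ ⟨ζ, hζ, rfl⟩
  refine ⟨by rw [← deck_image_compl]; exact mem_image_of_mem _ hζ.1, ?_⟩
  filter_upwards [hζ.2] with y hy
  have := JoinedIn.deck hy k
  rw [deck_image_compl] at this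
  convert this using 1
  simp only [CalabiRadial.deck]
  ring

theorem RadialFoliation.Below.deck {ζ ζ' : ℂ} (h : F.Below ζ ζ') (k : ℤ) :
    F.Below (deck k ζ) (deck k ζ') :=
  ⟨deck_mem_cover.2 h.1, by
    rw [F.liftedLeaf_deck k h.1]
    exact deck_image_side_subset k _ _ (mem_image_of_mem _ h.2)⟩

theorem RadialFoliation.below_deck_iff {ζ ζ' : ℂ} (k : ℤ) :
    F.Below (CalabiRadial.deck k ζ) (CalabiRadial.deck k ζ') ↔ F.Below ζ ζ' :=
  ⟨fun h => by simpa [deck_deck] using h.deck (-k), fun h => h.deck k⟩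

theorem RadialFoliation.deck_notMem {ζ : ℂ} (hζ : ζ ∈ cover) {k : ℤ} (hk : k ≠ 0) :
    deck k ζ ∉ F.liftedLeaf ζ := by
  obtain ⟨γ, s, hγ, rfl, e⟩ := F.exists_curve_eq hζ
  rw [e]
  rintro ⟨t, ht⟩
  have h1 : t = s := hγ.1.isRay.injective (by simp only [ht, exp_deck])
  rw [h1] at ht
  have := congrArg Complex.im ht
  simp at this
  exact hk this

/-- The covering automorphism `T` moves leaves up. -/
theorem RadialFoliation.below_deck_one (F : RadialFoliation) {ζ : ℂ} (hζ : ζ ∈ cover) :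
    F.Below ζ (deck 1 ζ) := by
  refine (F.below_or hζ (deck_mem_cover.2 hζ) (F.deck_notMem hζ one_ne_zero)).resolve_right
    fun h => ?_
  have hn : ∀ n : ℕ, F.Below (deck (n + 1) ζ) ζ := by
    intro n
    induction n with
    | zero => simpa using h
    | succ n ih =>
      have := ih.deck 1
      rw [deck_deck] at this
      push_cast
      rw [add_comm]
      exact this.trans h
  obtain ⟨γ, s, hγ, rfl, e⟩ := F.exists_curve_eq hζ
  obtain ⟨M, hM0, hM⟩ := hγ.1.exists_mem_side (σ := 1) (by simp) (γ s).re (hγ.1.mem s)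
  obtain ⟨n, hn'⟩ := exists_nat_gt (M - (γ s).im)
  have h1 := hM (CalabiRadial.deck (n + 1) (γ s)) (by simp) (by
    simp only [deck_im, one_mul]
    push_cast
    have : (n : ℝ) + 1 ≤ 2 * π * (n + 1) := by nlinarith [Real.pi_gt_three, (Nat.cast_nonneg n : (0:ℝ) ≤ n)]
    linarith)
  have h2 := (hn n).2
  rw [e] at h2
  exact Set.disjoint_left.1 hγ.1.disjoint_sides h1 h2

theorem RadialFoliation.below_deck_of_lt (F : RadialFoliation) {ζ : ℂ} (hζ : ζ ∈ cover) {k l : ℤ}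
    (h : k < l) : F.Below (deck k ζ) (deck l ζ) := by
  obtain ⟨n, rfl⟩ : ∃ n : ℕ, l = k + (n + 1) := ⟨(l - k - 1).toNat, by omega⟩
  clear h
  induction n with
  | zero =>
    have := F.below_deck_one (deck_mem_cover (k := k) |>.2 hζ)
    rw [deck_deck] at this
    simpa [add_comm] using this
  | succ n ih =>
    have := F.below_deck_one (deck_mem_cover (k := k + (n + 1)) |>.2 hζ)
    rw [deck_deck] at this
    have h2 := ih.trans this
    convert h2 using 2
    push_cast
    ring

/-! ### Transversals -/

/-- A map from the line to a totally ordered set of leaves that crosses each leaf it meets is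
strictly monotone: a first return would give a compact interval without a maximum. -/
theorem monotone_of_crossing {r : ℝ → ℝ → Prop} (hirr : ∀ a, ¬ r a a)
    (htrans : ∀ a b c, r a b → r b c → r a c)
    (heq : ∀ a b c, ¬ r a b → ¬ r b a → r a c → r b c)
    (heq' : ∀ a b c, ¬ r a b → ¬ r b a → r c a → r c b)
    (ho : ∀ a, IsOpen {y | r y a}) (ho' : ∀ a, IsOpen {y | r a y})
    (hloc : ∀ a, ∃ δ > 0, ((∀ y ∈ Ioo a (a + δ), r a y) ∧ ∀ y ∈ Ioo (a - δ) a, r y a) ∨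
      ((∀ y ∈ Ioo a (a + δ), r y a) ∧ ∀ y ∈ Ioo (a - δ) a, r a y)) :
    (∀ a b, a < b → r a b) ∨ (∀ a b, a < b → r b a) := by
  -- A compact interval has a maximum for an order `q` with open lower sections.
  have hmax : ∀ q : ℝ → ℝ → Prop, (∀ a, ¬ q a a) → (∀ a b c, q a b → q b c → q a c) →
      (∀ a, IsOpen {y | q y a}) → ∀ a b : ℝ, a ≤ b → ∃ m ∈ Icc a b, ∀ y ∈ Icc a b, ¬ q m y := by
    intro q hq hqt hqo a b hab
    by_contra hcon
    push Not at hcon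
    obtain ⟨t, ht, hfin, hcov⟩ := (isCompact_Icc (a := a) (b := b)).elim_finite_subcover_image
      (b := Icc a b) (c := fun y => {x | q x y}) (fun y _ => hqo y)
      (fun x hx => by
        obtain ⟨y, hy, hxy⟩ := hcon x hx
        exact mem_iUnion₂.2 ⟨y, hy, hxy⟩)
    have hne : t.Nonempty := by
      obtain ⟨y, hy, -⟩ := mem_iUnion₂.1 (hcov (left_mem_Icc.2 hab))
      exact ⟨y, hy⟩
    have : ∃ m ∈ t, ∀ y ∈ t, ¬ q m y := by
      have : IsStrictOrder ℝ (Function.swap q) :=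
        { irrefl := hq, trans := fun a b c h h' => hqt c b a h' h }
      have hwf := (hfin.wellFoundedOn (r := Function.swap q))
      obtain ⟨m, hm⟩ := hwf.has_min univ (by obtain ⟨y, hy⟩ := hne; exact ⟨⟨y, hy⟩, trivial⟩)
      exact ⟨m, m.2, fun y hy => hm.2 ⟨y, hy⟩ trivial⟩
    obtain ⟨m, hm, hmy⟩ := this
    obtain ⟨y, hy, hxy⟩ := mem_iUnion₂.1 (hcov (ht hm))
    exact hmy y hy hxy
  -- If `a < b` were equivalent, a maximum and a minimum over `[a, b]` would be attained at the ends only,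
  -- hence be equivalent to `a`, which contradicts the crossing at `a`.
  have hne : ∀ a b, a < b → r a b ∨ r b a := by
    intro a b hab
    by_contra hcon
    push Not at hcon
    obtain ⟨hn1, hn2⟩ := hcon
    obtain ⟨m, hm, hmm⟩ := hmax r hirr htrans ho a b hab.le
    obtain ⟨m', hm', hmm'⟩ := hmax (fun x y => r y x) hirr (fun a b c h h' => htrans _ _ _ h' h)
      ho' a b hab.le
    have hend : ∀ m ∈ Icc a b, (∀ y ∈ Icc a b, ¬ r m y) ∨ (∀ y ∈ Icc a b, ¬ r y m) →
        m = a ∨ m = b := by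
      intro m hm h
      by_contra hc
      push Not at hc
      have h1 : a < m := lt_of_le_of_ne hm.1 (Ne.symm hc.1)
      have h2 : m < b := lt_of_le_of_ne hm.2 hc.2
      obtain ⟨δ, hδ, hl⟩ := hloc m
      have hy1 : min ((m + b) / 2) (m + δ / 2) ∈ Ioo m (m + δ) :=
        ⟨lt_min (by linarith) (by linarith), (min_le_right _ _).trans_lt (by linarith)⟩
      have hy1' : min ((m + b) / 2) (m + δ / 2) ∈ Icc a b :=
        ⟨by linarith [hy1.1], (min_le_left _ _).trans (by linarith)⟩
      have hy2 : max ((m + a) / 2) (m - δ / 2) ∈ Ioo (m - δ) m :=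
        ⟨lt_of_lt_of_le (by linarith) (le_max_right _ _), max_lt (by linarith) (by linarith)⟩
      have hy2' : max ((m + a) / 2) (m - δ / 2) ∈ Icc a b :=
        ⟨le_trans (by linarith) (le_max_left _ _), by linarith [hy2.2]⟩
      rcases hl with ⟨l1, l2⟩ | ⟨l1, l2⟩ <;> rcases h with h | h
      · exact h _ hy1' (l1 _ hy1)
      · exact h _ hy2' (l2 _ hy2)
      · exact h _ hy2' (l2 _ hy2)
      · exact h _ hy1' (l1 _ hy1)
    have hrel : ∀ m, m = a ∨ m = b → ¬ r a m ∧ ¬ r m a := by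
      rintro m (rfl | rfl)
      · exact ⟨hirr _, hirr _⟩
      · exact ⟨hn1, hn2⟩
    have e1 := hrel m (hend m hm (Or.inl hmm))
    have e2 := hrel m' (hend m' hm' (Or.inr hmm'))
    obtain ⟨δ, hδ, hl⟩ := hloc a
    have hy1 : min b (a + δ / 2) ∈ Ioo a (a + δ) :=
      ⟨lt_min (by linarith) (by linarith), (min_le_right _ _).trans_lt (by linarith)⟩
    have hy1' : min b (a + δ / 2) ∈ Icc a b := ⟨hy1.1.le, min_le_left _ _⟩
    rcases hl with ⟨l1, -⟩ | ⟨l1, -⟩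
    · exact hmm _ hy1' (heq _ _ _ e1.1 e1.2 (l1 _ hy1))
    · exact hmm' _ hy1' (heq' _ _ _ e2.1 e2.2 (l1 _ hy1))
  -- By connectedness the sign is constant on both half-lines of each point; it remains to compare the
  -- signs at different points.
  have hconst : ∀ (s : Set ℝ) (a : ℝ), IsPreconnected s → (∀ y ∈ s, r a y ∨ r y a) →
      (∀ y ∈ s, r a y) ∨ (∀ y ∈ s, r y a) := by
    intro s a hs hsa
    by_contra hcon
    push Not at hcon
    obtain ⟨⟨y, hy, hy'⟩, z, hz, hz'⟩ := hcon
    obtain ⟨w, hw, hw1, hw2⟩ := hs _ _ (ho' a) (ho a) (fun y hy => hsa y hy)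
      ⟨z, hz, (hsa z hz).resolve_right hz'⟩ ⟨y, hy, (hsa y hy).resolve_left hy'⟩
    exact hirr _ (htrans _ _ _ hw1 hw2)
  have hasymm : ∀ a b, r a b → ¬ r b a := fun a b h h' => hirr _ (htrans _ _ _ h h')
  have hIoi : ∀ a, (∀ y ∈ Ioi a, r a y) ∨ (∀ y ∈ Ioi a, r y a) := fun a =>
    hconst _ a isPreconnected_Ioi (fun y hy => hne a y hy)
  have hIio : ∀ a, (∀ y ∈ Iio a, r a y) ∨ (∀ y ∈ Iio a, r y a) := fun a =>
    hconst _ a isPreconnected_Iio (fun y hy => (hne y a hy).symm)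
  rcases hne 0 1 one_pos with h01 | h01
  · left
    have h0 : ∀ y ∈ Ioi (0 : ℝ), r 0 y := (hIoi 0).resolve_right
      fun h => hasymm _ _ h01 (h 1 (by simp))
    intro a b hab
    have hy : ∀ y, 0 < y → ∀ x < y, r x y := fun y hy => (hIio y).resolve_left
      fun h => hasymm _ _ (h0 y hy) (h 0 hy)
    have h1 : 0 < max b 0 + 1 := by linarith [le_max_right b 0]
    have h2 : b < max b 0 + 1 := by linarith [le_max_left b 0]
    exact (hIoi a).resolve_right (fun h => hasymm _ _ (hy _ h1 a (hab.trans h2))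
      (h _ (hab.trans h2))) b hab
  · right
    have h0 : ∀ y ∈ Ioi (0 : ℝ), r y 0 := (hIoi 0).resolve_left
      fun h => hasymm _ _ h01 (h 1 (by simp))
    intro a b hab
    have hy : ∀ y, 0 < y → ∀ x < y, r y x := fun y hy => (hIio y).resolve_right
      fun h => hasymm _ _ (h0 y hy) (h 0 hy)
    have h1 : 0 < max b 0 + 1 := by linarith [le_max_right b 0]
    have h2 : b < max b 0 + 1 := by linarith [le_max_left b 0]
    exact (hIoi a).resolve_left (fun h => hasymm _ _ (hy _ h1 a (hab.trans h2))
      (h _ (hab.trans h2))) b hab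

theorem RadialFoliation.IsBox.mem_liftedLeaf {b : ℝ × ℝ → ℂ} (hb : F.IsBox b) (x x' y : ℝ) :
    b (x', y) ∈ F.liftedLeaf (b (x, y)) := by
  rcases lt_trichotomy x x' with h | rfl | h
  · exact (hb.pointLT y x x' h).mem_liftedLeaf
  · exact F.mem_liftedLeaf (hb.mem _)
  · exact (hb.pointLT y x' x h).mem_liftedLeaf'

/-- Around each point there is a flow box whose plaques are ordered as their heights. In particular
a leaf meets the box along one plaque at most. -/
theorem RadialFoliation.exists_box_below (F : RadialFoliation) {ζ : ℂ} (hζ : ζ ∈ cover) :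
    ∃ b p, F.IsBox b ∧ b p = ζ ∧ ∀ x x' y y', y < y' → F.Below (b (x, y)) (b (x', y')) := by
  obtain ⟨b, p, hb, hbp⟩ := F.exists_box hζ
  have key := monotone_of_crossing (r := fun y y' => F.Below (b (0, y)) (b (0, y')))
    (fun a => F.below_irrefl _) (fun _ _ _ h h' => h.trans h')
    (fun a c d h1 h2 h => h.congr_left (by
      by_contra hc
      exact (F.below_or (hb.mem _) (hb.mem _) hc).elim h1 h2))
    (fun a c d h1 h2 h => h.congr_right (by
      by_contra hc
      exact (F.below_or (hb.mem _) (hb.mem _) hc).elim h1 h2))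
    (fun a => (F.isOpen_below_left _).preimage (hb.continuous.comp (by fun_prop)))
    (fun a => (F.isOpen_below_right _).preimage (hb.continuous.comp (by fun_prop)))
    (fun a => by
      obtain ⟨γ, t, hγ, ht, he⟩ := F.exists_curve_eq (hb.mem (0, a))
      obtain ⟨ε, hε, -, σ, hσ, h1, h2⟩ := hb.exists_sides hγ ht
      refine ⟨ε, hε, ?_⟩
      have h0 : |(0 : ℝ) - 0| < ε := by simpa using hε
      rcases hσ with rfl | rfl
      · exact Or.inl ⟨fun y hy => below_iff.2 ⟨hb.mem _, he ▸ h1 0 y h0 hy⟩,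
          fun y hy => ⟨hb.mem _, he ▸ h2 0 y h0 hy⟩⟩
      · exact Or.inr ⟨fun y hy => ⟨hb.mem _, he ▸ h1 0 y h0 hy⟩,
          fun y hy => below_iff.2 ⟨hb.mem _, he ▸ by simpa using h2 0 y h0 hy⟩⟩)
  rcases key with h | h
  · exact ⟨b, p, hb, hbp, fun x x' y y' hy => ((h y y' hy).congr_left (hb.mem_liftedLeaf _ _ _)).congr_right
      (hb.mem_liftedLeaf _ _ _)⟩
  · refine ⟨fun q => b (q.1, -q.2), (p.1, -p.2), ⟨by have := hb.continuous; fun_prop, ?_, ?_, ?_⟩,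
      by simpa using hbp, fun x x' y y' hy => ((h (-y') (-y) (by linarith)).congr_left
        (hb.mem_liftedLeaf _ _ _)).congr_right (hb.mem_liftedLeaf _ _ _)⟩
    · intro q q' hq
      have := Prod.ext_iff.1 (hb.injective hq)
      exact Prod.ext this.1 (neg_injective this.2)
    · exact hb.isOpenMap.comp ((Homeomorph.refl ℝ).prodCongr (Homeomorph.neg ℝ)).isOpenMap
    · exact fun y x x' hx => hb.pointLT _ x x' hx

/-- The order of the leaves is an open relation. -/
theorem RadialFoliation.isOpen_below (F : RadialFoliation) :
    IsOpen {p : ℂ × ℂ | F.Below p.1 p.2} := by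
  rw [isOpen_iff_mem_nhds]
  rintro ⟨ζ, ζ'⟩ h
  have h : F.Below ζ ζ' := h
  obtain ⟨b, ⟨x, y⟩, hb, rfl, hbel⟩ := F.exists_box_below h.left_mem
  have ht : Tendsto (fun v => b (x, v)) (𝓝[>] y) (𝓝 (b (x, y))) :=
    ((hb.continuous.comp (by fun_prop : Continuous fun v : ℝ => (x, v))).tendsto y).mono_left
      nhdsWithin_le_nhds
  -- Choose a leaf strictly between the two given ones.
  obtain ⟨v, hv1, hv2⟩ := ((ht.eventually ((F.isOpen_below_left ζ').mem_nhds h)).and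
    self_mem_nhdsWithin).exists
  have h1 : F.Below (b (x, y)) (b (x, v)) := hbel _ _ _ _ hv2
  have h2 : F.Below (b (x, v)) ζ' := hv1
  filter_upwards [prod_mem_nhds ((F.isOpen_below_left _).mem_nhds h1)
    ((F.isOpen_below_right _).mem_nhds h2)] with p hp
  exact RadialFoliation.Below.trans hp.1 hp.2

/-! ### Closedness of the order along the leaves -/

/-- Leaves near a given leaf follow it forwards over compact intervals of time. -/
theorem RadialFoliation.Curve.eventually_exists_pointLT {γ : ℝ → ℂ} (hγ : F.Curve γ) {s t : ℝ}
    (hst : s < t) {V : Set ℂ} (hV : V ∈ 𝓝 (γ t)) :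
    ∀ᶠ η in 𝓝 (γ s), ∃ η' ∈ V, F.PointLT η η' := by
  -- Inside one flow box the claim is clear; a compact time interval is cut into such steps.
  have hloc : ∀ τ, ∃ U : Set ℝ, IsOpen U ∧ τ ∈ U ∧ ∀ s ∈ U, ∀ t ∈ U, s < t → ∀ V ∈ 𝓝 (γ t),
      ∀ᶠ η in 𝓝 (γ s), ∃ η' ∈ V, F.PointLT η η' := by
    intro τ
    obtain ⟨b, ⟨x₀, y₀⟩, hb, hbp⟩ := F.exists_box (hγ.1.mem τ)
    obtain ⟨v, hv, hvc, hv0, hbv⟩ := hb.exists_param hγ hbp.symm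
    refine ⟨Ioo (v (x₀ - 1)) (v (x₀ + 1)), isOpen_Ioo, ?_, ?_⟩
    · rw [← hv0]; exact ⟨hv (by linarith), hv (by linarith)⟩
    · intro s hs t ht hst V hV
      obtain ⟨x₁, -, rfl⟩ := intermediate_value_Ioo (by linarith : x₀ - 1 ≤ x₀ + 1) hvc.continuousOn hs
      obtain ⟨x₂, -, rfl⟩ := intermediate_value_Ioo (by linarith : x₀ - 1 ≤ x₀ + 1) hvc.continuousOn ht
      have hx : x₁ < x₂ := hv.lt_iff_lt.1 hst
      rw [← hbv] at hV ⊢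
      obtain ⟨ε, hε, hO⟩ := exists_rect (hb.continuous.continuousAt.preimage_mem_nhds hV)
      filter_upwards [hb.mem_nhds (lt_min hε (sub_pos.2 hx))]
      rintro _ ⟨⟨x, y⟩, ⟨h1, h2⟩, rfl⟩
      refine ⟨b (x₂, y), hO _ _ (by simpa using hε) (h2.trans_le (min_le_left _ _)), hb.pointLT _ _ _ ?_⟩
      have := (abs_lt.1 (h1.trans_le (min_le_right _ _))).2
      simp only at this
      linarith
  choose U hUo hUm hU using hloc
  obtain ⟨T, hT0, hTm, ⟨m, hm⟩, hTc⟩ := exists_monotone_Icc_subset_open_cover_Icc hst.le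
    (c := fun τ : ℝ => (Subtype.val : Icc s t → ℝ) ⁻¹' U τ)
    (fun τ => (hUo τ).preimage continuous_subtype_val)
    (fun x _ => mem_iUnion.2 ⟨x, hUm x⟩)
  have key : ∀ n, (T n : ℝ) = s ∨ (s < T n ∧ ∀ V ∈ 𝓝 (γ (T n)),
      ∀ᶠ η in 𝓝 (γ s), ∃ η' ∈ V, F.PointLT η η') := by
    intro n
    induction n with
    | zero => exact Or.inl hT0
    | succ n ih =>
      rcases (hTm (Nat.le_succ n)).eq_or_lt with he | hlt
      · rw [← he]; exact ih
      have hlt' : (T n : ℝ) < T (n + 1) := hlt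
      obtain ⟨τ, hτ⟩ := hTc n
      have h1 : (T n : ℝ) ∈ U τ := hτ ⟨le_rfl, hlt.le⟩
      have h2 : (T (n + 1) : ℝ) ∈ U τ := hτ ⟨hlt.le, le_rfl⟩
      have h3 := hU τ _ h1 _ h2 hlt'
      rcases ih with h | ⟨h, h'⟩
      · rw [h] at h3 hlt'
        exact Or.inr ⟨hlt', h3⟩
      · refine Or.inr ⟨h.trans hlt', fun V hV => ?_⟩
        have h4 := h3 V hV
        obtain ⟨O, hO, hOo, hmO⟩ := eventually_nhds_iff.1 h4
        filter_upwards [h' O (hOo.mem_nhds hmO)]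
        rintro η ⟨η', hη', hlt⟩
        obtain ⟨η'', hη'', hlt'⟩ := hO η' hη'
        exact ⟨η'', hη'', hlt.trans hlt'⟩
  have hmt : (T m : ℝ) = t := hm m le_rfl
  rcases key m with h | ⟨-, h⟩
  · exact absurd (h.symm.trans hmt) hst.ne
  · exact h V (by rw [hmt]; exact hV)

theorem RadialFoliation.IsBox.exists_of_between {b : ℝ × ℝ → ℂ} (hb : F.IsBox b) {x x' y : ℝ} {ξ : ℂ}
    (h : F.PointLT (b (x, y)) ξ) (h' : F.PointLT ξ (b (x', y))) :
    ∃ x'' ∈ Ioo x x', b (x'', y) = ξ := by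
  obtain ⟨γ, s, t, hγ, hst, hs, rfl⟩ := h.exists_curve
  obtain ⟨v, hv, hvc, hv0, hbv⟩ := hb.exists_param hγ hs
  rw [hbv, hγ.pointLT_iff_lt] at h'
  have h1 : v x < v x' := by rw [hv0]; exact hst.trans h'
  obtain ⟨x'', hx'', rfl⟩ := intermediate_value_Ioo (hv.lt_iff_lt.1 h1).le hvc.continuousOn
    (⟨by rwa [hv0], h'⟩ : t ∈ Ioo (v x) (v x'))
  exact ⟨x'', hx'', hbv x''⟩

/-- The strict order along the leaves is closed away from the diagonal. -/
theorem RadialFoliation.eventually_not_pointLT {ζ ζ' : ℂ} (hζ : ζ ∈ cover) (hζ' : ζ' ∈ cover)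
    (hne : ζ ≠ ζ') (h : ¬ F.PointLT ζ ζ') :
    ∀ᶠ p : ℂ × ℂ in 𝓝 (ζ, ζ'), ¬ F.PointLT p.1 p.2 := by
  by_cases hm : ζ' ∈ F.liftedLeaf ζ
  · have h' : F.PointLT ζ' ζ := ((F.pointLT_or hζ hm).resolve_left h).resolve_left hne.symm
    obtain ⟨γ, s, t, hγ, hst, rfl, rfl⟩ := h'.exists_curve
    obtain ⟨b, ⟨x₀, y₀⟩, hb, hbp, hbel⟩ := F.exists_box_below hζ
    obtain ⟨O, O', hO, hO', hmO, hmO', hd⟩ := t2_separation hne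
    rw [← hbp] at hmO
    obtain ⟨ε, hε, hOr⟩ := exists_rect (hb.continuous.continuousAt.preimage_mem_nhds
      (hO.mem_nhds hmO))
    have hV := hbp ▸ hb.mem_nhds (x₀ := x₀) (y₀ := y₀) hε
    filter_upwards [prod_mem_nhds hV (inter_mem (hO'.mem_nhds hmO')
      (hγ.eventually_exists_pointLT hst hV))]
    rintro ⟨η, ξ⟩ ⟨⟨⟨x, y⟩, ⟨hx, hy⟩, hη⟩, hξ, _, ⟨⟨x', y'⟩, ⟨hx', hy'⟩, rfl⟩, hlt⟩ hlt'
    simp only at hη hξ hlt hlt' hx hy hx' hy'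
    subst hη
    have hyy : y = y' := by
      have h1 := (hlt'.trans hlt).mem_liftedLeaf
      have h2 := (hlt'.trans hlt).mem_liftedLeaf'
      rcases lt_trichotomy y y' with h3 | h3 | h3
      · exact absurd h1 (hbel x x' _ _ h3).notMem
      · exact h3
      · exact absurd h2 (hbel x' x _ _ h3).notMem
    subst hyy
    obtain ⟨x'', hx'', rfl⟩ := hb.exists_of_between hlt' hlt
    refine Set.disjoint_left.1 hd (hOr x'' y ?_ hy) hξ
    rw [abs_lt] at hx hx' ⊢
    constructor <;> linarith [hx''.1, hx''.2]
  · rcases F.below_or hζ hζ' hm with h1 | h1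
    · filter_upwards [F.isOpen_below.mem_nhds (show (ζ, ζ') ∈ {p : ℂ × ℂ | F.Below p.1 p.2} from h1)]
        with p hp hlt
      exact RadialFoliation.Below.notMem hp hlt.mem_liftedLeaf
    · have : Tendsto Prod.swap (𝓝 (ζ, ζ')) (𝓝 (ζ', ζ)) := continuous_swap.tendsto (ζ, ζ')
      filter_upwards [this.eventually (F.isOpen_below.mem_nhds
        (show (ζ', ζ) ∈ {p : ℂ × ℂ | F.Below p.1 p.2} from h1))] with p hp hlt
      exact RadialFoliation.Below.notMem hp hlt.mem_liftedLeaf'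

/-- Leaves through points near `ζ₀` meet the translates of a neighbourhood of `ζ₀'` for finitely many
translates only: they are squeezed between two leaves. -/
theorem RadialFoliation.exists_bound_deck (F : RadialFoliation) {ζ₀ ζ₀' : ℂ} (hζ : ζ₀ ∈ cover)
    (hζ' : ζ₀' ∈ cover) : ∃ K : ℕ, ∀ᶠ p : ℂ × ℂ in 𝓝 (ζ₀, ζ₀'),
      ∀ k : ℤ, F.PointLT p.1 (deck k p.2) → k ∈ Finset.Icc (-(K : ℤ)) K := by
  obtain ⟨b, ⟨x, y⟩, hb, hbp, hbel⟩ := F.exists_box_below hζ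
  -- The two squeezing leaves are the plaques just below and just above `ζ₀`.
  have ha : F.Below (b (x, y - 1)) ζ₀ := hbp ▸ hbel x x (y - 1) y (by linarith)
  have hc : F.Below ζ₀ (b (x, y + 1)) := hbp ▸ hbel x x y (y + 1) (by linarith)
  obtain ⟨α, s, hα, hαs, eα⟩ := F.exists_curve_eq ha.left_mem
  obtain ⟨β, t, hβ, hβt, eβ⟩ := F.exists_curve_eq hc.right_mem
  have hζ'0 : ζ₀'.re < 0 := hζ'
  obtain ⟨M₁, hM₁0, hM₁⟩ := hα.1.exists_mem_side (σ := -1) (by simp) (ζ₀'.re - 1)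
    (d := ζ₀'.re / 2) (by linarith)
  obtain ⟨M₂, hM₂0, hM₂⟩ := hβ.1.exists_mem_side (σ := 1) (by simp) (ζ₀'.re - 1)
    (d := ζ₀'.re / 2) (by linarith)
  obtain ⟨K, hK⟩ := exists_nat_gt (M₁ + M₂ + |ζ₀'.im| + 1)
  refine ⟨K, ?_⟩
  have hO : {w : ℂ | (ζ₀'.re - 1 < w.re ∧ w.re < ζ₀'.re / 2) ∧
      (ζ₀'.im - 1 < w.im ∧ w.im < ζ₀'.im + 1)} ∈ 𝓝 ζ₀' := by
    refine IsOpen.mem_nhds (((isOpen_lt continuous_const Complex.continuous_re).inter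
      (isOpen_lt Complex.continuous_re continuous_const)).inter
      ((isOpen_lt continuous_const Complex.continuous_im).inter
      (isOpen_lt Complex.continuous_im continuous_const))) ⟨⟨?_, ?_⟩, ?_, ?_⟩ <;> linarith
  filter_upwards [prod_mem_nhds (inter_mem ((F.isOpen_below_right _).mem_nhds ha)
    ((F.isOpen_below_left _).mem_nhds hc)) hO]
  rintro ⟨ζ, ζ'⟩ ⟨⟨h1, h2⟩, ⟨h3, h4⟩, h5, h6⟩ k hlt
  simp only at h3 h4 h5 h6 hlt
  have h1' : F.Below (b (x, y - 1)) (deck k ζ') := RadialFoliation.Below.congr_right h1 hlt.mem_liftedLeaf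
  have h2' : F.Below (deck k ζ') (b (x, y + 1)) := RadialFoliation.Below.congr_left h2 hlt.mem_liftedLeaf
  have h7 : (deck k ζ').im ≤ M₂ := by
    by_contra hcon
    push Not at hcon
    have := hM₂ (deck k ζ') ⟨by simp only [deck_re]; linarith, by simp only [deck_re]; linarith⟩ (by linarith)
    rw [← eβ] at this
    exact h2'.not_symm (below_iff.2 ⟨hc.right_mem, this⟩)
  have h8 : -M₁ ≤ (deck k ζ').im := by
    by_contra hcon
    push Not at hcon
    have := hM₁ (deck k ζ') ⟨by simp only [deck_re]; linarith, by simp only [deck_re]; linarith⟩ (by linarith)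
    rw [← eα] at this
    exact h1'.not_symm ⟨ha.left_mem, this⟩
  rw [deck_im] at h7 h8
  have hp := Real.pi_gt_three
  have hi := abs_le.1 (le_refl |ζ₀'.im|)
  have h9 : (k : ℝ) ≤ K := by
    by_contra hcon
    push Not at hcon
    nlinarith [(Nat.cast_nonneg K : (0 : ℝ) ≤ K)]
  have h10 : -(K : ℝ) ≤ k := by
    by_contra hcon
    push Not at hcon
    nlinarith [(Nat.cast_nonneg K : (0 : ℝ) ≤ K)]
  rw [Finset.mem_Icc]
  exact ⟨by exact_mod_cast h10, by exact_mod_cast h9⟩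

/-- Near a pair of points, no new coincidence of leaves appears, for all translates at once. -/
theorem RadialFoliation.eventually_forall_pointLT (F : RadialFoliation) {ζ₀ ζ₀' : ℂ}
    (hζ : ζ₀ ∈ cover) (hζ' : ζ₀' ∈ cover) (hne : Complex.exp ζ₀ ≠ Complex.exp ζ₀') :
    ∀ᶠ p : ℂ × ℂ in 𝓝 (ζ₀, ζ₀'), ∀ k : ℤ, F.PointLT p.1 (deck k p.2) →
      F.PointLT ζ₀ (deck k ζ₀') := by
  obtain ⟨K, hK⟩ := F.exists_bound_deck hζ hζ'
  have h1 : ∀ k ∈ Finset.Icc (-(K : ℤ)) K, ∀ᶠ p : ℂ × ℂ in 𝓝 (ζ₀, ζ₀'),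
      F.PointLT p.1 (deck k p.2) → F.PointLT ζ₀ (deck k ζ₀') := by
    intro k _
    by_cases h : F.PointLT ζ₀ (deck k ζ₀')
    · exact Eventually.of_forall fun _ _ => h
    · have ht : Tendsto (fun p : ℂ × ℂ => (p.1, deck k p.2)) (𝓝 (ζ₀, ζ₀')) (𝓝 (ζ₀, deck k ζ₀')) :=
        (Continuous.prodMk continuous_fst ((continuous_deck k).comp continuous_snd)).tendsto (ζ₀, ζ₀')
      filter_upwards [ht.eventually (F.eventually_not_pointLT hζ (deck_mem_cover.2 hζ')
        (fun he => hne (by rw [he, exp_deck])) h)] with p hp hlt using (hp hlt).elim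
  filter_upwards [hK, (Filter.eventually_all_finset _).2 h1] with p hp hp' k hlt
  exact hp' k (hp k hlt) hlt

/-! ### The discretized angle -/

theorem RadialFoliation.theta_cases {ζ ζ' : ℂ} (hζ : ζ ∈ cover) (hζ' : ζ' ∈ cover) (hne : ζ ≠ ζ') :
    (F.PointLT ζ ζ' ∧ F.theta ζ ζ' = 0) ∨ (F.Below ζ ζ' ∧ F.theta ζ ζ' = 1) ∨
      (F.PointLT ζ' ζ ∧ F.theta ζ ζ' = 2) ∨ (F.Below ζ' ζ ∧ F.theta ζ ζ' = 3) := by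
  unfold RadialFoliation.theta
  rw [leafLT_iff hζ hζ']
  by_cases hm : ζ' ∈ F.liftedLeaf ζ
  · have hb : ¬ F.Below ζ ζ' := fun h => h.notMem hm
    rcases F.pointLT_or hζ hm with h | h | h
    · exact Or.inl ⟨h, if_pos h⟩
    · exact absurd h.symm hne
    · have hn : ¬ F.PointLT ζ ζ' := fun h' => F.pointLT_irrefl _ (h.trans h')
      exact Or.inr (Or.inr (Or.inl ⟨h, by rw [if_neg hn, if_neg hb, if_pos h]⟩))
  · have hn : ¬ F.PointLT ζ ζ' := fun h => hm h.mem_liftedLeaf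
    rcases F.below_or hζ hζ' hm with h | h
    · exact Or.inr (Or.inl ⟨h, by rw [if_neg hn, if_pos h]⟩)
    · have hn' : ¬ F.PointLT ζ' ζ := fun h' => h.notMem h'.mem_liftedLeaf
      exact Or.inr (Or.inr (Or.inr ⟨h, by rw [if_neg hn, if_neg h.not_symm, if_neg hn']⟩))

section theta

variable {ζ ζ' : ℂ} (hζ : ζ ∈ cover) (hζ' : ζ' ∈ cover) (hne : ζ ≠ ζ')
include hζ hζ' hne

theorem RadialFoliation.theta_eq_zero_iff : F.theta ζ ζ' = 0 ↔ F.PointLT ζ ζ' := by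
  rcases F.theta_cases hζ hζ' hne with ⟨h, e⟩ | ⟨h, e⟩ | ⟨h, e⟩ | ⟨h, e⟩ <;> rw [e]
  · simpa using h
  · exact ⟨fun h' => absurd h' (by decide), fun h' => absurd h'.mem_liftedLeaf h.notMem⟩
  · exact ⟨fun h' => absurd h' (by decide), fun h' => absurd (h.trans h') (F.pointLT_irrefl _)⟩
  · exact ⟨fun h' => absurd h' (by decide), fun h' => absurd h'.mem_liftedLeaf' h.notMem⟩

theorem RadialFoliation.theta_eq_one_iff : F.theta ζ ζ' = 1 ↔ F.Below ζ ζ' := by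
  rcases F.theta_cases hζ hζ' hne with ⟨h, e⟩ | ⟨h, e⟩ | ⟨h, e⟩ | ⟨h, e⟩ <;> rw [e]
  · exact ⟨fun h' => absurd h' (by decide), fun h' => absurd h.mem_liftedLeaf h'.notMem⟩
  · simpa using h
  · exact ⟨fun h' => absurd h' (by decide), fun h' => absurd h.mem_liftedLeaf' h'.notMem⟩
  · exact ⟨fun h' => absurd h' (by decide), fun h' => absurd h h'.not_symm⟩

theorem RadialFoliation.theta_eq_two_iff : F.theta ζ ζ' = 2 ↔ F.PointLT ζ' ζ := by
  rcases F.theta_cases hζ hζ' hne with ⟨h, e⟩ | ⟨h, e⟩ | ⟨h, e⟩ | ⟨h, e⟩ <;> rw [e]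
  · exact ⟨fun h' => absurd h' (by decide), fun h' => absurd (h.trans h') (F.pointLT_irrefl _)⟩
  · exact ⟨fun h' => absurd h' (by decide), fun h' => absurd h'.mem_liftedLeaf' h.notMem⟩
  · simpa using h
  · exact ⟨fun h' => absurd h' (by decide), fun h' => absurd h'.mem_liftedLeaf h.notMem⟩

theorem RadialFoliation.theta_eq_three_iff : F.theta ζ ζ' = 3 ↔ F.Below ζ' ζ := by
  rcases F.theta_cases hζ hζ' hne with ⟨h, e⟩ | ⟨h, e⟩ | ⟨h, e⟩ | ⟨h, e⟩ <;> rw [e]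
  · exact ⟨fun h' => absurd h' (by decide), fun h' => absurd h.mem_liftedLeaf' h'.notMem⟩
  · exact ⟨fun h' => absurd h' (by decide), fun h' => absurd h h'.not_symm⟩
  · exact ⟨fun h' => absurd h' (by decide), fun h' => absurd h.mem_liftedLeaf h'.notMem⟩
  · simpa using h

end theta

/-! ### The order along the leaves of the punctured disk -/

/-- `z` comes before `w` on the same leaf of the foliation of the punctured disk. -/
def RadialFoliation.Before (F : RadialFoliation) (z w : ℂ) : Prop :=
  ∃ ζ ζ', F.PointLT ζ ζ' ∧ Complex.exp ζ = z ∧ Complex.exp ζ' = w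

theorem RadialFoliation.before_exp_iff {ζ ζ' : ℂ} :
    F.Before (Complex.exp ζ) (Complex.exp ζ') ↔ ∃ k, F.PointLT ζ (deck k ζ') := by
  constructor
  · rintro ⟨η, η', h, h1, h2⟩
    obtain ⟨k, rfl⟩ := exists_deck_of_exp_eq h1
    obtain ⟨l, rfl⟩ := exists_deck_of_exp_eq h2
    exact ⟨-k + l, by simpa [deck_deck] using h.deck (-k)⟩
  · rintro ⟨k, h⟩
    exact ⟨_, _, h, rfl, exp_deck k ζ'⟩

theorem RadialFoliation.Before.trans {a b c : ℂ} (h : F.Before a b) (h' : F.Before b c) :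
    F.Before a c := by
  obtain ⟨ζ, ζ', h1, rfl, rfl⟩ := h
  obtain ⟨η, η', h2, he, rfl⟩ := h'
  obtain ⟨k, rfl⟩ := exists_deck_of_exp_eq he
  have h3 := h2.deck (-k)
  simp only [deck_deck, neg_add_cancel, deck_zero] at h3
  exact ⟨_, _, h1.trans h3, rfl, exp_deck _ _⟩

theorem RadialFoliation.before_irrefl (z : ℂ) : ¬ F.Before z z := by
  rintro ⟨ζ, ζ', h, h1, h2⟩
  obtain ⟨k, rfl⟩ := exists_deck_of_exp_eq (h2.trans h1.symm)
  by_cases hk : k = 0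
  · rw [hk, deck_zero] at h
    exact F.pointLT_irrefl _ h
  · exact F.deck_notMem h.left_mem hk h.mem_liftedLeaf

theorem isOpenMap_exp_prod :
    IsOpenMap fun p : ℂ × ℂ => (Complex.exp p.1, Complex.exp p.2) :=
  Complex.isOpenMap_exp.prodMap Complex.isOpenMap_exp

theorem RadialFoliation.eventually_not_before {z z' : ℂ} (hz : z ∈ diskStar) (hz' : z' ∈ diskStar)
    (hne : z ≠ z') (h : ¬ F.Before z z') : ∀ᶠ p : ℂ × ℂ in 𝓝 (z, z'), ¬ F.Before p.1 p.2 := by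
  have e := Complex.exp_log (ne_zero_of_mem_diskStar hz)
  have e' := Complex.exp_log (ne_zero_of_mem_diskStar hz')
  rw [← e, ← e'] at hne h
  have h1 := isOpenMap_exp_prod.image_mem_nhds (F.eventually_forall_pointLT (log_mem_cover hz)
    (log_mem_cover hz') hne)
  simp only [e, e'] at h1
  filter_upwards [h1]
  rintro _ ⟨⟨ζ, ζ'⟩, hp, rfl⟩ hb
  obtain ⟨k, hk⟩ := before_exp_iff.1 hb
  exact h (before_exp_iff.2 ⟨k, hp k hk⟩)

/-- The path that comes from `0` along the leaf of `z` up to `z`. -/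
theorem RadialFoliation.exists_backward_path (F : RadialFoliation) {z : ℂ} (hz : z ∈ diskStar) :
    ∃ p : ℝ → ℂ, ContinuousOn p (Icc 0 1) ∧ p 0 = 0 ∧ p 1 = z ∧
      ∀ s ∈ Icc (0 : ℝ) 1, ‖p s‖ < 1 ∧ (p s ≠ 0 → p s = z ∨ F.Before (p s) z) := by
  obtain ⟨γ, t, hγ, ht⟩ := F.exists_curve (log_mem_cover hz)
  have he : Complex.exp (γ t) = z := by rw [ht, Complex.exp_log (ne_zero_of_mem_diskStar hz)]
  have hray := hγ.1.isRay
  -- `log s` sends `(0, 1]` to the past of `z`.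
  refine ⟨fun s => if s = 0 then 0 else Complex.exp (γ (t + Real.log s)), ?_, by simp, by simp [he], ?_⟩
  · intro s hs
    rcases hs.1.eq_or_lt with h0 | h0
    · subst h0
      have h1 : Tendsto (fun s => Complex.exp (γ (t + Real.log s))) (𝓝[>] 0) (𝓝 0) :=
        hray.past.comp (tendsto_atBot_add_const_left _ t Real.tendsto_log_nhdsGT_zero)
      show Tendsto _ _ (𝓝 (if (0 : ℝ) = 0 then 0 else _))
      rw [if_pos rfl]
      have h2 : Tendsto (fun s => if s = 0 then 0 else Complex.exp (γ (t + Real.log s)))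
          (𝓝[≥] (0 : ℝ)) (𝓝 0) := by
        rw [← Ioi_insert, nhdsWithin_insert, tendsto_sup]
        refine ⟨?_, h1.congr' ?_⟩
        · rw [tendsto_pure_left]
          intro s hs
          simpa using mem_of_mem_nhds hs
        filter_upwards [self_mem_nhdsWithin] with s hs
        rw [if_neg (ne_of_gt hs)]
      exact h2.mono_left (nhdsWithin_mono _ Icc_subset_Ici_self)
    · have h1 : ContinuousAt (fun s => Complex.exp (γ (t + Real.log s))) s :=
        hray.continuous.continuousAt.comp (continuousAt_const.add (Real.continuousAt_log h0.ne'))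
      refine (h1.congr ?_).continuousWithinAt
      filter_upwards [eventually_ne_nhds h0.ne'] with s hs
      rw [if_neg hs]
  · intro s hs
    rcases hs.1.eq_or_lt with h0 | h0
    · subst h0
      simp
    · simp only [if_neg h0.ne']
      refine ⟨(hray.mem _).2, fun _ => ?_⟩
      rcases hs.2.eq_or_lt with h1 | h1
      · left; simp [h1, he]
      · right
        exact ⟨_, _, hγ.pointLT_iff_lt.2 (by linarith [Real.log_neg h0 h1]), rfl, he⟩

/-- A path that goes from `z` along its leaf until it is close to the unit circle. -/
theorem RadialFoliation.exists_forward_path (F : RadialFoliation) {z : ℂ} (hz : z ∈ diskStar)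
    {r : ℝ} (hr : r < 1) :
    ∃ q : ℝ → ℂ, Continuous q ∧ q 0 = z ∧ r < ‖q 1‖ ∧
      ∀ s ∈ Icc (0 : ℝ) 1, q s ∈ diskStar ∧ (q s = z ∨ F.Before z (q s)) := by
  obtain ⟨γ, t, hγ, ht⟩ := F.exists_curve (log_mem_cover hz)
  have he : Complex.exp (γ t) = z := by rw [ht, Complex.exp_log (ne_zero_of_mem_diskStar hz)]
  have hray := hγ.1.isRay
  obtain ⟨T, hT1, hT2⟩ := ((hray.future.eventually_const_lt hr).and (eventually_gt_atTop t)).exists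
  refine ⟨fun s => Complex.exp (γ (t + s * (T - t))), hray.continuous.comp (by fun_prop),
    by simp [he], by simpa using hT1, fun s hs => ⟨hray.mem _, ?_⟩⟩
  rcases hs.1.eq_or_lt with h0 | h0
  · left; simp [← h0, he]
  · right
    exact ⟨_, _, hγ.pointLT_iff_lt.2 (by nlinarith), he, rfl⟩

/-! ### The branch of the angle defined by a foliation -/

open Classical in
/-- The branch of the argument (in turns) of `1 - z' / z` on the complement of the closed half-leaf
that starts at `z`: it vanishes at `z' = 0` and is continued along the leaf of `z'`. -/
def RadialFoliation.branch (F : RadialFoliation) (z z' : ℂ) : ℝ :=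
  if h : z' ∈ diskStar then
    angleVariation fun s => 1 - (F.exists_backward_path h).choose s / z
  else 0

theorem one_sub_div_ne_zero {z w : ℂ} (hz : z ≠ 0) (h : w ≠ z) : 1 - w / z ≠ 0 := by
  rw [sub_ne_zero]
  intro he
  exact h ((div_eq_one_iff_eq hz).1 he.symm)

theorem exists_norm_lt_of_continuousOn {p : ℝ → ℂ} (hp : ContinuousOn p (Icc 0 1))
    (h : ∀ s ∈ Icc (0 : ℝ) 1, ‖p s‖ < 1) : ∃ r < 1, ∀ s ∈ Icc (0 : ℝ) 1, ‖p s‖ ≤ r := by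
  obtain ⟨m, hm, hmax⟩ := isCompact_Icc.exists_isMaxOn (nonempty_Icc.2 zero_le_one) hp.norm
  exact ⟨_, h m hm, fun s hs => hmax hs⟩

theorem one_sub_div_re_pos {z w : ℂ} (h : ‖w‖ < ‖z‖) : 0 < (1 - w / z).re := by
  have h1 : ‖w / z‖ < 1 := by
    rw [norm_div, div_lt_one ((norm_nonneg w).trans_lt h)]
    exact h
  have := (Complex.re_le_norm (w / z)).trans_lt h1
  simp only [Complex.sub_re, Complex.one_re]
  linarith

/-- Both ways of computing the branch: continue in the second variable along a path from `0`,
or in the first one along a path to the boundary. -/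
theorem angleVariation_add_of_paths {p q : ℝ → ℂ} (hp : ContinuousOn p (Icc 0 1)) (hp0 : p 0 = 0)
    (hq : Continuous q) (hq0 : ∀ r ∈ Icc (0 : ℝ) 1, q r ≠ 0)
    (hpq : ∀ r ∈ Icc (0 : ℝ) 1, ∀ s ∈ Icc (0 : ℝ) 1, p s ≠ q r)
    (hq1 : ∀ s ∈ Icc (0 : ℝ) 1, ‖p s‖ < ‖q 1‖) :
    angleVariation (fun s => 1 - p s / q 0) + angleVariation (fun r => 1 - p 1 / q r) =
      (1 - p 1 / q 1).arg / (2 * π) := by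
  have hc : ContinuousOn (fun x : ℝ × ℝ => 1 - p x.2 / q x.1) (Icc 0 1 ×ˢ Icc 0 1) := by
    refine continuousOn_const.sub (ContinuousOn.div ?_ ?_ fun x hx => hq0 _ hx.1)
    · exact hp.comp continuousOn_snd fun x hx => hx.2
    · exact (hq.comp continuous_fst).continuousOn
  have := angleVariation_square (H := fun r s => 1 - p s / q r) hc
    (fun r hr s hs => one_sub_div_ne_zero (hq0 r hr) (hpq r hr s hs))
  rw [this]
  simp only [hp0, zero_div, sub_zero]
  rw [angleVariation_const one_ne_zero, angleVariation_of_slitPlane (γ := fun s => 1 - p s / q 1)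
    (continuousOn_const.sub (hp.div_const _))
    (fun s hs => Or.inl (one_sub_div_re_pos (hq1 s hs))), hp0]
  simp

theorem RadialFoliation.exists_branch_path (F : RadialFoliation) {z' : ℂ} (hz' : z' ∈ diskStar) :
    ∃ p : ℝ → ℂ, ContinuousOn p (Icc 0 1) ∧ p 0 = 0 ∧ p 1 = z' ∧ (∀ s ∈ Icc (0 : ℝ) 1, ‖p s‖ < 1) ∧
      (∀ z, F.branch z z' = angleVariation fun s => 1 - p s / z) ∧
      ∀ z ∈ diskStar, z ≠ z' → ¬ F.Before z z' → ∀ s ∈ Icc (0 : ℝ) 1, ∀ w ∈ diskStar,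
        (w = z ∨ F.Before z w) → p s ≠ w := by
  have hs := (F.exists_backward_path hz').choose_spec
  set p := (F.exists_backward_path hz').choose with hp
  refine ⟨p, hs.1, hs.2.1, hs.2.2.1, fun s h => (hs.2.2.2 s h).1, fun z => ?_, ?_⟩
  · rw [RadialFoliation.branch, dif_pos hz']
  · intro z hz hne hb s h w hw hzw he
    have h1 := (hs.2.2.2 s h).2 (by rw [he]; exact ne_zero_of_mem_diskStar hw)
    rw [he] at h1
    rcases hzw with rfl | hzw
    · exact h1.elim hne hb
    · rcases h1 with rfl | h1
      · exact hb hzw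
      · exact hb (hzw.trans h1)

section branch

variable {z z' : ℂ} (hz : z ∈ diskStar) (hz' : z' ∈ diskStar) (hne : z ≠ z')
  (hb : ¬ F.Before z z')
include hz hz' hne hb

theorem RadialFoliation.isTurn_branch : IsTurn (F.branch z z') (1 - z' / z) := by
  obtain ⟨p, hp, hp0, hp1, -, hbr, hav⟩ := F.exists_branch_path hz'
  rw [hbr]
  have := isTurn_angleVariation (γ := fun s => 1 - p s / z) (continuousOn_const.sub (hp.div_const _))
    (fun s hs => one_sub_div_ne_zero (ne_zero_of_mem_diskStar hz)
      (hav z hz hne hb s hs z hz (Or.inl rfl)))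
  simpa [hp0, hp1] using this

/-- The branch is locally given by the principal argument. -/
theorem RadialFoliation.eventually_branch_eq : ∀ᶠ x : ℂ × ℂ in 𝓝 (z, z'),
    F.branch x.1 x.2 = F.branch z z' +
      ((1 - x.2 / x.1) / (1 - z' / z)).arg / (2 * π) := by
  have hz0 := ne_zero_of_mem_diskStar hz
  have h0 : 1 - z' / z ≠ 0 := one_sub_div_ne_zero hz0 hne.symm
  have hcont : ContinuousAt (fun x : ℂ × ℂ => (1 - x.2 / x.1) / (1 - z' / z)) (z, z') := by
    refine ContinuousAt.div_const (continuousAt_const.sub ?_) _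
    exact continuousAt_snd.div continuousAt_fst hz0
  have hre : ∀ᶠ x : ℂ × ℂ in 𝓝 (z, z'), 0 < ((1 - x.2 / x.1) / (1 - z' / z)).re := by
    refine (Complex.continuous_re.continuousAt.comp hcont).eventually (lt_mem_nhds ?_)
    simp [div_self h0]
  have hall : ∀ᶠ x : ℂ × ℂ in 𝓝 (z, z'), 0 < ((1 - x.2 / x.1) / (1 - z' / z)).re ∧
      x.1 ∈ diskStar ∧ x.2 ∈ diskStar ∧ x.1 ≠ x.2 ∧ ¬ F.Before x.1 x.2 := by
    filter_upwards [hre, F.eventually_not_before hz hz' hne hb,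
      prod_mem_nhds (isOpen_diskStar.mem_nhds hz) (isOpen_diskStar.mem_nhds hz'),
      (isOpen_ne_fun continuous_fst continuous_snd).mem_nhds hne] with x h1 h2 h3 h4
    exact ⟨h1, h3.1, h3.2, h4, h2⟩
  -- On a small product of balls the difference does not vanish and all pairs avoid the half-leaves.
  obtain ⟨δ, hδ, hball⟩ := Metric.eventually_nhds_iff_ball.1 hall
  have hmem : ∀ w w', w ∈ Metric.ball z δ → w' ∈ Metric.ball z' δ → (w, w') ∈ Metric.ball (z, z') δ :=
    fun w w' h h' => by rw [← ball_prod_same]; exact ⟨h, h'⟩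
  filter_upwards [Metric.ball_mem_nhds (z, z') hδ]
  rintro ⟨w, w'⟩ hw
  rw [← ball_prod_same] at hw
  obtain ⟨hw1, hw2⟩ := hw
  simp only at hw1 hw2 ⊢
  have hseg : ∀ (a c : ℂ), c ∈ Metric.ball a δ → ∀ r ∈ Icc (0 : ℝ) 1,
      a + r * (c - a) ∈ Metric.ball a δ := by
    intro a c hc r hr
    rw [Metric.mem_ball, dist_eq_norm] at hc ⊢
    rw [add_sub_cancel_left, norm_mul, Complex.norm_real, Real.norm_eq_abs, abs_of_nonneg hr.1]
    nlinarith [hr.2, norm_nonneg (c - a), hr.1]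
  have hzc : z ∈ Metric.ball z δ := Metric.mem_ball_self hδ
  have hzc' : z' ∈ Metric.ball z' δ := Metric.mem_ball_self hδ
  -- Move the first variable along a segment, the path `p` from `0` to `z'` being kept.
  have step1 : F.branch w z' = F.branch z z' + ((1 - z' / w) / (1 - z' / z)).arg / (2 * π) := by
    obtain ⟨p, hp, hp0, hp1, -, hbr, hav⟩ := F.exists_branch_path hz'
    have hm : ∀ r ∈ Icc (0 : ℝ) 1, _ := fun r hr => hball _ (hmem _ _ (hseg z w hw1 r hr) hzc')
    have hc : ContinuousOn (fun x : ℝ × ℝ => 1 - p x.2 / (z + x.1 * (w - z)))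
        (Icc 0 1 ×ˢ Icc 0 1) := by
      refine continuousOn_const.sub (ContinuousOn.div ?_ ?_
        fun x hx => ne_zero_of_mem_diskStar (hm _ hx.1).2.1)
      · exact hp.comp continuousOn_snd fun x hx => hx.2
      · fun_prop
    have hsq := angleVariation_square (H := fun r s => 1 - p s / (z + r * (w - z))) hc
      (fun r hr s hs => one_sub_div_ne_zero (ne_zero_of_mem_diskStar (hm r hr).2.1)
        (hav _ (hm r hr).2.1 (hm r hr).2.2.2.1 (hm r hr).2.2.2.2 s hs _ (hm r hr).2.1 (Or.inl rfl)))
    simp only [hp0, hp1, zero_div, sub_zero, Complex.ofReal_zero, zero_mul, add_zero,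
      Complex.ofReal_one, one_mul, add_sub_cancel] at hsq
    rw [angleVariation_const one_ne_zero, zero_add, ← hbr, ← hbr] at hsq
    rw [← hsq]
    congr 1
    have h1 := angleVariation_of_slitPlane
      (γ := fun r : ℝ => (1 - z' / (z + r * (w - z))) / (1 - z' / z))
      ((continuousOn_const.sub (ContinuousOn.div continuousOn_const (by fun_prop)
        fun r hr => ne_zero_of_mem_diskStar (hm r hr).2.1)).div_const _)
      (fun r hr => Or.inl (hm r hr).1)
    have h2 := angleVariation_mul
      (γ := fun r : ℝ => (1 - z' / (z + r * (w - z))) / (1 - z' / z))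
      (δ := fun _ => 1 - z' / z)
      ((continuousOn_const.sub (ContinuousOn.div continuousOn_const (by fun_prop)
        fun r hr => ne_zero_of_mem_diskStar (hm r hr).2.1)).div_const _)
      (fun r hr hh => by
        have := (hm r hr).1
        simp only at hh this
        rw [hh] at this
        simp at this) continuousOn_const (fun _ _ => h0)
    rw [angleVariation_const h0, add_zero, h1] at h2
    simp only [div_mul_cancel₀ _ h0] at h2
    rw [h2]
    simp [div_self h0]
  -- Move the second variable along a segment: the branch is computed from the far end of the
  -- half-leaf of `w`, where `1 - z'/w` has positive real part.
  have step2 : F.branch w w' = F.branch w z' + (((1 - w' / w) / (1 - z' / z)).arg / (2 * π) -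
      ((1 - z' / w) / (1 - z' / z)).arg / (2 * π)) := by
    obtain ⟨hm0, hwD, hw'D, hww, hwb⟩ := hball _ (hmem _ _ hw1 hw2)
    simp only at hm0 hwD hw'D hww hwb
    have hm : ∀ r ∈ Icc (0 : ℝ) 1, _ := fun r hr => hball _ (hmem _ _ hw1 (hseg z' w' hw2 r hr))
    have hm1 := hball _ (hmem _ _ hw1 hzc')
    obtain ⟨p, hp, hp0, hp1, hpn, hbr, hav⟩ := F.exists_branch_path hz'
    obtain ⟨p', hp', hp0', hp1', hpn', hbr', hav'⟩ := F.exists_branch_path hw'D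
    obtain ⟨r₁, hr₁, hr₁'⟩ := exists_norm_lt_of_continuousOn hp hpn
    obtain ⟨r₂, hr₂, hr₂'⟩ := exists_norm_lt_of_continuousOn hp' hpn'
    obtain ⟨r₃, hr₃, hr₃'⟩ := exists_norm_lt_of_continuousOn
      (p := fun r : ℝ => z' + r * (w' - z')) (by fun_prop) (fun r hr => (hm r hr).2.2.1.2)
    obtain ⟨q, hq, hq0, hqr, hqm⟩ := F.exists_forward_path hwD (max_lt hr₁ (max_lt hr₂ hr₃))
    have hqne : ∀ r ∈ Icc (0 : ℝ) 1, q r ≠ 0 := fun r hr => ne_zero_of_mem_diskStar (hqm r hr).1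
    have e1 := angleVariation_add_of_paths hp hp0 hq hqne
      (fun r hr s hs => hav w hwD hm1.2.2.2.1 hm1.2.2.2.2 s hs _ (hqm r hr).1 (hqm r hr).2)
      (fun s hs => (hr₁' s hs).trans_lt ((le_max_left _ _).trans_lt hqr))
    have e2 := angleVariation_add_of_paths hp' hp0' hq hqne
      (fun r hr s hs => hav' w hwD hww hwb s hs _ (hqm r hr).1 (hqm r hr).2)
      (fun s hs => (hr₂' s hs).trans_lt
        (((le_max_left _ _).trans (le_max_right _ _)).trans_lt hqr))
    rw [hq0, ← hbr, hp1] at e1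
    rw [hq0, ← hbr', hp1'] at e2
    have hc : ContinuousOn (fun x : ℝ × ℝ => 1 - (z' + x.1 * (w' - z')) / q x.2)
        (Icc 0 1 ×ˢ Icc 0 1) := by
      refine continuousOn_const.sub (ContinuousOn.div (by fun_prop) ?_ fun x hx => hqne _ hx.2)
      exact (hq.comp continuous_snd).continuousOn
    have hsq := angleVariation_square (H := fun r s => 1 - (z' + r * (w' - z')) / q s) hc
      (fun r hr s hs => one_sub_div_ne_zero (hqne s hs) (fun he => by
        rcases (hqm s hs).2 with h | h
        · rw [h] at he
          exact (hm r hr).2.2.2.1 he.symm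
        · rw [← he] at h
          exact (hm r hr).2.2.2.2 h))
    simp only [Complex.ofReal_zero, zero_mul, add_zero,
      Complex.ofReal_one, one_mul, add_sub_cancel, hq0] at hsq
    rw [angleVariation_of_slitPlane (γ := fun r : ℝ => 1 - (z' + r * (w' - z')) / q 1) (by fun_prop)
      (fun r hr => Or.inl (one_sub_div_re_pos ((hr₃' r hr).trans_lt
        (((le_max_right _ _).trans (le_max_right _ _)).trans_lt hqr))))] at hsq
    simp only [Complex.ofReal_zero, zero_mul, add_zero,
      Complex.ofReal_one, one_mul, add_sub_cancel] at hsq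
    have h1 := angleVariation_of_slitPlane
      (γ := fun r : ℝ => (1 - (z' + r * (w' - z')) / w) / (1 - z' / z)) (by fun_prop)
      (fun r hr => Or.inl (hm r hr).1)
    have h2 := angleVariation_mul
      (γ := fun r : ℝ => (1 - (z' + r * (w' - z')) / w) / (1 - z' / z))
      (δ := fun _ => 1 - z' / z) (by fun_prop)
      (fun r hr hh => by
        have := (hm r hr).1
        simp only at hh this
        rw [hh] at this
        simp at this) continuousOn_const (fun _ _ => h0)
    rw [angleVariation_const h0, add_zero, h1] at h2
    simp only [div_mul_cancel₀ _ h0, Complex.ofReal_zero, zero_mul, add_zero,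
      Complex.ofReal_one, one_mul, add_sub_cancel] at h2
    rw [← sub_div, ← h2]
    rw [sub_div] at hsq
    linarith
  rw [step2, step1]
  ring

theorem RadialFoliation.continuousAt_branch :
    ContinuousAt (fun x : ℂ × ℂ => F.branch x.1 x.2) (z, z') := by
  have hz0 := ne_zero_of_mem_diskStar hz
  have h0 : 1 - z' / z ≠ 0 := one_sub_div_ne_zero hz0 hne.symm
  have hcont : ContinuousAt (fun x : ℂ × ℂ => (1 - x.2 / x.1) / (1 - z' / z)) (z, z') := by
    refine ContinuousAt.div_const (continuousAt_const.sub ?_) _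
    exact continuousAt_snd.div continuousAt_fst hz0
  have h1 : ContinuousAt (fun x : ℂ × ℂ => F.branch z z' +
      ((1 - x.2 / x.1) / (1 - z' / z)).arg / (2 * π)) (z, z') := by
    refine continuousAt_const.add (ContinuousAt.div_const ?_ _)
    refine ContinuousAt.comp (g := Complex.arg) (Complex.continuousAt_arg ?_) hcont
    left
    simp [div_self h0]
  refine h1.congr ?_
  filter_upwards [F.eventually_branch_eq hz hz' hne hb] with x hx using hx.symm

end branch

/-! ### Exchanging the two points in the branch -/

theorem RadialFoliation.below_deck_or_eq (F : RadialFoliation) {ζ : ℂ} (hζ : ζ ∈ cover) {k l : ℤ}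
    (h : k ≤ l) : F.Below (deck k ζ) (deck l ζ) ∨ deck k ζ = deck l ζ := by
  rcases h.lt_or_eq with h | rfl
  · exact Or.inl (F.below_deck_of_lt hζ h)
  · exact Or.inr rfl

theorem RadialFoliation.Below.trans_deck {ζ ζ' : ℂ} (h : F.Below ζ ζ') {k : ℤ} (hk : 0 ≤ k) :
    F.Below ζ (CalabiRadial.deck k ζ') := by
  rcases F.below_deck_or_eq h.right_mem hk with h1 | h1 <;> rw [deck_zero] at h1
  · exact h.trans h1
  · rwa [← h1]

theorem RadialFoliation.Below.deck_trans {ζ ζ' : ℂ} (h : F.Below ζ ζ') {k : ℤ} (hk : k ≤ 0) :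
    F.Below (CalabiRadial.deck k ζ) ζ' := by
  rcases F.below_deck_or_eq h.left_mem hk with h1 | h1 <;> rw [deck_zero] at h1
  · exact h1.trans h
  · rwa [h1]

/-- The leaf of `ζ'` lies strictly between the leaf of `ζ` and its first translate. -/
def RadialFoliation.Between (F : RadialFoliation) (ζ ζ' : ℂ) : Prop :=
  F.Below ζ ζ' ∧ F.Below ζ' (deck 1 ζ)

theorem RadialFoliation.Between.deck_notMem {ζ ζ' : ℂ} (h : F.Between ζ ζ') (k : ℤ) :
    deck k ζ' ∉ F.liftedLeaf ζ := by
  rcases le_or_gt 0 k with hk | hk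
  · exact (h.1.trans_deck hk).notMem
  · have := h.2.deck (-1)
    rw [deck_deck] at this
    simp only [Int.reduceNeg, neg_add_cancel, deck_zero] at this
    have := this.deck_trans (k := k + 1) (by omega)
    rw [deck_deck, add_neg_cancel_right] at this
    exact this.notMem'

theorem RadialFoliation.Between.not_before {ζ ζ' : ℂ} (h : F.Between ζ ζ') :
    ¬ F.Before (Complex.exp ζ) (Complex.exp ζ') := fun hb => by
  obtain ⟨k, hk⟩ := before_exp_iff.1 hb
  exact h.deck_notMem k hk.mem_liftedLeaf

theorem RadialFoliation.Between.not_before' {ζ ζ' : ℂ} (h : F.Between ζ ζ') :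
    ¬ F.Before (Complex.exp ζ') (Complex.exp ζ) := fun hb => by
  obtain ⟨k, hk⟩ := before_exp_iff.1 hb
  have := hk.deck (-k)
  rw [deck_deck, neg_add_cancel, deck_zero] at this
  exact h.deck_notMem (-k) this.mem_liftedLeaf'

theorem RadialFoliation.Between.exp_ne {ζ ζ' : ℂ} (h : F.Between ζ ζ') :
    Complex.exp ζ ≠ Complex.exp ζ' := fun he => by
  obtain ⟨k, rfl⟩ := exists_deck_of_exp_eq he
  exact h.deck_notMem k (F.mem_liftedLeaf h.1.left_mem)

/-- Two leaves are joined by a connected set that stays between them: the leaves themselves and a piece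
of a segment. -/
theorem RadialFoliation.Below.exists_isPreconnected {ξ₁ ξ₂ : ℂ} (h : F.Below ξ₁ ξ₂) :
    ∃ S : Set ℂ, IsPreconnected S ∧ ξ₁ ∈ S ∧ ξ₂ ∈ S ∧
      ∀ ξ ∈ S, ξ ∈ F.liftedLeaf ξ₁ ∨ ξ ∈ F.liftedLeaf ξ₂ ∨ (F.Below ξ₁ ξ ∧ F.Below ξ ξ₂) := by
  set σ : ℝ → ℂ := fun s => ξ₁ + s * (ξ₂ - ξ₁) with hσ
  have hσc : Continuous σ := by fun_prop
  have hσ0 : σ 0 = ξ₁ := by simp [hσ]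
  have hσ1 : σ 1 = ξ₂ := by simp [hσ]
  have hσm : ∀ s ∈ Icc (0 : ℝ) 1, σ s ∈ cover := fun s hs => by
    have := convex_cover.add_smul_sub_mem h.left_mem h.right_mem hs
    simpa [hσ] using this
  have hA : IsCompact {s ∈ Icc (0 : ℝ) 1 | ¬ F.Below ξ₁ (σ s)} :=
    isCompact_Icc.inter_right ((F.isOpen_below_right ξ₁).preimage hσc).isClosed_compl
  -- `s₁` is the last time at which the segment is not above the first leaf, and `s₂` the next time at
  -- which it is not below the second one.
  obtain ⟨s₁, ⟨hs₁, hs₁'⟩, hmax⟩ := hA.exists_isGreatest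
    ⟨0, ⟨by simp, by rw [hσ0]; exact F.below_irrefl _⟩⟩
  have hB : IsCompact {s ∈ Icc s₁ 1 | ¬ F.Below (σ s) ξ₂} :=
    isCompact_Icc.inter_right ((F.isOpen_below_left ξ₂).preimage hσc).isClosed_compl
  obtain ⟨s₂, ⟨hs₂, hs₂'⟩, hmin⟩ := hB.exists_isLeast
    ⟨1, ⟨⟨hs₁.2, le_rfl⟩, by rw [hσ1]; exact F.below_irrefl _⟩⟩
  have hup : ∀ s ∈ Ioc s₁ 1, F.Below ξ₁ (σ s) := fun s hs => by
    by_contra hn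
    exact hs.1.not_ge (hmax ⟨⟨hs₁.1.trans hs.1.le, hs.2⟩, hn⟩)
  have hdown : ∀ s ∈ Ico s₁ s₂, F.Below (σ s) ξ₂ := fun s hs => by
    by_contra hn
    exact hs.2.not_ge (hmin ⟨⟨hs.1, hs.2.le.trans hs₂.2⟩, hn⟩)
  have h1lt : s₁ < 1 := hs₁.2.lt_of_ne fun he => hs₁' (by rw [he, hσ1]; exact h)
  have hm1 : σ s₁ ∈ F.liftedLeaf ξ₁ := by
    by_contra hn
    have hb := (F.below_or h.left_mem (hσm _ hs₁) hn).resolve_left hs₁'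
    have hev : ∀ᶠ s in 𝓝[>] s₁, F.Below (σ s) ξ₁ :=
      (hσc.continuousAt.eventually ((F.isOpen_below_left ξ₁).mem_nhds hb)).filter_mono inf_le_left
    obtain ⟨s, hs, hs'⟩ := (hev.and (Ioc_mem_nhdsGT h1lt)).exists
    exact hs.not_symm (hup s hs')
  have h12 : s₁ < s₂ := hs₂.1.lt_of_ne fun he => hs₂' (he ▸ h.congr_left hm1)
  have hm2 : σ s₂ ∈ F.liftedLeaf ξ₂ := by
    by_contra hn
    have hb := (F.below_or h.right_mem (hσm _ ⟨hs₁.1.trans hs₂.1, hs₂.2⟩) hn).resolve_right hs₂'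
    have hev : ∀ᶠ s in 𝓝[<] s₂, F.Below ξ₂ (σ s) :=
      (hσc.continuousAt.eventually ((F.isOpen_below_right ξ₂).mem_nhds hb)).filter_mono inf_le_left
    obtain ⟨s, hs, hs'⟩ := (hev.and (Ico_mem_nhdsLT h12)).exists
    exact hs.not_symm (hdown s hs')
  have hleaf : ∀ ξ ∈ cover, IsPreconnected (F.liftedLeaf ξ) := fun ξ hξ => by
    obtain ⟨γ, t, hγ, -, e⟩ := F.exists_curve_eq hξ
    rw [e]
    exact isPreconnected_range hγ.1.continuous
  have hseg : IsPreconnected (σ '' Icc s₁ s₂) := isPreconnected_Icc.image _ hσc.continuousOn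
  refine ⟨(F.liftedLeaf ξ₁ ∪ σ '' Icc s₁ s₂) ∪ F.liftedLeaf ξ₂, ?_,
    Or.inl (Or.inl (F.mem_liftedLeaf h.left_mem)), Or.inr (F.mem_liftedLeaf h.right_mem), ?_⟩
  · refine IsPreconnected.union (σ s₂) (Or.inr ⟨s₂, ⟨h12.le, le_rfl⟩, rfl⟩) hm2 ?_
      (hleaf _ h.right_mem)
    exact IsPreconnected.union (σ s₁) hm1 ⟨s₁, ⟨le_rfl, h12.le⟩, rfl⟩ (hleaf _ h.left_mem) hseg
  · rintro ξ ((hξ | ⟨s, hs, rfl⟩) | hξ)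
    · exact Or.inl hξ
    · rcases hs.1.eq_or_lt with rfl | h1
      · exact Or.inl hm1
      rcases hs.2.eq_or_lt with rfl | h2
      · exact Or.inr (Or.inl hm2)
      exact Or.inr (Or.inr ⟨hup s ⟨h1, h2.le.trans hs₂.2⟩, hdown s ⟨h1.le, h2⟩⟩)
    · exact Or.inr (Or.inl hξ)

/-- The open strip between a leaf and its first translate is connected. -/
theorem RadialFoliation.isPreconnected_between (F : RadialFoliation) (ζ : ℂ) :
    IsPreconnected {ξ | F.Between ζ ξ} := by
  refine isPreconnected_of_forall_pair fun ξ₁ (h₁ : F.Between ζ ξ₁) ξ₂ (h₂ : F.Between ζ ξ₂) => ?_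
  have hcongr : ∀ {ξ ξ'}, F.Between ζ ξ → ξ' ∈ F.liftedLeaf ξ → F.Between ζ ξ' :=
    fun h h' => ⟨h.1.congr_right h', h.2.congr_left h'⟩
  by_cases hm : ξ₂ ∈ F.liftedLeaf ξ₁
  · refine ⟨F.liftedLeaf ξ₁, fun ξ hξ => hcongr h₁ hξ, F.mem_liftedLeaf h₁.1.right_mem, hm, ?_⟩
    obtain ⟨γ, t, hγ, -, e⟩ := F.exists_curve_eq h₁.1.right_mem
    rw [e]
    exact isPreconnected_range hγ.1.continuous
  · rcases F.below_or h₁.1.right_mem h₂.1.right_mem hm with h | h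
    · obtain ⟨S, hS, h1, h2, hsub⟩ := h.exists_isPreconnected
      refine ⟨S, fun ξ hξ => ?_, h1, h2, hS⟩
      rcases hsub ξ hξ with h' | h' | ⟨h', h''⟩
      · exact hcongr h₁ h'
      · exact hcongr h₂ h'
      · exact ⟨h₁.1.trans h', h''.trans h₂.2⟩
    · obtain ⟨S, hS, h1, h2, hsub⟩ := h.exists_isPreconnected
      refine ⟨S, fun ξ hξ => ?_, h2, h1, hS⟩
      rcases hsub ξ hξ with h' | h' | ⟨h', h''⟩
      · exact hcongr h₂ h'
      · exact hcongr h₁ h'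
      · exact ⟨h₂.1.trans h', h''.trans h₁.2⟩

/-- The defect of symmetry of the branch, corrected by the difference of the arguments of the two
points.  It takes its values in `1/2 + ℤ`. -/
def RadialFoliation.defect (F : RadialFoliation) (ζ ζ' : ℂ) : ℝ :=
  F.branch (Complex.exp ζ) (Complex.exp ζ') - F.branch (Complex.exp ζ') (Complex.exp ζ) -
    (ζ' - ζ).im / (2 * π)

theorem RadialFoliation.defect_swap (F : RadialFoliation) (ζ ζ' : ℂ) :
    F.defect ζ' ζ = - F.defect ζ ζ' := by
  simp only [defect, Complex.sub_im]
  ring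

theorem RadialFoliation.defect_deck_one (F : RadialFoliation) (ζ ζ' : ℂ) :
    F.defect ζ (deck 1 ζ') = F.defect ζ ζ' - 1 := by
  simp only [defect, Complex.sub_im, exp_deck, deck_im]
  field_simp
  push_cast
  ring

/-- The defect is in `1/2 + ℤ`, since `1 - z'/z` and `1 - z/z'` have the quotient `-z'/z`. -/
theorem RadialFoliation.Between.exists_int {ζ ζ' : ℂ} (h : F.Between ζ ζ') :
    ∃ n : ℤ, F.defect ζ ζ' - 1 / 2 = n := by
  have hz := exp_mem_diskStar.2 h.1.left_mem
  have hz' := exp_mem_diskStar.2 h.1.right_mem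
  have h1 := isTurn_branch hz hz' h.exp_ne h.not_before
  have h2 := (isTurn_half_neg_one.mul (isTurn_exp (ζ' - ζ))).mul
    (isTurn_branch hz' hz h.exp_ne.symm h.not_before')
  have e : -1 * Complex.exp (ζ' - ζ) * (1 - Complex.exp ζ / Complex.exp ζ') =
      1 - Complex.exp ζ' / Complex.exp ζ := by
    rw [Complex.exp_sub]
    have := Complex.exp_ne_zero ζ
    have := Complex.exp_ne_zero ζ'
    field_simp
    ring
  rw [e] at h2
  obtain ⟨n, hn⟩ := h1.sub_int h2
  exact ⟨n, by rw [defect, hn]; ring⟩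

theorem RadialFoliation.Between.continuousAt_defect {ζ ζ' : ℂ} (h : F.Between ζ ζ') :
    ContinuousAt (F.defect ζ) ζ' := by
  have hz := exp_mem_diskStar.2 h.1.left_mem
  have hz' := exp_mem_diskStar.2 h.1.right_mem
  have c1 : ContinuousAt (fun ξ : ℂ => (Complex.exp ζ, Complex.exp ξ)) ζ' := by fun_prop
  have c2 : ContinuousAt (fun ξ : ℂ => (Complex.exp ξ, Complex.exp ζ)) ζ' := by fun_prop
  have h1 := (continuousAt_branch hz hz' h.exp_ne h.not_before).comp (x := ζ') c1
  have h2 := (continuousAt_branch hz' hz h.exp_ne.symm h.not_before').comp (x := ζ') c2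
  refine (h1.sub h2).sub ?_
  exact (Complex.continuous_im.comp (continuous_id.sub continuous_const)).continuousAt.div_const _

theorem RadialFoliation.defect_eq_defect {ζ ξ₁ ξ₂ : ℂ} (h₁ : F.Between ζ ξ₁)
    (h₂ : F.Between ζ ξ₂) : F.defect ζ ξ₁ = F.defect ζ ξ₂ := by
  have := eq_of_continuousOn_of_int (F.isPreconnected_between ζ)
    (f := fun ξ => F.defect ζ ξ - 1 / 2)
    (fun ξ (hξ : F.Between ζ ξ) => (hξ.continuousAt_defect.sub continuousAt_const).continuousWithinAt)
    (fun ξ (hξ : F.Between ζ ξ) => hξ.exists_int) h₁ h₂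
  linarith

theorem RadialFoliation.Below.exists_between {a c : ℂ} (h : F.Below a c) :
    ∃ ξ, F.Below a ξ ∧ F.Below ξ c := by
  obtain ⟨b, ⟨x, y⟩, hb, rfl, hbel⟩ := F.exists_box_below h.left_mem
  have hc : Continuous fun y' : ℝ => b (x, y') := hb.1.comp (by fun_prop)
  have hev : ∀ᶠ y' in 𝓝[>] y, F.Below (b (x, y')) c :=
    (hc.continuousAt.eventually ((F.isOpen_below_left c).mem_nhds h)).filter_mono inf_le_left
  obtain ⟨y', h1, h2⟩ := (hev.and self_mem_nhdsWithin).exists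
  exact ⟨_, hbel x x y y' h2, h1⟩

/-- The defect is `-1/2`: it is constant on each strip, antisymmetric, and drops by `1` under `T`;
comparing three leaves in a strip leaves no other possibility. -/
theorem RadialFoliation.Between.defect_eq {ζ a : ℂ} (h : F.Between ζ a) :
    F.defect ζ a = -1 / 2 := by
  obtain ⟨c, hac, hc⟩ := h.2.exists_between
  have hζc : F.Between ζ c := ⟨h.1.trans hac, hc⟩
  have hTa : F.Below (deck 1 ζ) (deck 1 a) := h.1.deck 1
  have h1 := defect_eq_defect h hζc
  have h2 : F.defect a c = F.defect a (deck 1 ζ) :=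
    defect_eq_defect ⟨hac, hc.trans hTa⟩ ⟨h.2, hTa⟩
  have h3 : F.defect c (deck 1 ζ) = F.defect c (deck 1 a) :=
    defect_eq_defect ⟨hc, hTa.trans (hac.deck 1)⟩ ⟨hc.trans hTa, hac.deck 1⟩
  rw [defect_deck_one, F.defect_swap ζ] at h2
  rw [defect_deck_one, defect_deck_one, F.defect_swap ζ, F.defect_swap a] at h3
  linarith

/-! ### The angle function of a foliation -/

open Classical in
/-- The branch, extended to the pairs `z' > z` of points of a leaf by its mean value across the
leaf. -/
def RadialFoliation.beta (F : RadialFoliation) (z z' : ℂ) : ℝ :=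
  if h : ∃ r : ℝ, ∃ ζ ζ', F.PointLT ζ ζ' ∧ Complex.exp ζ = z ∧ Complex.exp ζ' = z' ∧
      r = (ζ' - ζ).im / (2 * π) then F.branch z' z + h.choose
  else F.branch z z'

theorem RadialFoliation.beta_of_not_before {z z' : ℂ} (h : ¬ F.Before z z') :
    F.beta z z' = F.branch z z' := by
  rw [beta, dif_neg]
  rintro ⟨r, ζ, ζ', h1, h2, h3, -⟩
  exact h ⟨ζ, ζ', h1, h2, h3⟩

theorem RadialFoliation.PointLT.deck_eq_zero {ζ ζ' : ℂ} (h : F.PointLT ζ ζ') {k : ℤ}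
    (h' : F.PointLT ζ (CalabiRadial.deck k ζ')) : k = 0 := by
  by_contra hk
  refine F.deck_notMem h.right_mem hk ?_
  rw [F.liftedLeaf_eq_of_mem h.left_mem h.mem_liftedLeaf]
  exact h'.mem_liftedLeaf

theorem RadialFoliation.PointLT.beta_eq {ζ ζ' : ℂ} (h : F.PointLT ζ ζ') :
    F.beta (Complex.exp ζ) (Complex.exp ζ') =
      F.branch (Complex.exp ζ') (Complex.exp ζ) + (ζ' - ζ).im / (2 * π) := by
  have hex : ∃ r : ℝ, ∃ η η', F.PointLT η η' ∧ Complex.exp η = Complex.exp ζ ∧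
      Complex.exp η' = Complex.exp ζ' ∧ r = (η' - η).im / (2 * π) := ⟨_, ζ, ζ', h, rfl, rfl, rfl⟩
  rw [beta, dif_pos hex]
  obtain ⟨η, η', h1, h2, h3, h4⟩ := hex.choose_spec
  rw [h4]
  obtain ⟨k, rfl⟩ := exists_deck_of_exp_eq h2
  obtain ⟨l, rfl⟩ := exists_deck_of_exp_eq h3
  have h5 := h1.deck (-k)
  rw [deck_deck, deck_deck, neg_add_cancel, deck_zero] at h5
  have h6 : l = k := by have := h.deck_eq_zero h5; omega
  rw [h6]
  simp

/-- Just above the leaf of `ζ`, `beta` lies `1/2` below the continuous function that it equals on the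
leaf. -/
theorem RadialFoliation.Between.beta_eq {ζ ζ' : ℂ} (h : F.Between ζ ζ') :
    F.beta (Complex.exp ζ) (Complex.exp ζ') + 1 / 2 =
      F.branch (Complex.exp ζ') (Complex.exp ζ) + (ζ' - ζ).im / (2 * π) := by
  have h1 := h.defect_eq
  rw [beta_of_not_before h.not_before]
  rw [defect] at h1
  linarith

/-- Just below the leaf of `ζ`, `beta` lies `1/2` above the continuous function that it equals on the
leaf. -/
theorem RadialFoliation.Between.beta_eq' {ζ ζ' : ℂ} (h : F.Between ζ' ζ) :
    F.beta (Complex.exp ζ) (Complex.exp ζ') - 1 / 2 =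
      F.branch (Complex.exp ζ') (Complex.exp ζ) + (ζ' - ζ).im / (2 * π) := by
  have h1 := h.defect_eq
  rw [beta_of_not_before h.not_before']
  rw [defect, ← neg_sub ζ', Complex.neg_im, neg_div] at h1
  linarith

theorem RadialFoliation.PointLT.not_before {ζ ζ' : ℂ} (h : F.PointLT ζ ζ') :
    ¬ F.Before (Complex.exp ζ') (Complex.exp ζ) := fun hb =>
  F.before_irrefl _ (Before.trans ⟨ζ, ζ', h, rfl, rfl⟩ hb)

theorem RadialFoliation.PointLT.exp_ne {ζ ζ' : ℂ} (h : F.PointLT ζ ζ') :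
    Complex.exp ζ ≠ Complex.exp ζ' := fun he =>
  F.before_irrefl (Complex.exp ζ) ⟨ζ, ζ', h, rfl, he.symm⟩

/-- Near a pair `ζ₀ < ζ₀'` the function `beta` jumps by `1/2` upon arriving on, and by `1/2` upon
leaving, the pairs of points of a leaf. -/
theorem RadialFoliation.PointLT.eventually_beta {ζ₀ ζ₀' : ℂ} (h : F.PointLT ζ₀ ζ₀') :
    ∀ᶠ p : ℂ × ℂ in 𝓝 (ζ₀, ζ₀'),
      (F.PointLT p.1 p.2 ∧ F.beta (Complex.exp p.1) (Complex.exp p.2) =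
        F.branch (Complex.exp p.2) (Complex.exp p.1) + (p.2 - p.1).im / (2 * π)) ∨
      (F.Below p.1 p.2 ∧ F.beta (Complex.exp p.1) (Complex.exp p.2) + 1 / 2 =
        F.branch (Complex.exp p.2) (Complex.exp p.1) + (p.2 - p.1).im / (2 * π)) ∨
      (F.Below p.2 p.1 ∧ F.beta (Complex.exp p.1) (Complex.exp p.2) - 1 / 2 =
        F.branch (Complex.exp p.2) (Complex.exp p.1) + (p.2 - p.1).im / (2 * π)) := by
  have hne : ζ₀ ≠ ζ₀' := fun he => h.exp_ne (by rw [he])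
  have e1 : ∀ᶠ p : ℂ × ℂ in 𝓝 (ζ₀, ζ₀'), ¬ F.PointLT p.2 p.1 := by
    have := eventually_not_pointLT h.right_mem h.left_mem hne.symm
      (fun h' => F.pointLT_irrefl _ (h.trans h'))
    exact (continuous_swap.tendsto (ζ₀, ζ₀')).eventually this
  have e2 : ∀ᶠ p : ℂ × ℂ in 𝓝 (ζ₀, ζ₀'), F.Below p.2 (CalabiRadial.deck 1 p.1) := by
    have h1 : F.Below ζ₀' (CalabiRadial.deck 1 ζ₀) := (F.below_deck_one h.left_mem).congr_left h.mem_liftedLeaf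
    have hc : Continuous fun p : ℂ × ℂ => (p.2, CalabiRadial.deck 1 p.1) :=
      continuous_snd.prodMk ((continuous_deck 1).comp continuous_fst)
    exact (hc.tendsto (ζ₀, ζ₀')).eventually (F.isOpen_below.mem_nhds h1)
  have e3 : ∀ᶠ p : ℂ × ℂ in 𝓝 (ζ₀, ζ₀'), F.Below p.1 (CalabiRadial.deck 1 p.2) := by
    have h1 : F.Below ζ₀ (CalabiRadial.deck 1 ζ₀') := (F.below_deck_one h.right_mem).congr_left h.mem_liftedLeaf'
    have hc : Continuous fun p : ℂ × ℂ => (p.1, CalabiRadial.deck 1 p.2) :=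
      continuous_fst.prodMk ((continuous_deck 1).comp continuous_snd)
    exact (hc.tendsto (ζ₀, ζ₀')).eventually (F.isOpen_below.mem_nhds h1)
  filter_upwards [e1, e2, e3, (isOpen_ne_fun continuous_fst continuous_snd).mem_nhds hne]
    with p h1 h2 h3 h4
  by_cases hm : p.2 ∈ F.liftedLeaf p.1
  · have := ((F.pointLT_or h3.left_mem hm).resolve_right (not_or.2 ⟨fun he => h4 he.symm, h1⟩))
    exact Or.inl ⟨this, this.beta_eq⟩
  · rcases F.below_or h3.left_mem h2.left_mem hm with h | h
    · exact Or.inr (Or.inl ⟨h, Between.beta_eq ⟨h, h2⟩⟩)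
    · exact Or.inr (Or.inr ⟨h, Between.beta_eq' ⟨h, h3⟩⟩)

theorem RadialFoliation.continuousAt_beta {z z' : ℂ} (hz : z ∈ diskStar) (hz' : z' ∈ diskStar)
    (hne : z ≠ z') (hb : ¬ F.Before z z') :
    ContinuousAt (fun x : ℂ × ℂ => F.beta x.1 x.2) (z, z') := by
  refine (continuousAt_branch hz hz' hne hb).congr ?_
  filter_upwards [F.eventually_not_before hz hz' hne hb] with x hx
  exact (beta_of_not_before hx).symm

theorem RadialFoliation.PointLT.continuousAt_branch_swap {ζ ζ' : ℂ} (h : F.PointLT ζ ζ') :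
    ContinuousAt (fun p : ℂ × ℂ => F.branch (Complex.exp p.2) (Complex.exp p.1) +
      (p.2 - p.1).im / (2 * π)) (ζ, ζ') := by
  have hc : ContinuousAt (fun p : ℂ × ℂ => (Complex.exp p.2, Complex.exp p.1)) (ζ, ζ') := by
    fun_prop
  have h1 := (continuousAt_branch (exp_mem_diskStar.2 h.right_mem)
    (exp_mem_diskStar.2 h.left_mem) h.exp_ne.symm h.not_before).comp (x := (ζ, ζ')) hc
  refine ContinuousAt.add h1 ?_
  exact (Complex.continuous_im.comp (continuous_snd.sub continuous_fst)).continuousAt.div_const _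

theorem RadialFoliation.continuousOn_beta_before (F : RadialFoliation) :
    ContinuousOn (fun x : ℂ × ℂ => F.beta x.1 x.2) {x | F.Before x.1 x.2} := by
  rintro ⟨_, _⟩ ⟨ζ, ζ', h, rfl, rfl⟩
  intro V hV
  have hV' : ∀ᶠ p : ℂ × ℂ in 𝓝 (ζ, ζ'), F.branch (Complex.exp p.2) (Complex.exp p.1) +
      (p.2 - p.1).im / (2 * π) ∈ V := by
    have hV : V ∈ 𝓝 (F.beta (Complex.exp ζ) (Complex.exp ζ')) := hV
    rw [h.beta_eq] at hV
    exact h.continuousAt_branch_swap hV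
  have hev : ∀ᶠ p : ℂ × ℂ in 𝓝 (ζ, ζ'), F.Before (Complex.exp p.1) (Complex.exp p.2) →
      F.beta (Complex.exp p.1) (Complex.exp p.2) ∈ V := by
    filter_upwards [hV', F.eventually_forall_pointLT h.left_mem h.right_mem h.exp_ne] with p h1 h2 h3
    obtain ⟨k, hk⟩ := before_exp_iff.1 h3
    obtain rfl := h.deck_eq_zero (h2 k hk)
    rw [deck_zero] at hk
    rwa [hk.beta_eq]
  have := isOpenMap_exp_prod.image_mem_nhds hev
  rw [mem_map, mem_nhdsWithin_iff_exists_mem_nhds_inter]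
  refine ⟨_, this, ?_⟩
  rintro _ ⟨⟨p, hp, rfl⟩, hb⟩
  exact hp hb

theorem isOpen_pairs : IsOpen pairs :=
  (isOpen_diskStar.preimage continuous_fst).inter
    ((isOpen_diskStar.preimage continuous_snd).inter (isOpen_ne_fun continuous_fst continuous_snd))

/-- `beta` is continuous off, and on, the relatively closed set of pairs `z' > z`, hence measurable. -/
theorem RadialFoliation.aemeasurable_beta (F : RadialFoliation) (μ : Measure (ℂ × ℂ)) :
    AEMeasurable (fun x : ℂ × ℂ => F.beta x.1 x.2) (μ.restrict pairs) := by
  have ho : IsOpen (pairs \ {x | F.Before x.1 x.2}) := by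
    rw [isOpen_iff_mem_nhds]
    rintro ⟨z, z'⟩ ⟨h, hb⟩
    filter_upwards [isOpen_pairs.mem_nhds h, F.eventually_not_before h.1 h.2.1 h.2.2 hb]
      with x h1 h2 using ⟨h1, h2⟩
  have hm : MeasurableSet (pairs ∩ {x : ℂ × ℂ | F.Before x.1 x.2}) := by
    rw [← sdiff_sdiff_right_self]
    exact isOpen_pairs.measurableSet.diff ho.measurableSet
  have hu : pairs = (pairs \ {x | F.Before x.1 x.2}) ∪ (pairs ∩ {x : ℂ × ℂ | F.Before x.1 x.2}) :=
    (sdiff_union_inter _ _).symm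
  rw [hu]
  refine aemeasurable_union_iff.2 ⟨?_, ?_⟩
  · refine ContinuousOn.aemeasurable (fun x hx => ?_) ho.measurableSet
    exact (continuousAt_beta hx.1.1 hx.1.2.1 hx.1.2.2 hx.2).continuousWithinAt
  · exact (F.continuousOn_beta_before.mono inter_subset_right).aemeasurable hm

/-! ### Crossings of `4ℤ` and the digital line -/

open Classical in
/-- The height of an integer: up to a constant, the number of multiples of `4` below it, itself being
counted one half.  The crossing number of a path is the variation of the height. -/
def height (n : ℤ) : ℝ := ((n / 4 : ℤ) : ℝ) + if (4 : ℤ) ∣ n then 0 else 1 / 2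

theorem card_Ioo_filter_dvd {a b : ℤ} (h : a < b) :
    (((Finset.Ioo a b).filter fun j => (4 : ℤ) ∣ j).card : ℝ) =
      ((b / 4 : ℤ) : ℝ) - ((a / 4 : ℤ) : ℝ) - if (4 : ℤ) ∣ b then 1 else 0 := by
  classical
  have hle : a / 4 ≤ b / 4 := Int.ediv_le_ediv (by norm_num) h.le
  have hc : (((Finset.Ioc a b).filter fun j => (4 : ℤ) ∣ j).card : ℤ) = b / 4 - a / 4 := by
    have := Int.Ioc_filter_dvd_card a b (r := 4) (by norm_num)
    have e : ∀ x : ℤ, ⌊(x : ℚ) / (4 : ℤ)⌋ = x / 4 := fun x => by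
      exact_mod_cast Rat.floor_intCast_div_natCast x 4
    rw [e, e, max_eq_left (by omega)] at this
    exact this
  rw [← Finset.Ioo_insert_right h, Finset.filter_insert] at hc
  split_ifs at hc ⊢ with hd
  · rw [Finset.card_insert_of_notMem (by simp)] at hc
    have : ((((Finset.Ioo a b).filter fun j => (4 : ℤ) ∣ j).card : ℤ) : ℝ) =
      ((b / 4 - a / 4 - 1 : ℤ) : ℝ) := by
      congr 1
      push_cast at hc
      linarith
    push_cast at this
    exact this
  · have := congrArg (Int.cast : ℤ → ℝ) hc
    push_cast at this
    rw [this, sub_zero]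

theorem crossing_eq (a b : ℤ) : crossing a b = height b - height a := by
  classical
  have key : ∀ a b : ℤ, a < b → (((Finset.Ioo a b).filter fun j => (4 : ℤ) ∣ j).card : ℝ) +
      ((({a, b} : Finset ℤ).filter fun j => (4 : ℤ) ∣ j).card : ℝ) / 2 = height b - height a := by
    intro a b h
    rw [card_Ioo_filter_dvd h, height, height, Finset.filter_insert, Finset.filter_singleton]
    split_ifs <;> simp [h.ne] <;> ring
  unfold crossing
  split_ifs with h1 h2
  · simp [h1]
  · rw [← key a b h2]
  · have := key b a (by omega)
    rw [← neg_sub (height a), ← this]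
    ring_nf

theorem exists_int_two_mul_height (n : ℤ) : ∃ m : ℤ, 2 * height n = m := by
  rw [height]
  split_ifs
  · exact ⟨2 * (n / 4), by push_cast; ring⟩
  · exact ⟨2 * (n / 4) + 1, by push_cast; ring⟩

/-- `m` lies in the smallest neighbourhood of `n` in the digital line. -/
def DigitalNear (n m : ℤ) : Prop := m = n ∨ Even n ∧ |m - n| ≤ 1

theorem tendsto_digitalLine_iff {f : ℝ → ℤ} {l : Filter ℝ} {n : ℤ} :
    Tendsto f l (@nhds ℤ digitalLine n) ↔ ∀ᶠ s in l, DigitalNear n (f s) := by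
  unfold digitalLine
  rw [TopologicalSpace.tendsto_nhds_generateFrom_iff]
  constructor
  · intro h
    rcases Int.even_or_odd' n with ⟨k, rfl | rfl⟩
    · filter_upwards [h {2 * k - 1, 2 * k, 2 * k + 1} ⟨k, Or.inr rfl⟩ (by simp)] with s hs
      simp only [mem_preimage, mem_insert_iff, mem_singleton_iff] at hs
      exact Or.inr ⟨even_two_mul k, by rw [abs_le]; omega⟩
    · filter_upwards [h {2 * k + 1} ⟨k, Or.inl rfl⟩ (by simp)] with s hs
      exact Or.inl hs
  · rintro h U ⟨k, hU⟩ hn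
    filter_upwards [h] with s hs
    rcases hU with rfl | rfl
    · simp only [mem_singleton_iff, mem_preimage, DigitalNear] at hn hs ⊢
      subst hn
      rcases hs with hs | ⟨⟨m, hm⟩, -⟩ <;> omega
    · simp only [mem_insert_iff, mem_singleton_iff, mem_preimage, DigitalNear, abs_le] at hn hs ⊢
      rcases hs with hs | ⟨⟨m, hm⟩, hs⟩ <;> omega

theorem continuousOn_digitalLine_iff {f : ℝ → ℤ} {S : Set ℝ} :
    @ContinuousOn ℝ ℤ _ digitalLine f S ↔ ∀ s ∈ S, ∀ᶠ t in 𝓝[S] s, DigitalNear (f s) (f t) :=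
  forall₂_congr fun _ _ => tendsto_digitalLine_iff

theorem height_of_near {n m : ℤ} (h : DigitalNear n m) (hn : (n : ZMod 4) ≠ 0) :
    height m = height n := by
  rcases h with rfl | ⟨⟨k, hk⟩, h⟩
  · rfl
  · have hn' : ¬ (4 : ℤ) ∣ n := fun h' => hn ((ZMod.intCast_zmod_eq_zero_iff_dvd n 4).2 (by exact_mod_cast h'))
    rw [abs_le] at h
    have h1 : m / 4 = n / 4 := by omega
    have h2 : ¬ (4 : ℤ) ∣ m := by omega
    simp only [height, h1, h2, hn']

theorem intCast_zmod_four (n : ℤ) (r : ℤ) (hr : 0 ≤ r) (hr' : r < 4) :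
    (n : ZMod 4) = r ↔ n % 4 = r := by
  rw [ZMod.intCast_eq_intCast_iff' n r 4]
  push_cast
  rw [Int.emod_eq_of_lt hr hr']

theorem height_of_near_zero {n m : ℤ} (h : DigitalNear n m) (hn : (n : ZMod 4) = 0) :
    ((m : ZMod 4) = 0 → height m = height n) ∧ ((m : ZMod 4) = 1 → height m = height n + 1 / 2) ∧
      ((m : ZMod 4) = 3 → height m = height n - 1 / 2) := by
  have e0 := fun n => intCast_zmod_four n 0 (by norm_num) (by norm_num)
  have e1 := intCast_zmod_four m 1 (by norm_num) (by norm_num)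
  have e3 := intCast_zmod_four m 3 (by norm_num) (by norm_num)
  push_cast at e0 e1 e3
  rw [e0] at hn ⊢
  rw [e1, e3]
  have h' : |m - n| ≤ 1 := by
    rcases h with rfl | h
    · simp
    · exact h.2
  rw [abs_le] at h'
  have hn' : (4 : ℤ) ∣ n := by omega
  refine ⟨fun hm => ?_, fun hm => ?_, fun hm => ?_⟩
  · have : m = n := by omega
    rw [this]
  · obtain rfl : m = n + 1 := by omega
    have h1 : (n + 1) / 4 = n / 4 := by omega
    have h2 : ¬ (4 : ℤ) ∣ n + 1 := by omega
    simp [height, h1, h2, hn']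
  · obtain rfl : m = n - 1 := by omega
    have h1 : (n - 1) / 4 = n / 4 - 1 := by omega
    have h2 : ¬ (4 : ℤ) ∣ n - 1 := by omega
    simp only [height, h1, h2, hn', if_true, if_false]
    push_cast
    ring

theorem DigitalNear.add {n m : ℤ} (h : DigitalNear n m) {k : ℤ} (hk : Even k) :
    DigitalNear (k + n) (k + m) := by
  rcases h with rfl | ⟨h1, h2⟩
  · exact Or.inl rfl
  · exact Or.inr ⟨hk.add h1, by rwa [add_sub_add_left_eq_sub]⟩

/-- Lifting to the digital line a path of `ℤ/4ℤ` that does not take the value `0`, or does not take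
the value `2`. -/
theorem exists_digital_lift_piece {θ : ℝ → ZMod 4} {S : Set ℝ}
    (hcont : ∀ s ∈ S, ∀ᶠ t in 𝓝[S] s, (θ s = 1 → θ t = 1) ∧ (θ s = 3 → θ t = 3))
    {e : ZMod 4} (he : e = 0 ∨ e = 2) (hav : ∀ s ∈ S, θ s ≠ e) {a : ℝ}
    {n : ℤ} (hn : (n : ZMod 4) = θ a) :
    ∃ θh : ℝ → ℤ, θh a = n ∧ (∀ s ∈ S, (θh s : ZMod 4) = θ s) ∧
      ∀ s ∈ S, ∀ᶠ t in 𝓝[S] s, DigitalNear (θh s) (θh t) := by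
  obtain ⟨r, hr, hrn⟩ : ∃ r : ZMod 4 → ℤ, (∀ x, (r x : ZMod 4) = x) ∧
      ∀ x y, x ≠ e → y ≠ e → (x = 1 → y = 1) → (x = 3 → y = 3) →
        (r y = r x ∨ Even (r x) ∧ |r y - r x| ≤ 1) := by
    rcases he with rfl | rfl
    · exact ⟨fun x => x.val, by decide, by decide⟩
    · exact ⟨fun x => if x = 3 then -1 else x.val, by decide, by decide⟩
  have hk : Even (n - r (θ a)) := by
    have h0 : ((n - r (θ a) : ℤ) : ZMod 4) = 0 := by push_cast; rw [hn, hr, sub_self]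
    rw [ZMod.intCast_zmod_eq_zero_iff_dvd _ 4] at h0
    exact even_iff_two_dvd.2 (Dvd.dvd.trans (by norm_num) h0)
  refine ⟨fun s => n - r (θ a) + r (θ s), by ring, fun s hs => ?_, fun s hs => ?_⟩
  · push_cast
    rw [hr, hr, hn, sub_self, zero_add]
  · filter_upwards [hcont s hs, self_mem_nhdsWithin] with t ht htS
    exact DigitalNear.add (hrn _ _ (hav s hs) (hav t htS) ht.1 ht.2) hk

theorem digital_glue {f g : ℝ → ℤ} {B : Set ℝ} (hB : IsClosed B) (hfg : EqOn f g B)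
    (hg : ∀ s ∈ B, ∀ᶠ t in 𝓝[B] s, DigitalNear (g s) (g t)) (s : ℝ) :
    ∀ᶠ t in 𝓝[B] s, DigitalNear (f s) (f t) := by
  by_cases h : s ∈ B
  · filter_upwards [hg s h, self_mem_nhdsWithin] with t ht htB
    rw [hfg h, hfg htB]
    exact ht
  · rw [notMem_closure_iff_nhdsWithin_eq_bot.1 (by rwa [hB.closure_eq])]
    exact eventually_bot

/-- A path of `ℤ/4ℤ` that is continuous for the digital topology lifts to the digital line. -/
theorem exists_digital_lift {θ : ℝ → ZMod 4}
    (hcont : ∀ s ∈ Icc (0 : ℝ) 1, ∀ᶠ t in 𝓝[Icc (0 : ℝ) 1] s, (θ s = 1 → θ t = 1) ∧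
      (θ s = 3 → θ t = 3) ∧ (θ s = 0 → θ t ≠ 2) ∧ (θ s = 2 → θ t ≠ 0)) :
    ∃ θh : ℝ → ℤ, @ContinuousOn ℝ ℤ _ digitalLine θh (Icc 0 1) ∧
      ∀ s ∈ Icc (0 : ℝ) 1, (θh s : ZMod 4) = θ s := by
  -- Locally the path avoids `0` or `2`.
  have hloc : ∀ s : Icc (0 : ℝ) 1, ∃ U : Set (Icc (0 : ℝ) 1), IsOpen U ∧ s ∈ U ∧
      ∃ e : ZMod 4, (e = 0 ∨ e = 2) ∧ ∀ t ∈ U, θ t ≠ e := by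
    intro s
    have h1 := hcont s s.2
    rw [eventually_nhdsWithin_iff] at h1
    obtain ⟨U, hU, hUo, hsU⟩ := eventually_nhds_iff.1 h1
    refine ⟨Subtype.val ⁻¹' U, hUo.preimage continuous_subtype_val, hsU, ?_⟩
    have hd : ∀ x : ZMod 4, x = 0 ∨ x = 1 ∨ x = 2 ∨ x = 3 := by decide
    rcases hd (θ s) with h | h | h | h
    · exact ⟨2, Or.inr rfl, fun t ht => (hU t ht t.2).2.2.1 h⟩
    · exact ⟨0, Or.inl rfl, fun t ht => by rw [(hU t ht t.2).1 h]; decide⟩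
    · exact ⟨0, Or.inl rfl, fun t ht => (hU t ht t.2).2.2.2 h⟩
    · exact ⟨0, Or.inl rfl, fun t ht => by rw [(hU t ht t.2).2.1 h]; decide⟩
  choose U hUo hUm hUe using hloc
  obtain ⟨T, hT0, hTm, ⟨m, hm⟩, hTc⟩ := exists_monotone_Icc_subset_open_cover_Icc
    (zero_le_one (α := ℝ)) hUo (fun x _ => mem_iUnion.2 ⟨x, hUm x⟩)
  have key : ∀ n, ∃ θh : ℝ → ℤ, (∀ s ∈ Icc (0 : ℝ) (T n), (θh s : ZMod 4) = θ s) ∧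
      ∀ s ∈ Icc (0 : ℝ) (T n), ∀ᶠ t in 𝓝[Icc (0 : ℝ) (T n)] s, DigitalNear (θh s) (θh t) := by
    intro n
    induction n with
    | zero =>
      rw [hT0, Icc_self]
      refine ⟨fun s => (θ 0).val, ?_, ?_⟩
      · rintro s rfl
        simp
      · exact fun s _ => Eventually.of_forall fun t => Or.inl rfl
    | succ n ih =>
      obtain ⟨f, hf, hf'⟩ := ih
      have hle : (T n : ℝ) ≤ T (n + 1) := hTm n.le_succ
      have h0 : (0 : ℝ) ≤ T n := (T n).2.1
      have hsub : Icc (T n : ℝ) (T (n + 1)) ⊆ Icc 0 1 := Icc_subset_Icc h0 (T (n + 1)).2.2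
      obtain ⟨i, hi⟩ := hTc n
      obtain ⟨e, he, hav⟩ := hUe i
      obtain ⟨g, hga, hg, hg'⟩ := exists_digital_lift_piece (S := Icc (T n : ℝ) (T (n + 1)))
        (fun s hs => ((hcont s (hsub hs)).filter_mono (nhdsWithin_mono _ hsub)).mono
          fun t ht => ⟨ht.1, ht.2.1⟩) he
        (fun s hs => hav ⟨s, hsub hs⟩ (hi ⟨hs.1, hs.2⟩))
        (hf _ (right_mem_Icc.2 h0))
      set h : ℝ → ℤ := fun s => if s ≤ T n then f s else g s with hh
      have e1 : EqOn h f (Icc 0 (T n)) := fun s hs => if_pos hs.2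
      have e2 : EqOn h g (Icc (T n) (T (n + 1))) := fun s hs => by
        rcases hs.1.eq_or_lt with rfl | hlt
        · simp only [hh, le_refl, if_true, hga]
        · exact if_neg hlt.not_ge
      refine ⟨h, fun s hs => ?_, fun s hs => ?_⟩
      · rcases le_total s (T n) with hs' | hs'
        · rw [e1 ⟨hs.1, hs'⟩, hf s ⟨hs.1, hs'⟩]
        · rw [e2 ⟨hs', hs.2⟩, hg s ⟨hs', hs.2⟩]
      · rw [← Icc_union_Icc_eq_Icc h0 hle]
        rw [nhdsWithin_union, eventually_sup]
        exact ⟨digital_glue isClosed_Icc e1 hf' s, digital_glue isClosed_Icc e2 hg' s⟩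
  obtain ⟨θh, h1, h2⟩ := key m
  rw [hm m le_rfl] at h1 h2
  exact ⟨θh, continuousOn_digitalLine_iff.2 h2, h1⟩

/-! ### The crossing number along a pair of paths -/

section paths

variable {u v : ℝ → ℂ} (hu : ContinuousOn u (Icc 0 1)) (hv : ContinuousOn v (Icc 0 1))
  (hum : ∀ s ∈ Icc (0 : ℝ) 1, u s ∈ cover) (hvm : ∀ s ∈ Icc (0 : ℝ) 1, v s ∈ cover)
  (hne : ∀ s ∈ Icc (0 : ℝ) 1, Complex.exp (u s) ≠ Complex.exp (v s))

theorem ne_deck_of_exp_ne {ζ ζ' : ℂ} (h : Complex.exp ζ ≠ Complex.exp ζ') (k : ℤ) :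
    ζ ≠ deck k ζ' := fun he => h (by rw [he, exp_deck])

include hu hv hum hvm hne

/-- Along a pair of paths, only finitely many translates of the second point ever come after the first
one on its leaf. -/
theorem RadialFoliation.finite_pointLT (F : RadialFoliation) :
    {k : ℤ | ∃ s ∈ Icc (0 : ℝ) 1, F.PointLT (u s) (deck k (v s))}.Finite := by
  refine isCompact_Icc.induction_on
    (p := fun S => {k : ℤ | ∃ s ∈ S, F.PointLT (u s) (deck k (v s))}.Finite) (by simp)
    (fun S T hST hT => hT.subset fun k ⟨s, hs, h⟩ => ⟨s, hST hs, h⟩)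
    (fun S T hS hT => (hS.union hT).subset ?_) fun s hs => ?_
  · rintro k ⟨s, hs | hs, h⟩
    · exact Or.inl ⟨s, hs, h⟩
    · exact Or.inr ⟨s, hs, h⟩
  · have := ((hu s hs).prodMk_nhds (hv s hs)).eventually
      (F.eventually_forall_pointLT (hum s hs) (hvm s hs) (hne s hs))
    refine ⟨_, this, ?_⟩
    by_cases hk : ∃ k, F.PointLT (u s) (deck k (v s))
    · obtain ⟨k, hk⟩ := hk
      refine (finite_singleton k).subset ?_
      rintro l ⟨t, ht, h⟩
      have h1 := ht l h
      have h2 : F.PointLT (u s) (deck (l - k) (deck k (v s))) := by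
        rw [deck_deck, sub_add_cancel]; exact h1
      have := hk.deck_eq_zero h2
      rw [mem_singleton_iff]
      omega
    · convert finite_empty
      refine eq_empty_of_forall_notMem ?_
      rintro l ⟨t, ht, h⟩
      exact hk ⟨l, ht l h⟩

theorem RadialFoliation.exists_theta_lift (F : RadialFoliation) :
    ∃ θh : ℝ → ℤ, @ContinuousOn ℝ ℤ _ digitalLine θh (Icc 0 1) ∧
      ∀ s ∈ Icc (0 : ℝ) 1, (θh s : ZMod 4) = F.theta (u s) (v s) := by
  refine exists_digital_lift (θ := fun s => F.theta (u s) (v s)) fun s hs => ?_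
  have hn : ∀ t ∈ Icc (0 : ℝ) 1, u t ≠ v t := fun t ht he => hne t ht (by rw [he])
  have htend := (hu s hs).prodMk_nhds (hv s hs)
  have htend' := (hv s hs).prodMk_nhds (hu s hs)
  have e1 : F.Below (u s) (v s) → ∀ᶠ t in 𝓝[Icc (0 : ℝ) 1] s, F.Below (u t) (v t) :=
    fun h => htend.eventually (F.isOpen_below.mem_nhds h)
  have e3 : F.Below (v s) (u s) → ∀ᶠ t in 𝓝[Icc (0 : ℝ) 1] s, F.Below (v t) (u t) :=
    fun h => htend'.eventually (F.isOpen_below.mem_nhds h)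
  have e0 : F.PointLT (u s) (v s) → ∀ᶠ t in 𝓝[Icc (0 : ℝ) 1] s, ¬ F.PointLT (v t) (u t) :=
    fun h => htend'.eventually (eventually_not_pointLT (hvm s hs) (hum s hs) (hn s hs).symm
      fun h' => F.pointLT_irrefl _ (h.trans h'))
  have e2 : F.PointLT (v s) (u s) → ∀ᶠ t in 𝓝[Icc (0 : ℝ) 1] s, ¬ F.PointLT (u t) (v t) :=
    fun h => htend.eventually (eventually_not_pointLT (hum s hs) (hvm s hs) (hn s hs)
      fun h' => F.pointLT_irrefl _ (h.trans h'))
  rw [← eventually_imp_distrib_left] at e0 e1 e2 e3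
  filter_upwards [e0, e1, e2, e3, self_mem_nhdsWithin] with t h0 h1 h2 h3 ht
  rw [theta_eq_one_iff (hum s hs) (hvm s hs) (hn s hs), theta_eq_one_iff (hum t ht) (hvm t ht) (hn t ht),
    theta_eq_three_iff (hum s hs) (hvm s hs) (hn s hs),
    theta_eq_three_iff (hum t ht) (hvm t ht) (hn t ht),
    theta_eq_zero_iff (hum s hs) (hvm s hs) (hn s hs), Ne, Ne,
    theta_eq_two_iff (hum t ht) (hvm t ht) (hn t ht),
    theta_eq_two_iff (hum s hs) (hvm s hs) (hn s hs),
    theta_eq_zero_iff (hum t ht) (hvm t ht) (hn t ht)]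
  exact ⟨h1, h3, h0, h2⟩

section height

variable {θh : ℤ → ℝ → ℤ}
  (hθ : ∀ k, @ContinuousOn ℝ ℤ _ digitalLine (θh k) (Icc 0 1))
  (hθ' : ∀ k, ∀ s ∈ Icc (0 : ℝ) 1, (θh k s : ZMod 4) = F.theta (u s) (deck k (v s)))
include hθ hθ'

omit hu hv in
theorem RadialFoliation.eventually_height_eq {k : ℤ} {s : ℝ} (hs : s ∈ Icc (0 : ℝ) 1)
    (h : ¬ F.PointLT (u s) (deck k (v s))) :
    ∀ᶠ t in 𝓝[Icc (0 : ℝ) 1] s, height (θh k t) = height (θh k s) := by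
  filter_upwards [continuousOn_digitalLine_iff.1 (hθ k) s hs] with t ht
  refine height_of_near ht ?_
  rwa [hθ' k s hs, Ne, theta_eq_zero_iff (hum s hs) (deck_mem_cover.2 (hvm s hs))
    (ne_deck_of_exp_ne (hne s hs) k)]

omit hu hv in
theorem RadialFoliation.height_eq_of_forall {k : ℤ}
    (h : ∀ s ∈ Icc (0 : ℝ) 1, ¬ F.PointLT (u s) (deck k (v s))) :
    height (θh k 1) = height (θh k 0) := by
  have := eq_of_continuousOn_of_int (f := fun s => 2 * height (θh k s)) (s := Icc (0 : ℝ) 1)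
    (x := 1) (y := 0) isPreconnected_Icc (fun s hs => ?_)
    (fun s hs => exists_int_two_mul_height _) (by simp) (by simp)
  · linarith
  · refine tendsto_const_nhds.congr' ?_
    filter_upwards [eventually_height_eq hum hvm hne hθ hθ' hs (h s hs)] with t ht
    rw [ht]

/-- The jumps of `beta` are compensated by those of the heights. -/
theorem RadialFoliation.continuousOn_beta_add_height {K : Finset ℤ}
    (hK : ∀ k, (∃ s ∈ Icc (0 : ℝ) 1, F.PointLT (u s) (deck k (v s))) → k ∈ K) :
    ContinuousOn (fun s => F.beta (Complex.exp (u s)) (Complex.exp (v s)) +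
      ∑ k ∈ K, height (θh k s)) (Icc 0 1) := by
  intro s hs
  have hconst : ∀ k, ¬ F.PointLT (u s) (deck k (v s)) →
      ContinuousWithinAt (fun t => height (θh k t)) (Icc 0 1) s := fun k hk => by
    refine tendsto_const_nhds.congr' ?_
    filter_upwards [eventually_height_eq hum hvm hne hθ hθ' hs hk] with t ht
    rw [ht]
  -- At most one translate is on the leaf of `u s`; only its height jumps, and so does `beta`.
  by_cases hex : ∃ k, F.PointLT (u s) (deck k (v s))
  · obtain ⟨k, hk⟩ := hex
    have hkK := hK k ⟨s, hs, hk⟩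
    have hrest : ContinuousWithinAt (fun t => ∑ l ∈ K.erase k, height (θh l t)) (Icc 0 1) s := by
      refine tendsto_finsetSum _ fun l hl => hconst l fun h => ?_
      have h2 : F.PointLT (u s) (deck (l - k) (deck k (v s))) := by
        rw [deck_deck, sub_add_cancel]; exact h
      have := hk.deck_eq_zero h2
      exact (Finset.mem_erase.1 hl).1 (by omega)
    have htend : ContinuousWithinAt (fun t => (u t, deck k (v t))) (Icc 0 1) s :=
      (hu s hs).prodMk ((continuous_deck k).continuousAt.comp_continuousWithinAt (hv s hs))
    have hR := (hk.continuousAt_branch_swap.comp_continuousWithinAt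
      (f := fun t => (u t, deck k (v t))) (x := s) htend)
    have h1 : ContinuousWithinAt (fun t => F.beta (Complex.exp (u t)) (Complex.exp (v t)) +
        height (θh k t)) (Icc 0 1) s := by
      have hθk : (θh k s : ZMod 4) = 0 := by
        rw [hθ' k s hs, theta_eq_zero_iff (hum s hs) (deck_mem_cover.2 (hvm s hs))
          (ne_deck_of_exp_ne (hne s hs) k)]
        exact hk
      have key : ∀ᶠ t in 𝓝[Icc (0 : ℝ) 1] s,
          F.branch (Complex.exp (deck k (v t))) (Complex.exp (u t)) +
            (deck k (v t) - u t).im / (2 * π) + height (θh k s) =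
          F.beta (Complex.exp (u t)) (Complex.exp (v t)) + height (θh k t) := by
        filter_upwards [htend.eventually hk.eventually_beta,
          continuousOn_digitalLine_iff.1 (hθ k) s hs, self_mem_nhdsWithin] with t h1 h2 ht
        have h3 := height_of_near_zero h2 hθk
        have ha := hum t ht
        have hb := deck_mem_cover (k := k).2 (hvm t ht)
        have hc := ne_deck_of_exp_ne (hne t ht) k
        rw [hθ' k t ht, theta_eq_zero_iff ha hb hc, theta_eq_one_iff ha hb hc,
          theta_eq_three_iff ha hb hc] at h3
        rcases h1 with ⟨h1, e⟩ | ⟨h1, e⟩ | ⟨h1, e⟩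
        · rw [← e, h3.1 h1, exp_deck]
        · rw [← e, h3.2.1 h1, exp_deck]; ring
        · rw [← e, h3.2.2 h1, exp_deck]; ring
      have h4 := hR.add (continuousWithinAt_const (b := height (θh k s)))
      exact h4.congr_of_eventuallyEq (key.mono fun t ht => ht.symm)
        (key.self_of_nhdsWithin hs).symm
    refine (h1.add hrest).congr (fun t _ => ?_) ?_ <;>
    · rw [← Finset.add_sum_erase _ _ hkK, ← add_assoc]
      rfl
  · have hb : ¬ F.Before (Complex.exp (u s)) (Complex.exp (v s)) := fun h =>
      hex (before_exp_iff.1 h)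
    have h1 := (continuousAt_beta (exp_mem_diskStar.2 (hum s hs)) (exp_mem_diskStar.2 (hvm s hs))
      (hne s hs) hb).comp_continuousWithinAt (f := fun t => (Complex.exp (u t), Complex.exp (v t)))
      (x := s) ((hu s hs).cexp.prodMk (hv s hs).cexp)
    exact h1.add (tendsto_finsetSum _ fun l _ => hconst l fun h => hex ⟨l, h⟩)

omit hu hv hθ hθ' in
theorem RadialFoliation.exists_int_beta {a : ℝ} {s : ℝ} (hs : s ∈ Icc (0 : ℝ) 1)
    (ha : IsTurn a (1 - Complex.exp (v s) / Complex.exp (u s))) :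
    ∃ n : ℤ, 2 * (a - F.beta (Complex.exp (u s)) (Complex.exp (v s))) = n := by
  have hz := exp_mem_diskStar.2 (hum s hs)
  have hz' := exp_mem_diskStar.2 (hvm s hs)
  by_cases hb : F.Before (Complex.exp (u s)) (Complex.exp (v s))
  · obtain ⟨k, hk⟩ := before_exp_iff.1 hb
    have h1 := hk.beta_eq
    rw [exp_deck] at h1
    have h2 := (isTurn_half_neg_one.mul (isTurn_exp (deck k (v s) - u s))).mul
      (isTurn_branch hz' hz (hne s hs).symm (by simpa only [exp_deck] using hk.not_before))
    have e : -1 * Complex.exp (deck k (v s) - u s) * (1 - Complex.exp (u s) / Complex.exp (v s)) =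
        1 - Complex.exp (v s) / Complex.exp (u s) := by
      rw [Complex.exp_sub, exp_deck]
      have := Complex.exp_ne_zero (u s)
      have := Complex.exp_ne_zero (v s)
      field_simp
      ring
    rw [e] at h2
    obtain ⟨n, hn⟩ := ha.sub_int h2
    exact ⟨1 + 2 * n, by rw [h1, hn]; push_cast; ring⟩
  · have := isTurn_branch hz hz' (hne s hs) hb
    obtain ⟨n, hn⟩ := ha.sub_int this
    exact ⟨2 * n, by rw [beta_of_not_before hb, hn]; push_cast; ring⟩

/-- The total crossing number is the variation of the angle of `1 - z'/z` minus that of `beta`. -/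
theorem RadialFoliation.finsum_crossing_eq :
    (Function.support fun k => crossing (θh k 0) (θh k 1)).Finite ∧
      ∑ᶠ k, crossing (θh k 0) (θh k 1) =
        angleVariation (fun s => 1 - Complex.exp (v s) / Complex.exp (u s)) -
          (F.beta (Complex.exp (u 1)) (Complex.exp (v 1)) -
            F.beta (Complex.exp (u 0)) (Complex.exp (v 0))) := by
  have hfin := F.finite_pointLT hu hv hum hvm hne
  set K := hfin.toFinset with hKdef
  have hK : ∀ k, (∃ s ∈ Icc (0 : ℝ) 1, F.PointLT (u s) (deck k (v s))) → k ∈ K :=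
    fun k hk => hfin.mem_toFinset.2 hk
  have hsupp : (Function.support fun k => crossing (θh k 0) (θh k 1)) ⊆ K := by
    intro k hk
    by_contra hkK
    refine hk ?_
    simp only [crossing_eq]
    rw [height_eq_of_forall hum hvm hne hθ hθ' fun s hs h => hkK (hK k ⟨s, hs, h⟩), sub_self]
  refine ⟨K.finite_toSet.subset hsupp, ?_⟩
  rw [finsum_eq_sum_of_support_subset _ hsupp]
  simp only [crossing_eq, Finset.sum_sub_distrib]
  have hcont : ContinuousOn (fun s => 1 - Complex.exp (v s) / Complex.exp (u s)) (Icc 0 1) :=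
    continuousOn_const.sub (hv.cexp.div hu.cexp fun s _ => Complex.exp_ne_zero _)
  obtain ⟨L, hL, hL'⟩ := exists_log_Icc hcont
    (fun s hs => one_sub_div_ne_zero (Complex.exp_ne_zero _) (hne s hs).symm)
  rw [angleVariation_of_log hL hL']
  -- `beta` plus the heights differs from the continuous argument `L.im / 2π` by a continuous function
  -- with values in `ℤ/2`, that is by a constant.
  have hint := eq_of_continuousOn_of_int (s := Icc (0 : ℝ) 1)
    (f := fun s => 2 * ((L s).im / (2 * π) - (F.beta (Complex.exp (u s)) (Complex.exp (v s)) +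
      ∑ k ∈ K, height (θh k s)))) isPreconnected_Icc (x := 0) (y := 1) ?_ ?_ (by simp) (by simp)
  · have : ∀ x y : ℝ, (x - y) / (2 * π) = x / (2 * π) - y / (2 * π) := fun x y => sub_div _ _ _
    rw [this]
    linarith
  · exact continuousOn_const.mul (((Complex.continuous_im.comp_continuousOn hL).div_const _).sub
      (continuousOn_beta_add_height hu hv hum hvm hne hθ hθ' hK))
  · intro s hs
    obtain ⟨n, hn⟩ := exists_int_beta (F := F) hum hvm hne hs (by rw [← hL' s hs]; exact isTurn_exp (L s))
    choose m hm using fun k => exists_int_two_mul_height (θh k s)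
    refine ⟨n - ∑ k ∈ K, m k, ?_⟩
    push_cast
    rw [← hn, ← Finset.sum_congr rfl fun k _ => hm k, ← Finset.mul_sum]
    ring

end height

end paths

/-! ### Isotopies of the punctured disk -/

theorem angleVariation_circle {δ : ℝ} (hδ : 0 < δ) :
    angleVariation (fun θ => δ * Complex.exp (2 * π * θ * Complex.I)) = 1 := by
  rw [angleVariation_of_log (L := fun θ : ℝ => Real.log δ + 2 * π * θ * Complex.I) (by fun_prop)]
  · have := Real.pi_pos
    simp
  · intro s _
    rw [Complex.exp_add, ← Complex.ofReal_exp, Real.exp_log hδ]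

theorem norm_circle {δ : ℝ} (hδ : 0 ≤ δ) (θ : ℝ) :
    ‖(δ * Complex.exp (2 * π * θ * Complex.I) : ℂ)‖ = δ := by
  have : (2 * π * θ * Complex.I : ℂ) = ((2 * π * θ : ℝ) : ℂ) * Complex.I := by push_cast; ring
  rw [norm_mul, this, Complex.norm_exp_ofReal_mul_I, Complex.norm_real, Real.norm_eq_abs,
    abs_of_nonneg hδ, mul_one]

/-- The winding number of a closed curve is invariant under homotopy. -/
theorem angleVariation_loop {H : ℝ → ℝ → ℂ}
    (hH : ContinuousOn (fun p : ℝ × ℝ => H p.1 p.2) (Icc 0 1 ×ˢ Icc 0 1))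
    (h0 : ∀ r ∈ Icc (0 : ℝ) 1, ∀ s ∈ Icc (0 : ℝ) 1, H r s ≠ 0) (hl : ∀ r, H r 1 = H r 0) :
    angleVariation (H 0) = angleVariation (H 1) := by
  have := angleVariation_square hH h0
  simp only [hl] at this
  linarith

section isotopy

variable {g : ℝ → ℂ → ℂ} {f : ℂ → ℂ} (hg : IsIdentityIsotopyStar g f)
include hg

theorem IsIdentityIsotopyStar.ne {s : ℝ} (hs : s ∈ Icc (0 : ℝ) 1) {a b : ℂ} (ha : a ∈ diskStar)
    (hb : b ∈ diskStar) (h : a ≠ b) : g s a ≠ g s b := fun he => h ((hg.bijOn s hs).injOn ha hb he)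

/-- The homeomorphisms of an isotopy are locally onto, uniformly in the time: a small circle keeps
its winding number `1` along the isotopy. -/
theorem IsIdentityIsotopyStar.eventually_mem_image {y : ℂ} {δ : ℝ} (hδ : 0 < δ)
    (hy : Metric.closedBall y δ ⊆ diskStar) {s : ℝ} (hs : s ∈ Icc (0 : ℝ) 1) :
    ∀ᶠ p : ℝ × ℂ in 𝓝 (s, g s y), p.1 ∈ Icc (0 : ℝ) 1 → p.2 ∈ g p.1 '' Metric.closedBall y δ := by
  set c : ℝ → ℂ := fun θ => δ * Complex.exp (2 * π * θ * Complex.I) with hc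
  have hcc : Continuous c := by fun_prop
  have hc1 : c 1 = c 0 := by simp [hc]
  have hcn : ∀ θ, ‖c θ‖ = δ := norm_circle hδ.le
  have hcm : ∀ r ∈ Icc (0 : ℝ) 1, ∀ θ, y + r * c θ ∈ Metric.closedBall y δ := by
    intro r hr θ
    rw [mem_closedBall_iff_norm, add_sub_cancel_left, norm_mul, hcn, Complex.norm_real,
      Real.norm_eq_abs, abs_of_nonneg hr.1]
    exact mul_le_of_le_one_left hδ.le hr.2
  have hcm1 : ∀ θ, y + c θ ∈ Metric.closedBall y δ := fun θ => by
    simpa using hcm 1 (by simp) θ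
  have hyD : y ∈ diskStar := hy (Metric.mem_closedBall_self hδ.le)
  have hgc : ∀ {P : ℝ × ℝ → ℝ} {Q : ℝ × ℝ → ℂ}, Continuous P → Continuous Q →
      (∀ x ∈ Icc (0 : ℝ) 1 ×ˢ Icc (0 : ℝ) 1, P x ∈ Icc (0 : ℝ) 1 ∧ Q x ∈ diskStar) →
      ContinuousOn (fun x => g (P x) (Q x)) (Icc (0 : ℝ) 1 ×ˢ Icc (0 : ℝ) 1) := by
    intro P Q hP hQ h
    exact hg.continuousOn.comp (hP.prodMk hQ).continuousOn fun x hx => h x hx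
  -- The winding number at time `s`.
  have hW : angleVariation (fun θ => g s (y + c θ) - g s y) = 1 := by
    have hmem : ∀ r ∈ Icc (0 : ℝ) 1, r * s ∈ Icc (0 : ℝ) 1 := fun r hr =>
      ⟨mul_nonneg hr.1 hs.1, mul_le_one₀ hr.2 hs.1 hs.2⟩
    have := angleVariation_loop (H := fun r θ => g (r * s) (y + c θ) - g (r * s) y)
      ((hgc (by fun_prop) (by fun_prop) fun x hx => ⟨hmem _ hx.1, hy (hcm1 _)⟩).sub
        (hgc (by fun_prop) continuous_const fun x hx => ⟨hmem _ hx.1, hyD⟩))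
      (fun r hr θ _ => sub_ne_zero.2 (hg.ne (hmem r hr) (hy (hcm1 _)) hyD fun he => by
        have := hcn θ
        rw [add_eq_left.1 he, norm_zero] at this
        exact hδ.ne this)) (fun r => by simp only [hc1])
    simp only [zero_mul, one_mul] at this
    rw [← this]
    simp only [hg.start _ (hy (hcm1 _)), hg.start _ hyD, add_sub_cancel_left]
    exact angleVariation_circle hδ
  -- A lower bound of the distance of the curve to its centre.
  have hscont : ContinuousOn (g s) diskStar :=
    hg.continuousOn.comp (f := fun w => (s, w)) (by fun_prop) fun x hx => ⟨hs, hx⟩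
  have hcurve : ContinuousOn (fun θ => ‖g s (y + c θ) - g s y‖) (Icc 0 1) :=
    ((hscont.comp (by fun_prop) fun θ _ => hy (hcm1 θ)).sub continuousOn_const).norm
  obtain ⟨θ₀, hθ₀, hmin⟩ := isCompact_Icc.exists_isMinOn (nonempty_Icc.2 zero_le_one) hcurve
  set η := ‖g s (y + c θ₀) - g s y‖ / 2 with hη
  have hηpos : 0 < η := half_pos (norm_pos_iff.2 (sub_ne_zero.2
    (hg.ne hs (hy (hcm1 _)) hyD fun he => by
      have := hcn θ₀
      rw [add_eq_left.1 he, norm_zero] at this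
      exact hδ.ne this)))
  have huc : UniformContinuousOn (fun p : ℝ × ℂ => g p.1 p.2)
      (Icc 0 1 ×ˢ Metric.closedBall y δ) :=
    (isCompact_Icc.prod (isCompact_closedBall y δ)).uniformContinuousOn_of_continuous
      (hg.continuousOn.mono (prod_mono le_rfl hy))
  obtain ⟨d, hd, hud⟩ := Metric.uniformContinuousOn_iff.1 huc η hηpos
  have hbound : ∀ σ ∈ Icc (0 : ℝ) 1, |σ - s| < d → ∀ ω, ‖ω - g s y‖ < η → ∀ θ ∈ Icc (0 : ℝ) 1,
      g σ (y + c θ) - ω ≠ 0 := by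
    intro σ hσ hσs ω hω θ hθ he
    have h1 := hud (σ, y + c θ) ⟨hσ, hcm1 θ⟩ (s, y + c θ) ⟨hs, hcm1 θ⟩ (by
      rw [Prod.dist_eq, dist_self, max_eq_left dist_nonneg]; exact hσs)
    rw [dist_eq_norm] at h1
    have h2 := isMinOn_iff.1 hmin θ hθ
    have h3 : ‖g s (y + c θ) - g s y‖ ≤ ‖g σ (y + c θ) - g s (y + c θ)‖ + ‖ω - g s y‖ := by
      rw [← sub_eq_zero.1 he, norm_sub_rev]
      have := norm_add_le (g s y - g σ (y + c θ)) (g σ (y + c θ) - g s (y + c θ))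
      rw [sub_add_sub_cancel, norm_sub_rev (g s y) (g σ (y + c θ))] at this
      linarith
    simp only at h1 h2
    linarith
  filter_upwards [prod_mem_nhds (Metric.ball_mem_nhds s hd) (Metric.ball_mem_nhds (g s y) hηpos)]
  rintro ⟨σ, ω⟩ ⟨hσs, hω⟩ hσ
  simp only [Metric.mem_ball, dist_eq_norm, Real.norm_eq_abs] at hσs hω hσ
  have hscale : ∀ r ∈ Icc (0 : ℝ) 1, ∀ x : ℝ, 0 ≤ x → r * x ≤ x := fun r hr x hx =>
    mul_le_of_le_one_left hx hr.2
  -- The winding number is unchanged for times and points nearby; if the point were not attained, the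
  -- circle could be shrunk without meeting it.
  have hW1 : angleVariation (fun θ => g σ (y + c θ) - ω) = 1 := by
    have hmem : ∀ r ∈ Icc (0 : ℝ) 1, s + r * (σ - s) ∈ Icc (0 : ℝ) 1 := fun r hr =>
      ⟨by nlinarith [hr.1, hr.2, hs.1, hσ.1], by nlinarith [hr.1, hr.2, hs.2, hσ.2]⟩
    have := angleVariation_loop
      (H := fun r θ => g (s + r * (σ - s)) (y + c θ) - (g s y + r * (ω - g s y)))
      ((hgc (by fun_prop) (by fun_prop) fun x hx => ⟨hmem _ hx.1, hy (hcm1 _)⟩).sub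
        (by fun_prop))
      (fun r hr θ hθ => hbound _ (hmem r hr) (by
          rw [add_sub_cancel_left, abs_mul, abs_of_nonneg hr.1]
          exact (hscale r hr _ (abs_nonneg _)).trans_lt hσs) _ (by
          rw [add_sub_cancel_left, norm_mul, Complex.norm_real, Real.norm_eq_abs,
            abs_of_nonneg hr.1]
          exact (hscale r hr _ (norm_nonneg _)).trans_lt hω) θ hθ) (fun r => by simp only [hc1])
    simp only [zero_mul, one_mul, add_zero, Complex.ofReal_zero, Complex.ofReal_one,
      add_sub_cancel] at this
    rw [← this, hW]
  by_contra hn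
  have h0 : ∀ r ∈ Icc (0 : ℝ) 1, ∀ θ ∈ Icc (0 : ℝ) 1, g σ (y + r * c θ) - ω ≠ 0 :=
    fun r hr θ _ he => hn ⟨_, hcm r hr θ, sub_eq_zero.1 he⟩
  have := angleVariation_loop (H := fun r θ => g σ (y + r * c θ) - ω)
    ((hgc continuous_const (by fun_prop) fun x hx => ⟨hσ, hy (hcm _ hx.1 _)⟩).sub
      continuousOn_const) h0 (fun r => by simp only [hc1])
  simp only [Complex.ofReal_zero, Complex.ofReal_one, zero_mul, add_zero, one_mul] at this
  rw [hW1, angleVariation_const (by simpa using h0 0 (by simp) 0 (by simp))] at this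
  exact zero_ne_one this

/-- Points close to the puncture stay, along the whole isotopy, closer to it than a given orbit. -/
theorem IsIdentityIsotopyStar.exists_norm_lt {z : ℂ} (hz : z ∈ diskStar) :
    ∃ ε > 0, ∀ y ∈ diskStar, ‖y‖ < ε → ∀ s ∈ Icc (0 : ℝ) 1, ‖g s y‖ < ‖g s z‖ := by
  have horb : ∀ y ∈ diskStar, ContinuousOn (fun s => ‖g s y‖) (Icc 0 1) := fun y hy =>
    (hg.continuousOn.comp (f := fun s => (s, y)) (by fun_prop) fun x hx => ⟨hx, hy⟩).norm
  obtain ⟨s₀, hs₀, hmin⟩ := isCompact_Icc.exists_isMinOn (nonempty_Icc.2 zero_le_one) (horb z hz)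
  set c := ‖g s₀ z‖ with hc
  have hc0 : 0 < c := ((hg.bijOn s₀ hs₀).mapsTo hz).1
  have hc1 : c < 1 := ((hg.bijOn s₀ hs₀).mapsTo hz).2
  have hK : IsCompact (Icc (0 : ℝ) 1 ×ˢ Metric.sphere (0 : ℂ) c) :=
    isCompact_Icc.prod (isCompact_sphere 0 c)
  -- By local surjectivity, the points that are carried at some time onto the circle of radius `c`, the
  -- least distance of the orbit to the puncture, stay away from the puncture.
  obtain ⟨ε, hε, hε'⟩ := hK.induction_on (p := fun U => ∃ ε > 0, ∀ p ∈ U, p.1 ∈ Icc (0 : ℝ) 1 →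
      ∀ y ∈ diskStar, g p.1 y = p.2 → ε ≤ ‖y‖)
    ⟨1, one_pos, fun p hp => absurd hp (notMem_empty p)⟩
    (fun S T hST ⟨ε, hε, h⟩ => ⟨ε, hε, fun p hp => h p (hST hp)⟩)
    (fun S T ⟨ε, hε, h⟩ ⟨ε', hε', h'⟩ => ⟨min ε ε', lt_min hε hε', fun p hp hp1 y hy he =>
      hp.elim (fun hp => (min_le_left _ _).trans (h p hp hp1 y hy he))
        fun hp => (min_le_right _ _).trans (h' p hp hp1 y hy he)⟩) (by
    rintro ⟨s, w⟩ ⟨hs, hw⟩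
    simp only [mem_sphere_iff_norm, sub_zero] at hw hs
    obtain ⟨y, hy, rfl⟩ := (hg.bijOn s hs).surjOn (show w ∈ diskStar from ⟨hw ▸ hc0, hw ▸ hc1⟩)
    obtain ⟨δ, hδ, hball⟩ := Metric.isOpen_iff.1 isOpen_diskStar y hy
    have hsub : Metric.closedBall y (δ / 2) ⊆ diskStar :=
      (Metric.closedBall_subset_ball (by linarith)).trans hball
    refine ⟨_, nhdsWithin_le_nhds (hg.eventually_mem_image (half_pos hδ) hsub hs), ?_⟩
    obtain ⟨x₀, hx₀, hxmin⟩ := (isCompact_closedBall y (δ / 2)).exists_isMinOn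
      ⟨y, Metric.mem_closedBall_self (by linarith)⟩ continuous_norm.continuousOn
    refine ⟨‖x₀‖, (hsub hx₀).1, fun p hp hp1 x hx he => ?_⟩
    obtain ⟨x', hx', he'⟩ := hp hp1
    rw [(hg.bijOn p.1 hp1).injOn hx (hsub hx') (he.trans he'.symm)]
    exact isMinOn_iff.1 hxmin x' hx')
  refine ⟨min ε c, lt_min hε hc0, fun y hy hyε s hs => ?_⟩
  by_contra hn
  have hcs : c ≤ ‖g s y‖ := (isMinOn_iff.1 hmin s hs).trans (not_lt.1 hn)
  have hivt := intermediate_value_Icc hs.1 ((horb y hy).mono (Icc_subset_Icc_right hs.2))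
  obtain ⟨t, ht, hte⟩ := hivt (show c ∈ Icc ‖g 0 y‖ ‖g s y‖ from
    ⟨by rw [hg.start y hy]; exact (hyε.trans_le (min_le_right _ _)).le, hcs⟩)
  have ht' : t ∈ Icc (0 : ℝ) 1 := ⟨ht.1, ht.2.trans hs.2⟩
  have := hε' (t, g t y) ⟨ht', by simpa using hte⟩ ht' y hy rfl
  exact (hyε.trans_le (min_le_left _ _)).not_ge this

/-- The variation of the angle of `1 - z'/z` along an isotopy is determined by its end. -/
theorem IsIdentityIsotopyStar.angleVariation_eq {g' : ℝ → ℂ → ℂ} (hg' : IsIdentityIsotopyStar g' f)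
    {z z' : ℂ} (hz : z ∈ diskStar) (hz' : z' ∈ diskStar) (hne : z ≠ z') :
    angleVariation (fun s => 1 - g s z' / g s z) = angleVariation (fun s => 1 - g' s z' / g' s z) := by
  obtain ⟨ε, hε, h⟩ := hg.exists_norm_lt hz
  obtain ⟨ε', hε', h'⟩ := hg'.exists_norm_lt hz
  -- A path from `z'` to a small multiple of it, spiralling if `z` is on the way.
  obtain ⟨c, hc0, hc⟩ : ∃ c : ℂ, c.re < 0 ∧ ∀ r ∈ Icc (0 : ℝ) 1, z' * Complex.exp (r * c) ≠ z ∧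
      (r = 1 → ‖z' * Complex.exp (r * c)‖ < min ε ε') := by
    have hz0 := ne_zero_of_mem_diskStar hz
    have hz0' := ne_zero_of_mem_diskStar hz'
    obtain ⟨M, hM0, hM⟩ : ∃ M < 0, ‖z'‖ * Real.exp M < min ε ε' := by
      have h1 : Tendsto (fun M => ‖z'‖ * Real.exp M) atBot (𝓝 (‖z'‖ * 0)) :=
        tendsto_const_nhds.mul Real.tendsto_exp_atBot
      rw [mul_zero] at h1
      exact ((eventually_lt_atBot 0).and
        (h1.eventually (gt_mem_nhds (lt_min hε hε')))).exists
    have hnorm : ∀ b : ℝ, ‖z' * Complex.exp ((1 : ℝ) * (M + b * Complex.I))‖ < min ε ε' := by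
      intro b
      rw [norm_mul, Complex.norm_exp]
      simpa using hM
    by_cases hq : ∃ r ∈ Icc (0 : ℝ) 1, z' * Complex.exp (r * (M + (0 : ℝ) * Complex.I)) = z
    · refine ⟨M + (1 : ℝ) * Complex.I, by simpa using hM0, fun r hr => ⟨fun he => ?_, ?_⟩⟩
      · obtain ⟨r', hr', he'⟩ := hq
        rw [← he'] at he
        have h1 := mul_left_cancel₀ hz0' he
        obtain ⟨n, hn⟩ := Complex.exp_eq_exp_iff_exists_int.1 h1
        have him := congrArg Complex.im hn
        simp at him
        have hp := Real.pi_gt_three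
        have hn0 : n = 0 := by
          have h3 : (n : ℝ) * (2 * π) < 2 * π := by rw [← him]; linarith [hr.2]
          have h4 : 0 ≤ (n : ℝ) * (2 * π) := by rw [← him]; exact hr.1
          have h5 : (n : ℝ) < 1 := by nlinarith
          have h6 : (0 : ℝ) ≤ n := by nlinarith
          have h5' : n < 1 := by exact_mod_cast h5
          have h6' : 0 ≤ n := by exact_mod_cast h6
          omega
        rw [hn0] at him
        simp only [Int.cast_zero, zero_mul] at him
        have hre := congrArg Complex.re hn
        simp [him] at hre
        rcases hre with hre | hre
        · rw [← he', hre] at hne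
          simp at hne
        · exact hM0.ne hre
      · rintro rfl
        exact hnorm 1
    · push Not at hq
      refine ⟨M + (0 : ℝ) * Complex.I, by simpa using hM0, fun r hr => ⟨hq r hr, ?_⟩⟩
      rintro rfl
      exact hnorm 0
  set p : ℝ → ℂ := fun r => z' * Complex.exp (r * c) with hp
  have hpc : Continuous p := by fun_prop
  have hp0 : p 0 = z' := by simp [hp]
  have hpm : ∀ r ∈ Icc (0 : ℝ) 1, p r ∈ diskStar := fun r hr => by
    have h1 : ‖p r‖ = ‖z'‖ * Real.exp (r * c.re) := by
      rw [hp, norm_mul, Complex.norm_exp]; simp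
    have h2 : Real.exp (r * c.re) ≤ 1 := Real.exp_le_one_iff.2 (by nlinarith [hr.1])
    refine ⟨by rw [h1]; exact mul_pos hz'.1 (Real.exp_pos _), ?_⟩
    rw [h1]
    nlinarith [hz'.1, hz'.2]
  -- For a point `p 1` so close to the puncture, `1 - z'/z` stays in the right half plane; the square
  -- swept by the isotopy and the path `p` relates it to `z'`.
  have key : ∀ {G : ℝ → ℂ → ℂ}, IsIdentityIsotopyStar G f →
      (∀ s ∈ Icc (0 : ℝ) 1, ‖G s (p 1)‖ < ‖G s z‖) →
      angleVariation (fun s => 1 - G s z' / G s z) +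
        angleVariation (fun r => 1 - f (p r) / f z) = angleVariation (fun r => 1 - p r / z) +
        ((1 - f (p 1) / f z).arg - (1 - p 1 / z).arg) / (2 * π) := by
    intro G hG hlt
    have hz1 : ∀ s ∈ Icc (0 : ℝ) 1, G s z ≠ 0 := fun s hs =>
      ne_zero_of_mem_diskStar ((hG.bijOn s hs).mapsTo hz)
    have hGz : ContinuousOn (fun s => G s z) (Icc 0 1) :=
      hG.continuousOn.comp (f := fun s => (s, z)) (by fun_prop) fun x hx => ⟨hx, hz⟩
    have hGp : ContinuousOn (fun s => G s (p 1)) (Icc 0 1) :=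
      hG.continuousOn.comp (f := fun s => (s, p 1)) (by fun_prop) fun x hx => ⟨hx, hpm 1 (by simp)⟩
    have hsq := angleVariation_square (H := fun r s => 1 - G s (p r) / G s z)
      (continuousOn_const.sub (ContinuousOn.div
        (hG.continuousOn.comp (f := fun x : ℝ × ℝ => (x.2, p x.1)) (by fun_prop)
          fun x hx => ⟨hx.2, hpm _ hx.1⟩)
        (hGz.comp continuousOn_snd fun x hx => hx.2) fun x hx => hz1 _ hx.2))
      (fun r hr s hs => one_sub_div_ne_zero (hz1 s hs)
        (hG.ne hs (hpm r hr) hz (hc r hr).1))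
    rw [angleVariation_of_slitPlane (γ := fun s => 1 - G s (p 1) / G s z)
      (continuousOn_const.sub (hGp.div hGz hz1))
      (fun s hs => Or.inl (one_sub_div_re_pos (hlt s hs)))] at hsq
    rw [hp0] at hsq
    rw [angleVariation_congr (γ := fun r => 1 - G 1 (p r) / G 1 z) (δ := fun r => 1 - f (p r) / f z) (fun r hr => by
      simp only [hG.finish _ (hpm r hr), hG.finish z hz]),
      angleVariation_congr (γ := fun r => 1 - G 0 (p r) / G 0 z) (δ := fun r => 1 - p r / z) (fun r hr => by
      simp only [hG.start _ (hpm r hr), hG.start z hz])] at hsq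
    rwa [hG.finish _ (hpm 1 (by simp)), hG.finish z hz, hG.start _ (hpm 1 (by simp)),
      hG.start z hz] at hsq
  have hp1 := (hc 1 (by simp)).2 rfl
  have k1 := key hg (h _ (hpm 1 (by simp)) (hp1.trans_le (min_le_left _ _)))
  have k2 := key hg' (h' _ (hpm 1 (by simp)) (hp1.trans_le (min_le_right _ _)))
  linarith

end isotopy

/-! ### Isotopies of the disk that fix the centre -/

theorem isCompact_disk : IsCompact disk := isCompact_closedBall 0 1

theorem mem_disk_iff {z : ℂ} : z ∈ disk ↔ ‖z‖ ≤ 1 := by simp [disk]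

theorem diskStar_subset_disk : diskStar ⊆ disk := fun _ hz => mem_disk_iff.2 hz.2.le

/-- A continuous injection of a compact set has a continuous inverse. -/
theorem continuousOn_invFunOn {h : ℂ → ℂ} {K : Set ℂ} (hK : IsCompact K) (hc : ContinuousOn h K)
    (hb : BijOn h K K) : ContinuousOn (Function.invFunOn h K) K := by
  rw [continuousOn_iff_isClosed]
  intro C hC
  refine ⟨h '' (K ∩ C), ((hK.inter_right hC).image_of_continuousOn
    (hc.mono inter_subset_left)).isClosed, ?_⟩
  have hinv := hb.invOn_invFunOn
  ext w
  constructor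
  · rintro ⟨h1, h2⟩
    exact ⟨⟨_, ⟨hb.surjOn.mapsTo_invFunOn h2, h1⟩, hinv.2 h2⟩, h2⟩
  · rintro ⟨⟨x, ⟨hx, hxC⟩, rfl⟩, h2⟩
    exact ⟨by rw [mem_preimage, hinv.1 hx]; exact hxC, h2⟩

/-- A continuous injection of the circle into itself is onto: otherwise the argument would give a
continuous injection of the circle into the line, which takes equal values at two opposite points. -/
theorem surjOn_sphere {h : ℂ → ℂ} (hc : ContinuousOn h (Metric.sphere 0 1))
    (hi : InjOn h (Metric.sphere 0 1)) (hm : MapsTo h (Metric.sphere 0 1) (Metric.sphere 0 1)) :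
    SurjOn h (Metric.sphere 0 1) (Metric.sphere 0 1) := by
  intro p hp
  by_contra hn
  have hp1 : ‖p‖ = 1 := by simpa using hp
  have hp0 : p ≠ 0 := fun h0 => by rw [h0, norm_zero] at hp1; exact zero_ne_one hp1
  set e : ℝ → ℂ := fun t => Complex.exp (t * Complex.I) with he
  have hem : ∀ t, e t ∈ Metric.sphere (0 : ℂ) 1 := fun t => by simp [he, Complex.norm_exp_ofReal_mul_I]
  have hnorm : ∀ t, ‖-h (e t) / p‖ = 1 := fun t => by
    have : ‖h (e t)‖ = 1 := by simpa using hm (hem t)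
    rw [norm_div, norm_neg, this, hp1, div_one]
  have hslit : ∀ t, -h (e t) / p ∈ Complex.slitPlane := fun t => by
    rw [Complex.mem_slitPlane_iff_arg]
    refine ⟨fun harg => hn ⟨e t, hem t, ?_⟩, fun h0 => ?_⟩
    · have := Complex.norm_mul_exp_arg_mul_I (-h (e t) / p)
      rw [harg, hnorm, Complex.exp_pi_mul_I] at this
      push_cast at this
      rw [one_mul, eq_div_iff hp0] at this
      simpa using this.symm
    · have := hnorm t
      rw [h0, norm_zero] at this
      exact zero_ne_one this
  set a : ℝ → ℝ := fun t => (-h (e t) / p).arg with ha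
  have hac : Continuous a := by
    rw [continuous_iff_continuousAt]
    intro t
    refine ContinuousAt.comp (g := Complex.arg) (Complex.continuousAt_arg (hslit t)) ?_
    have : Continuous fun t => h (e t) := hc.comp_continuous (by fun_prop) hem
    exact (this.neg.div_const p).continuousAt
  have hper : a (π + π) = a 0 := by
    have : e (π + π) = e 0 := by
      simp only [he]
      push_cast
      rw [← two_mul, Complex.exp_two_pi_mul_I]
      simp
    simp only [ha, this]
  obtain ⟨t, ht⟩ : ∃ t, a t - a (t + π) = 0 := by
    have hdc : Continuous fun t => a t - a (t + π) := by fun_prop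
    have h1 : a 0 - a (0 + π) = -(a π - a (π + π)) := by rw [hper, zero_add]; ring
    rcases le_total (a π - a (π + π)) 0 with h0 | h0
    · obtain ⟨t, ht⟩ := mem_range_of_exists_le_of_exists_ge hdc ⟨π, h0⟩
        ⟨0, by rw [h1]; linarith⟩
      exact ⟨t, ht⟩
    · obtain ⟨t, ht⟩ := mem_range_of_exists_le_of_exists_ge hdc
        ⟨0, by rw [h1]; linarith⟩ ⟨π, h0⟩
      exact ⟨t, ht⟩
  have heq : -h (e t) / p = -h (e (t + π)) / p :=
    Complex.ext_norm_arg (by rw [hnorm, hnorm]) (by simpa [ha, sub_eq_zero] using ht)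
  have h2 := hi (hem t) (hem (t + π)) (neg_injective ((div_left_inj' hp0).1 heq))
  have h3 : e (t + π) = -e t := by
    simp only [he]
    push_cast
    rw [add_mul, Complex.exp_add, Complex.exp_pi_mul_I, mul_neg_one]
  rw [h3] at h2
  exact Complex.exp_ne_zero _ (self_eq_neg.1 h2)

/-- An isotopy of the disk that fixes `0` and lifts to the cover restricts to `𝔻*`.  That it is onto `𝔻*`
uses that the inverses preserve the circle, on which they are therefore onto. -/
theorem IsIdentityIsotopy.star {J Jt : ℝ → ℂ → ℂ} {f : ℂ → ℂ} (hJ : IsIdentityIsotopy J f)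
    (hJ0 : ∀ s ∈ Icc (0 : ℝ) 1, J s 0 = 0) (hJt : IsLiftedIsotopy J Jt) :
    IsIdentityIsotopyStar J f := by
  have hmaps : ∀ s ∈ Icc (0 : ℝ) 1, MapsTo (J s) diskStar diskStar := fun s hs z hz => by
    have h1 := hJt.lift s hs _ (log_mem_cover hz)
    rw [Complex.exp_log (ne_zero_of_mem_diskStar hz)] at h1
    rw [← h1, exp_mem_diskStar]
    exact hJt.mapsTo s hs (log_mem_cover hz)
  refine ⟨hJ.continuousOn.mono (prod_mono le_rfl diskStar_subset_disk), fun s hs => ?_,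
    fun z hz => hJ.start z (diskStar_subset_disk hz), fun z hz => hJ.finish z (diskStar_subset_disk hz)⟩
  have hb := hJ.bijOn s hs
  refine ⟨hmaps s hs, hb.injOn.mono diskStar_subset_disk, ?_⟩
  have hJc : ContinuousOn (J s) disk :=
    hJ.continuousOn.comp (f := fun w => (s, w)) (by fun_prop) fun x hx => ⟨hs, hx⟩
  have hsd : Metric.sphere (0 : ℂ) 1 ⊆ disk := Metric.sphere_subset_closedBall
  have hinv := hb.invOn_invFunOn
  set h := Function.invFunOn (J s) disk
  have hhm : MapsTo h disk disk := hb.surjOn.mapsTo_invFunOn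
  have hcase : ∀ w ∈ disk, w = 0 ∨ w ∈ diskStar ∨ w ∈ Metric.sphere (0 : ℂ) 1 := by
    intro w hw
    rw [mem_disk_iff] at hw
    rcases hw.lt_or_eq with h1 | h1
    · rcases eq_or_ne w 0 with h2 | h2
      · exact Or.inl h2
      · exact Or.inr (Or.inl ⟨norm_pos_iff.2 h2, h1⟩)
    · exact Or.inr (Or.inr (by simpa using h1))
  have hnot : ∀ w ∈ Metric.sphere (0 : ℂ) 1, w ≠ 0 ∧ w ∉ diskStar := by
    intro w hw
    have hw : ‖w‖ = 1 := by simpa using hw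
    exact ⟨fun h0 => by rw [h0, norm_zero] at hw; exact zero_ne_one hw, fun h0 => h0.2.ne hw⟩
  have hsurj := surjOn_sphere (h := h) ((continuousOn_invFunOn isCompact_disk hJc hb).mono hsd)
    (hinv.2.injOn.mono hsd) (fun w hw => by
      have h1 : J s (h w) = w := hinv.2 (hsd hw)
      rcases hcase _ (hhm (hsd hw)) with h2 | h2 | h2
      · rw [h2, hJ0 s hs] at h1
        exact absurd h1.symm (hnot w hw).1
      · exact absurd (h1 ▸ hmaps s hs h2) (hnot w hw).2
      · exact h2)
  intro w hw
  have hwd := diskStar_subset_disk hw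
  refine ⟨h w, ?_, hinv.2 hwd⟩
  have h1 : J s (h w) = w := hinv.2 hwd
  rcases hcase _ (hhm hwd) with h2 | h2 | h2
  · rw [h2, hJ0 s hs] at h1
    exact absurd h1.symm (ne_zero_of_mem_diskStar hw)
  · exact h2
  · obtain ⟨q, hq, hqe⟩ := hsurj h2
    have := hinv.2.injOn (hsd hq) hwd hqe
    exact absurd hw (this ▸ (hnot q hq).2)

/-! ### The crossing function in terms of the angle -/

theorem IsLiftedIsotopy.continuousOn_path {g gt : ℝ → ℂ → ℂ} (h : IsLiftedIsotopy g gt) {ζ : ℂ}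
    (hζ : ζ ∈ cover) : ContinuousOn (fun s => gt s ζ) (Icc 0 1) :=
  h.continuousOn.comp (f := fun s => (s, ζ)) (by fun_prop) fun _ hx => ⟨hx, hζ⟩

theorem IsLiftedIsotopy.deck {g gt : ℝ → ℂ → ℂ} (h : IsLiftedIsotopy g gt) {ζ : ℂ}
    (hζ : ζ ∈ cover) (k : ℤ) {s : ℝ} (hs : s ∈ Icc (0 : ℝ) 1) :
    gt s (deck k ζ) = deck k (gt s ζ) := by
  have hk : CalabiRadial.deck k ζ ∈ cover := deck_mem_cover.2 hζ
  obtain ⟨n, hn⟩ := exists_int_of_exp_eq isPreconnected_Icc (h.continuousOn_path hk)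
    (h.continuousOn_path hζ) (fun x hx => by rw [h.lift x hx _ hk, h.lift x hx _ hζ, exp_deck])
  have h0 := hn 0 (by simp)
  rw [h.start _ hk, h.start _ hζ] at h0
  rw [hn s hs]
  have : (n * (2 * π * Complex.I) : ℂ) = 2 * π * k * Complex.I := by
    rw [CalabiRadial.deck] at h0
    exact (add_left_cancel h0).symm
  rw [this, CalabiRadial.deck]

theorem IsLiftedIsotopy.crossing_sum {g gt : ℝ → ℂ → ℂ} {f : ℂ → ℂ}
    (hg : IsIdentityIsotopyStar g f) (h : IsLiftedIsotopy g gt) {ζ ζ' : ℂ} (hζ : ζ ∈ cover)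
    (hζ' : ζ' ∈ cover) (hne : Complex.exp ζ ≠ Complex.exp ζ') {θh : ℤ → ℝ → ℤ}
    (hθ : ∀ k, IsThetaLift F gt ζ (CalabiRadial.deck k ζ') (θh k)) :
    (Function.support fun k => crossing (θh k 0) (θh k 1)).Finite ∧
      ∑ᶠ k : ℤ, crossing (θh k 0) (θh k 1) =
        angleVariation (fun s => 1 - g s (Complex.exp ζ') / g s (Complex.exp ζ)) -
          (F.beta (f (Complex.exp ζ)) (f (Complex.exp ζ')) -
            F.beta (Complex.exp ζ) (Complex.exp ζ')) := by
  have hz := exp_mem_diskStar.2 hζ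
  have hz' := exp_mem_diskStar.2 hζ'
  have h1 := F.finsum_crossing_eq (θh := θh) (h.continuousOn_path hζ) (h.continuousOn_path hζ')
    (fun s hs => h.mapsTo s hs hζ) (fun s hs => h.mapsTo s hs hζ')
    (fun s hs => by rw [h.lift s hs _ hζ, h.lift s hs _ hζ']; exact hg.ne hs hz hz' hne)
    (fun k => (hθ k).1) (fun k s hs => by rw [(hθ k).2 s hs, h.deck hζ' k hs])
  rwa [h.lift 1 (by simp) _ hζ, h.lift 1 (by simp) _ hζ', h.start _ hζ, h.start _ hζ',
    hg.finish _ hz, hg.finish _ hz',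
    angleVariation_congr (δ := fun s => 1 - g s (Complex.exp ζ') / g s (Complex.exp ζ))
      (fun s hs => by simp only [h.lift s hs _ hζ, h.lift s hs _ hζ'])] at h1

/-- The function `λ` is the variation of the angle of `1 - z'/z` up to the coboundary of `beta`. -/
theorem lam_eq {g gt : ℝ → ℂ → ℂ} {f : ℂ → ℂ} (hg : IsIdentityIsotopyStar g f)
    (h : IsLiftedIsotopy g gt) {z z' : ℂ} (hz : z ∈ diskStar) (hz' : z' ∈ diskStar) (hne : z ≠ z') :
    lam F f z z' = angleVariation (fun s => 1 - g s z' / g s z) -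
      (F.beta (f z) (f z') - F.beta z z') := by
  have hex : ∃ v, IsLambdaValue F f z z' v := by
    have e := Complex.exp_log (ne_zero_of_mem_diskStar hz)
    have e' := Complex.exp_log (ne_zero_of_mem_diskStar hz')
    have hζ := log_mem_cover hz
    have hζ' := log_mem_cover hz'
    have hlift : ∀ k : ℤ, ∃ θh, IsThetaLift F gt (Complex.log z) (deck k (Complex.log z')) θh :=
      fun k => by
        have hk : deck k (Complex.log z') ∈ cover := deck_mem_cover.2 hζ'
        exact F.exists_theta_lift (h.continuousOn_path hζ) (h.continuousOn_path hk)
          (fun s hs => h.mapsTo s hs hζ) (fun s hs => h.mapsTo s hs hk)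
          (fun s hs => by
            rw [h.lift s hs _ hζ, h.lift s hs _ hk, exp_deck, e, e']; exact hg.ne hs hz hz' hne)
    choose θh hθ using hlift
    exact ⟨_, g, gt, hg, h, _, hζ, _, hζ', e, e', θh, hθ,
      (h.crossing_sum hg hζ hζ' (by rwa [e, e']) hθ).1, rfl⟩
  rw [lam, dif_pos hex]
  obtain ⟨g', gt', hg', h', ζ, hζ, ζ', hζ', e, e', θh, hθ, -, hv⟩ := hex.choose_spec
  rw [hv, (h'.crossing_sum hg' hζ hζ' (by rwa [e, e']) hθ).2, e, e',
    hg'.angleVariation_eq hg hz hz' hne]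

/-! ### The displacement function -/

/-- A half-open strip in terms of the order of the leaves. -/
theorem RadialFoliation.mem_strip_iff {η : ℂ} (hη : η ∈ cover) {ζ : ℂ} {k : ℤ} :
    ζ ∈ strip (F.liftedLeaf η) k ↔
      ζ ∈ cover ∧ ¬ F.Below ζ (deck k η) ∧ F.Below ζ (deck (k + 1) η) := by
  have hk := deck_mem_cover (k := k).2 hη
  have hk1 := deck_mem_cover (k := k + 1).2 hη
  rw [strip, ← F.liftedLeaf_deck k hη, ← F.liftedLeaf_deck (k + 1) hη, leftSide_eq, rightSide_eq]
  obtain ⟨γ, t, hγ, ht, e⟩ := F.exists_curve_eq hk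
  constructor
  · rintro ⟨h1, h2⟩
    refine ⟨h2.1.1, fun hb => ?_, ⟨hk1, h2⟩⟩
    have hb2 := hb.2
    rw [e] at h1 hb2
    obtain ⟨w, hw, hw'⟩ := mem_closure_iff.1 h1 _ (hγ.1.isOpen_side (by simp)) hb2
    exact Set.disjoint_left.1 hγ.1.disjoint_sides hw' hw
  · rintro ⟨h1, h2, h3⟩
    refine ⟨?_, h3.2⟩
    by_cases hm : ζ ∈ F.liftedLeaf (deck k η)
    · rw [e] at hm ⊢
      obtain ⟨s, rfl⟩ := hm
      exact hγ.subset_closure_side (by simp) s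
    · exact subset_closure (below_iff.1 ((F.below_or hk h1 hm).resolve_right h2)).2

theorem RadialFoliation.exists_below_deck (F : RadialFoliation) {η ζ : ℂ} (hη : η ∈ cover)
    (hζ : ζ ∈ cover) : ∃ N : ℕ, F.Below ζ (deck N η) ∧ F.Below (deck (-N) η) ζ := by
  obtain ⟨γ, t, hγ, rfl, e⟩ := F.exists_curve_eq hη
  obtain ⟨M, hM0, hM⟩ := hγ.1.exists_mem_side (σ := -1) (by simp) ζ.re hζ
  obtain ⟨M', hM0', hM'⟩ := hγ.1.exists_mem_side (σ := 1) (by simp) ζ.re hζ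
  obtain ⟨N, hN⟩ := exists_nat_gt (max (M + ζ.im) (M' - ζ.im))
  have hπ := Real.pi_gt_three
  have hle : (N : ℝ) ≤ 2 * π * N := le_mul_of_one_le_left N.cast_nonneg (by linarith)
  have h1 := (le_max_left _ _).trans_lt hN
  have h2 := (le_max_right _ _).trans_lt hN
  refine ⟨N, ?_, ?_⟩
  · have := (below_deck_iff (F := F) (ζ := deck (-N) ζ) (ζ' := γ t) N).2
      ⟨hη, by
        rw [e]
        refine hM _ (by simp [deck_re]) ?_
        rw [deck_im]
        push_cast
        linarith⟩
    simpa [deck_deck] using this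
  · have := (below_deck_iff (F := F) (ζ := γ t) (ζ' := deck N ζ) (-N)).2
      (below_iff.2 ⟨hη, by
        rw [e]
        refine hM' _ (by simp [deck_re]) ?_
        rw [deck_im]
        push_cast
        linarith⟩)
    simpa [deck_deck] using this

theorem RadialFoliation.exists_strip (F : RadialFoliation) {η ζ : ℂ} (hη : η ∈ cover)
    (hζ : ζ ∈ cover) : ∃ k, ζ ∈ strip (F.liftedLeaf η) k := by
  obtain ⟨N, h1, h2⟩ := F.exists_below_deck hη hζ
  obtain ⟨k, hk, hmin⟩ := Int.exists_least_of_bdd (P := fun k => F.Below ζ (deck k η))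
    ⟨-N, fun k hk => by
      by_contra hlt
      exact h2.not_symm (hk.trans (F.below_deck_of_lt hη (not_le.1 hlt)))⟩ ⟨N, h1⟩
  refine ⟨k - 1, (mem_strip_iff hη).2 ⟨hζ, fun h => ?_, by rwa [sub_add_cancel]⟩⟩
  have := hmin _ h
  omega

theorem RadialFoliation.strip_unique {η ζ : ℂ} (hη : η ∈ cover) {j k : ℤ}
    (hj : ζ ∈ strip (F.liftedLeaf η) j) (hk : ζ ∈ strip (F.liftedLeaf η) k) : j = k := by
  rw [mem_strip_iff hη] at hj hk
  have key : ∀ {j k : ℤ}, F.Below ζ (deck (j + 1) η) → ¬ F.Below ζ (deck k η) → k ≤ j := by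
    intro j k h h'
    by_contra hlt
    rcases F.below_deck_or_eq hη (show j + 1 ≤ k by omega) with h1 | h1
    · exact h' (h.trans h1)
    · exact h' (h1 ▸ h)
  exact le_antisymm (key hk.2.2 hj.2.1) (key hj.2.2 hk.2.1)

theorem RadialFoliation.mem_strip_deck_iff {η ζ : ℂ} (hη : η ∈ cover) {k j : ℤ} :
    deck j ζ ∈ strip (F.liftedLeaf η) k ↔ ζ ∈ strip (F.liftedLeaf η) (k - j) := by
  have e : ∀ l, F.Below (deck j ζ) (deck l η) ↔ F.Below ζ (deck (l - j) η) := fun l => by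
    rw [← below_deck_iff (ζ := ζ) j, deck_deck, add_sub_cancel]
  rw [mem_strip_iff hη, mem_strip_iff hη, deck_mem_cover, e, e, add_sub_right_comm]

theorem RadialFoliation.mem_strip_congr {η η' ζ : ℂ} (hη : η ∈ cover) {k j : ℤ}
    (h : η' ∈ F.liftedLeaf η) :
    ζ ∈ strip (F.liftedLeaf (deck j η')) k ↔ ζ ∈ strip (F.liftedLeaf η) (k + j) := by
  have hη' := F.liftedLeaf_subset _ h
  rw [← F.liftedLeaf_eq_of_mem hη h, mem_strip_iff (deck_mem_cover.2 hη'), mem_strip_iff hη',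
    deck_deck, deck_deck, add_right_comm]

open Classical in
/-- The index of the strip, relative to the lifted leaf through `η`, that contains `ζ`. -/
def RadialFoliation.stripIndex (F : RadialFoliation) (η ζ : ℂ) : ℤ :=
  if h : ∃ k, ζ ∈ strip (F.liftedLeaf η) k then h.choose else 0

theorem RadialFoliation.stripIndex_eq_iff {η ζ : ℂ} (hη : η ∈ cover) (hζ : ζ ∈ cover) {k : ℤ} :
    F.stripIndex η ζ = k ↔ ζ ∈ strip (F.liftedLeaf η) k := by
  have h := F.exists_strip hη hζ
  rw [stripIndex, dif_pos h]
  exact ⟨fun e => e ▸ h.choose_spec, fun hk => strip_unique hη h.choose_spec hk⟩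

theorem RadialFoliation.stripIndex_deck {η ζ : ℂ} (hη : η ∈ cover) (hζ : ζ ∈ cover) (j : ℤ) :
    F.stripIndex η (deck j ζ) = F.stripIndex η ζ + j := by
  rw [stripIndex_eq_iff hη (deck_mem_cover.2 hζ), mem_strip_deck_iff hη, add_sub_cancel_right,
    ← stripIndex_eq_iff hη hζ]

theorem RadialFoliation.measurable_stripIndex (F : RadialFoliation) {η : ℂ} (hη : η ∈ cover) :
    Measurable (F.stripIndex η) := by
  refine measurable_to_countable' fun n => ?_
  have hset : F.stripIndex η ⁻¹' {n} =
      (cover ∩ ({ζ | F.Below ζ (deck n η)}ᶜ ∩ {ζ | F.Below ζ (deck (n + 1) η)})) ∪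
        (coverᶜ ∩ {_ζ | n = 0}) := by
    ext ζ
    by_cases hζ : ζ ∈ cover
    · simp [stripIndex_eq_iff hη hζ, mem_strip_iff hη, hζ]
    · have : ¬ ∃ k, ζ ∈ strip (F.liftedLeaf η) k := fun ⟨k, hk⟩ => hζ ((mem_strip_iff hη).1 hk).1
      simp [stripIndex, this, hζ, eq_comm]
  rw [hset]
  exact (isOpen_cover.measurableSet.inter ((F.isOpen_below_left _).measurableSet.compl.inter
    (F.isOpen_below_left _).measurableSet)).union
      (isOpen_cover.measurableSet.compl.inter (MeasurableSet.const _))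

/-- The strip index corrected by the argument: a function on the punctured disk. -/
def RadialFoliation.sheet (F : RadialFoliation) (η z : ℂ) : ℝ :=
  F.stripIndex η (Complex.log z) - (Complex.log z).im / (2 * π)

theorem RadialFoliation.sheet_exp {η ζ : ℂ} (hη : η ∈ cover) (hζ : ζ ∈ cover) :
    F.sheet η (Complex.exp ζ) = F.stripIndex η ζ - ζ.im / (2 * π) := by
  have hz := exp_mem_diskStar.2 hζ
  obtain ⟨k, hk⟩ := exists_deck_of_exp_eq (Complex.exp_log (ne_zero_of_mem_diskStar hz)).symm
  rw [sheet]
  set ζ₀ := Complex.log (Complex.exp ζ)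
  have h0 : ζ₀ ∈ cover := log_mem_cover hz
  rw [hk, stripIndex_deck hη h0, deck_im]
  push_cast
  field_simp
  ring

theorem RadialFoliation.measurable_sheet (F : RadialFoliation) {η : ℂ} (hη : η ∈ cover) :
    Measurable (F.sheet η) := by
  have h1 : Measurable fun z => (F.stripIndex η (Complex.log z) : ℝ) :=
    (measurable_from_top (f := fun n : ℤ => (n : ℝ))).comp
      ((F.measurable_stripIndex hη).comp Complex.measurable_log)
  exact h1.sub ((Complex.measurable_im.comp Complex.measurable_log).div_const _)

/-- The displacement is the angular displacement of the lift up to the coboundary of the sheet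
function. -/
theorem displacement_eq {φ : Set ℂ} (hφ : φ ∈ F.leaves) {η : ℂ} (hη : η ∈ cover)
    (hηφ : Complex.exp η ∈ φ) {f ft : ℂ → ℂ} (hft : MapsTo ft cover cover)
    (hlift : ∀ ζ ∈ cover, Complex.exp (ft ζ) = f (Complex.exp ζ))
    (hdeck : ∀ ζ ∈ cover, ∀ k, ft (deck k ζ) = deck k (ft ζ)) {ζ : ℂ} (hζ : ζ ∈ cover) :
    (displacement ft φ (Complex.exp ζ) : ℝ) = ((ft ζ).im - ζ.im) / (2 * π) +
      (F.sheet η (f (Complex.exp ζ)) - F.sheet η (Complex.exp ζ)) := by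
  obtain ⟨γ, t, hγ, rfl, e⟩ := F.exists_curve_eq hη
  have hγφ : (range fun t => Complex.exp (γ t)) = φ := F.leaf_unique hγ.2 hφ ⟨t, rfl⟩ hηφ
  have hval : ∀ m, IsDisplacement ft φ (Complex.exp ζ) m →
      m = F.stripIndex (γ t) (ft ζ) - F.stripIndex (γ t) ζ := by
    rintro m ⟨φt, hφt, ζ₀, he, h0, hm⟩
    obtain ⟨δ, hδ, rfl⟩ := hφt.exists_curve hφ
    obtain ⟨-, -, -, hδφ⟩ := hφt
    obtain ⟨s, hs⟩ : Complex.exp (δ 0) ∈ range fun t => Complex.exp (γ t) := by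
      rw [hγφ, ← hδφ]
      exact mem_image_of_mem _ (mem_range_self 0)
    obtain ⟨j, hj⟩ := exists_deck_of_exp_eq (Eq.symm hs)
    have hsl : γ s ∈ F.liftedLeaf (γ t) := by rw [e]; exact mem_range_self s
    rw [← hδ.liftedLeaf_eq 0, hj, RadialFoliation.mem_strip_congr hη hsl] at h0 hm
    obtain ⟨k, rfl⟩ := exists_deck_of_exp_eq he
    have hc := hft hζ
    rw [hdeck ζ hζ, ← RadialFoliation.stripIndex_eq_iff hη (deck_mem_cover.2 hc), RadialFoliation.stripIndex_deck hη hc] at hm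
    rw [← RadialFoliation.stripIndex_eq_iff hη (deck_mem_cover.2 hζ), RadialFoliation.stripIndex_deck hη hζ] at h0
    omega
  have hex : ∃ m, IsDisplacement ft φ (Complex.exp ζ) m := by
    obtain ⟨k, hk⟩ := F.exists_strip hη hζ
    have hl := hγ.isLiftOfRay
    rw [hγφ, ← e] at hl
    obtain ⟨m, hm⟩ := F.exists_strip hη (hft (deck_mem_cover (k := -k).2 hζ))
    exact ⟨m, _, hl, deck (-k) ζ, exp_deck _ _, (RadialFoliation.mem_strip_deck_iff hη).2 (by simpa using hk), hm⟩
  rw [displacement, dif_pos hex, hval _ hex.choose_spec, ← hlift ζ hζ, RadialFoliation.sheet_exp hη hζ,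
    RadialFoliation.sheet_exp hη (hft hζ)]
  push_cast
  ring

/-! ### The decomposition of `Λ` -/

/-- The angular function of an isotopy that fixes `0`, computed with the lifted isotopy. -/
theorem ang_eq_of_lift {J Jt : ℝ → ℂ → ℂ} {f : ℂ → ℂ} (hJ : IsIdentityIsotopyStar J f)
    (hJt : IsLiftedIsotopy J Jt) {ζ : ℂ} (hζ : ζ ∈ cover) {z' : ℂ} (hz' : z' ∈ diskStar)
    (hne : Complex.exp ζ ≠ z') :
    ang J (Complex.exp ζ) z' = ((Jt 1 ζ).im - ζ.im) / (2 * π) +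
      angleVariation (fun s => 1 - J s z' / J s (Complex.exp ζ)) := by
  have hz := exp_mem_diskStar.2 hζ
  have hJz : ∀ s ∈ Icc (0 : ℝ) 1, J s (Complex.exp ζ) ≠ 0 := fun s hs =>
    ne_zero_of_mem_diskStar ((hJ.bijOn s hs).mapsTo hz)
  have hcont : ∀ w ∈ diskStar, ContinuousOn (fun s => J s w) (Icc 0 1) := fun w hw =>
    hJ.continuousOn.comp (f := fun s => (s, w)) (by fun_prop) fun x hx => ⟨hx, hw⟩
  have h1 := angleVariation_mul (γ := fun s => -J s (Complex.exp ζ))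
    (δ := fun s => 1 - J s z' / J s (Complex.exp ζ)) (hcont _ hz).neg
    (fun s hs => neg_ne_zero.2 (hJz s hs))
    (continuousOn_const.sub ((hcont _ hz').div (hcont _ hz) hJz))
    (fun s hs => one_sub_div_ne_zero (hJz s hs) (hJ.ne hs hz hz' hne).symm)
  have h2 : angleVariation (fun s => -J s (Complex.exp ζ)) = ((Jt 1 ζ).im - ζ.im) / (2 * π) := by
    rw [angleVariation_of_log (L := fun s => Jt s ζ + π * Complex.I)
      ((hJt.continuousOn_path hζ).add continuousOn_const)
      (fun s hs => by rw [Complex.exp_add, Complex.exp_pi_mul_I, hJt.lift s hs _ hζ, mul_neg_one])]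
    simp [hJt.start _ hζ]
  rw [← h2, ← h1]
  refine angleVariation_congr fun s hs => ?_
  have := hJz s hs
  field_simp
  ring

/-- `Λ` is cohomologous to the angular function: the coboundary is that of `beta` minus the sheet
function. -/
theorem Lam_eq {J Jt : ℝ → ℂ → ℂ} {f ft : ℂ → ℂ} (hJ : IsIdentityIsotopyStar J f)
    (hJt : IsLiftedIsotopy J Jt) (hft : ∀ ζ ∈ cover, ft ζ = Jt 1 ζ) {φ : Set ℂ} (hφ : φ ∈ F.leaves)
    {η : ℂ} (hη : η ∈ cover) (hηφ : Complex.exp η ∈ φ) {z z' : ℂ} (hz : z ∈ diskStar)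
    (hz' : z' ∈ diskStar) (hne : z ≠ z') :
    Lam F φ f ft z z' = ang J z z' + ((F.beta z z' - F.sheet η z) -
      (F.beta (f z) (f z') - F.sheet η (f z))) := by
  have hζ := log_mem_cover hz
  have e := Complex.exp_log (ne_zero_of_mem_diskStar hz)
  have h1 := displacement_eq (f := f) (ft := ft) hφ hη hηφ
    (fun ζ hζ => by rw [hft ζ hζ]; exact hJt.mapsTo 1 (by simp) hζ)
    (fun ζ hζ => by
      rw [hft ζ hζ, hJt.lift 1 (by simp) _ hζ, hJ.finish _ (exp_mem_diskStar.2 hζ)])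
    (fun ζ hζ k => by
      rw [hft ζ hζ, hft _ (deck_mem_cover.2 hζ), hJt.deck hζ k (by simp)]) hζ
  have h2 := ang_eq_of_lift hJ hJt hζ hz' (by rwa [e])
  rw [e] at h1 h2
  rw [Lam, h1, h2, lam_eq hJ hJt hz hz' hne, hft _ hζ]
  ring

/-! ### Symplectic diffeomorphisms preserve the area -/

theorem measurableSet_disk : MeasurableSet disk := Metric.isClosed_closedBall.measurableSet

theorem convex_disk : Convex ℝ disk := convex_closedBall 0 1

theorem uniqueDiffOn_disk : UniqueDiffOn ℝ disk := by
  refine uniqueDiffOn_convex convex_disk ⟨0, ?_⟩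
  rw [disk, interior_closedBall _ one_ne_zero]
  simp

/-- The circle and the centre are negligible. -/
theorem muOmega_eq : muOmega = (volume : Measure ℂ).restrict disk := by
  refine Measure.restrict_congr_set ?_
  refine diskStar_subset_disk.eventuallyLE.antisymm ?_
  rw [ae_le_set]
  refine measure_mono_null (t := Metric.sphere 0 1 ∪ {0}) (fun z ⟨h1, h2⟩ => ?_) ?_
  · rw [mem_disk_iff] at h1
    by_contra hn
    simp only [mem_union, mem_sphere_iff_norm, sub_zero, mem_singleton_iff, not_or] at hn
    exact h2 ⟨norm_pos_iff.2 hn.2, h1.lt_of_ne hn.1⟩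
  · exact measure_union_null (Measure.addHaar_sphere _ _ _) (measure_singleton _)

instance : IsFiniteMeasure muOmega := by
  rw [muOmega_eq]
  exact ⟨by rw [Measure.restrict_apply_univ]; exact isCompact_disk.measure_lt_top⟩

theorem det_eq_omega (L : ℂ →L[ℝ] ℂ) : L.det = omega (L 1) (L Complex.I) := by
  rw [ContinuousLinearMap.det, ← LinearMap.det_toMatrix Complex.basisOneI, Matrix.det_fin_two]
  simp [LinearMap.toMatrix_apply, omega]
  ring

theorem IsSymplecticDiffeo.hasFDerivWithinAt {f : ℂ → ℂ} (hf : IsSymplecticDiffeo f) {z : ℂ}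
    (hz : z ∈ disk) : HasFDerivWithinAt f (fderivWithin ℝ f disk z) disk z :=
  ((hf.contDiffOn.differentiableOn one_ne_zero) z hz).hasFDerivWithinAt

theorem IsSymplecticDiffeo.det_eq_one {f : ℂ → ℂ} (hf : IsSymplecticDiffeo f) {z : ℂ}
    (hz : z ∈ disk) : (fderivWithin ℝ f disk z).det = 1 := by
  rw [det_eq_omega, hf.symplectic z hz]
  simp [omega]

open Classical in
/-- A self-map of the disk, extended by the identity to the plane. -/
def extend (f : ℂ → ℂ) : ℂ → ℂ := disk.piecewise f id

theorem extend_eqOn (f : ℂ → ℂ) : EqOn (extend f) f disk := fun _ hz => by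
  simp [extend, hz]

theorem measurable_extend {f : ℂ → ℂ} (hf : ContinuousOn f disk) : Measurable (extend f) := by
  classical
  exact hf.measurable_piecewise continuousOn_id measurableSet_disk

theorem IsSymplecticDiffeo.measurePreserving {f : ℂ → ℂ} (hf : IsSymplecticDiffeo f) :
    MeasurePreserving (extend f) muOmega muOmega := by
  refine ⟨measurable_extend hf.contDiffOn.continuousOn, ?_⟩
  rw [muOmega_eq]
  have h1 := map_withDensity_abs_det_fderiv_eq_addHaar (volume : Measure ℂ) (s := disk)
    (f := extend f) (f' := fderivWithin ℝ f disk) measurableSet_disk.nullMeasurableSet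
    (fun z hz => (hf.hasFDerivWithinAt hz).congr (extend_eqOn f) (extend_eqOn f hz))
    (hf.bijOn.injOn.congr (extend_eqOn f).symm)
  rw [(hf.bijOn.congr (extend_eqOn f).symm).image_eq, withDensity_congr_ae (g := 1)] at h1
  · rwa [withDensity_one] at h1
  · filter_upwards [ae_restrict_mem measurableSet_disk] with z hz
    rw [hf.det_eq_one hz]
    simp

theorem ae_mem_disk : ∀ᵐ z ∂muOmega, z ∈ disk := by
  rw [muOmega_eq]
  exact ae_restrict_mem measurableSet_disk

theorem measure_diagonal : (muOmega.prod muOmega) {p : ℂ × ℂ | p.1 = p.2} = 0 := by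
  have hm : MeasurableSet {p : ℂ × ℂ | p.1 = p.2} := (isClosed_eq continuous_fst continuous_snd).measurableSet
  rw [Measure.measure_prod_null hm]
  have hz : ∀ z : ℂ, muOmega {z} = 0 := fun z => by rw [muOmega_eq]; exact measure_singleton z
  refine Eventually.of_forall fun z => ?_
  refine measure_mono_null (t := {z}) (fun w hw => ?_) (hz z)
  exact Eq.symm hw

theorem restrict_pairs : (muOmega.prod muOmega).restrict pairs = muOmega.prod muOmega := by
  have h : pairs = (diskStar ×ˢ diskStar) ∩ {p : ℂ × ℂ | p.1 = p.2}ᶜ := by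
    ext p
    simp [pairs, and_assoc]
  rw [h]
  have h2 : (muOmega.prod muOmega).restrict ((diskStar ×ˢ diskStar) ∩ {p : ℂ × ℂ | p.1 = p.2}ᶜ) =
      (muOmega.prod muOmega).restrict (diskStar ×ˢ diskStar) :=
    Measure.restrict_congr_set (inter_ae_eq_left_of_ae_eq_univ
      (ae_eq_univ.2 (by rw [compl_compl]; exact measure_diagonal)))
  rw [h2, muOmega, Measure.prod_restrict, Measure.restrict_restrict
    (isOpen_diskStar.measurableSet.prod isOpen_diskStar.measurableSet), inter_self]

theorem ae_mem_pairs : ∀ᵐ p ∂(muOmega.prod muOmega), p ∈ pairs := by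
  rw [← restrict_pairs]
  exact ae_restrict_mem isOpen_pairs.measurableSet

theorem calabi_eq_integral (I : ℝ → ℂ → ℂ) :
    calabi I = ∫ p, ang I p.1 p.2 ∂(muOmega.prod muOmega) := by
  rw [calabi, muOmega_eq, Measure.prod_restrict]
  congr 1
  refine Measure.restrict_congr_set ?_
  have h : {p : ℂ × ℂ | p.1 ∈ disk ∧ p.2 ∈ disk ∧ p.1 ≠ p.2} =
      (disk ×ˢ disk) ∩ {p : ℂ × ℂ | p.1 = p.2}ᶜ := by
    ext p
    simp [and_assoc]
  rw [h]
  refine inter_subset_left.eventuallyLE.antisymm ?_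
  rw [ae_le_set]
  have := measure_diagonal
  rw [muOmega_eq, Measure.prod_restrict, Measure.restrict_apply
    (isClosed_eq continuous_fst continuous_snd).measurableSet] at this
  refine measure_mono_null (fun p hp => ?_) this
  exact ⟨by_contra fun h => hp.2 ⟨hp.1, h⟩, hp.1⟩

/-! ### Coboundaries have mean zero -/

/-- An integrable coboundary has integral zero, even when the transfer function is not
integrable. -/
theorem integral_coboundary {X : Type*} [MeasurableSpace X] {μ : Measure X} [IsFiniteMeasure μ]
    {T : X → X} (hT : MeasurePreserving T μ μ) {U : X → ℝ} (hU : AEMeasurable U μ)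
    (h : Integrable (fun x => U x - U (T x)) μ) : ∫ x, (U x - U (T x)) ∂μ = 0 := by
  -- Truncate `U` at height `N`: the truncations are `1`-Lipschitz, so `|U - U ∘ T|` dominates.
  set c : ℕ → ℝ → ℝ := fun N x => max (-(N : ℝ)) (min N x) with hc
  have hcm : ∀ N, Measurable (c N) := fun N => by
    simp only [hc]
    fun_prop
  have hint : ∀ N, Integrable (fun x => c N (U x)) μ := fun N => by
    refine Integrable.of_bound ((hcm N).comp_aemeasurable hU).aestronglyMeasurable N
      (Eventually.of_forall fun x => ?_)
    rw [Real.norm_eq_abs, abs_le]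
    exact ⟨le_max_left _ _, max_le (by linarith [N.cast_nonneg (α := ℝ)]) (min_le_left _ _)⟩
  have hint' : ∀ N, Integrable (fun x => c N (U (T x))) μ := fun N =>
    (hT.integrable_comp (hint N).aestronglyMeasurable).2 (hint N)
  have hzero : ∀ N, ∫ x, (c N (U x) - c N (U (T x))) ∂μ = 0 := fun N => by
    rw [integral_sub (hint N) (hint' N), sub_eq_zero]
    have h1 := integral_map hT.measurable.aemeasurable (f := fun x => c N (U x))
      (by rw [hT.map_eq]; exact (hint N).aestronglyMeasurable)
    rw [hT.map_eq] at h1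
    exact h1
  have hlim : Tendsto (fun N => ∫ x, (c N (U x) - c N (U (T x))) ∂μ) atTop
      (𝓝 (∫ x, (U x - U (T x)) ∂μ)) := by
    refine tendsto_integral_of_dominated_convergence (fun x => |U x - U (T x)|)
      (fun N => ((hint N).sub (hint' N)).aestronglyMeasurable) h.abs
      (fun N => Eventually.of_forall fun x => ?_) (Eventually.of_forall fun x => ?_)
    · rw [Real.norm_eq_abs]
      exact (abs_max_sub_max_le_max _ _ _ _).trans
        (max_le (by simp) ((abs_min_sub_min_le_max _ _ _ _).trans (max_le (by simp) le_rfl)))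
    · have key : ∀ y : ℝ, Tendsto (fun N => c N y) atTop (𝓝 y) := fun y => by
        obtain ⟨M, hM⟩ := exists_nat_ge |y|
        refine tendsto_const_nhds.congr' ?_
        filter_upwards [eventually_ge_atTop M] with N hN
        have h1 : |y| ≤ N := hM.trans (by exact_mod_cast hN)
        rw [abs_le] at h1
        simp only [hc, min_eq_right h1.2, max_eq_right h1.1]
      exact (key _).sub (key _)
  simp only [hzero] at hlim
  exact tendsto_nhds_unique hlim tendsto_const_nhds |>.symm ▸ rfl

/-! ### The angular function is bounded -/

section

variable {J : ℝ → ℂ → ℂ} {f : ℂ → ℂ} (hJ : IsIdentityIsotopy J f)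
include hJ

theorem IsIdentityIsotopy.ne {s : ℝ} (hs : s ∈ Icc (0 : ℝ) 1) {a b : ℂ} (ha : a ∈ disk)
    (hb : b ∈ disk) (h : a ≠ b) : J s a ≠ J s b := fun he => h ((hJ.bijOn s hs).injOn ha hb he)

theorem IsIdentityIsotopy.continuousOn_path {z : ℂ} (hz : z ∈ disk) :
    ContinuousOn (fun s => J s z) (Icc 0 1) :=
  hJ.continuousOn.comp (f := fun s => (s, z)) (by fun_prop) fun _ hx => ⟨hx, hz⟩

/-- The angular function is bounded on the pairs of opposite points of the circle. -/
theorem IsIdentityIsotopy.exists_bound_ang_antipodal :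
    ∃ N : ℕ, ∀ u : ℂ, ‖u‖ = 1 → |ang J (-u) u| ≤ N := by
  have hS : IsCompact (Icc (0 : ℝ) 1 ×ˢ Metric.sphere (0 : ℂ) 1) :=
    isCompact_Icc.prod (isCompact_sphere 0 1)
  have hd : ∀ u ∈ Metric.sphere (0 : ℂ) 1, u ∈ disk ∧ -u ∈ disk ∧ -u ≠ u := fun u hu => by
    have hu : ‖u‖ = 1 := by simpa using hu
    refine ⟨mem_disk_iff.2 hu.le, mem_disk_iff.2 (by rw [norm_neg, hu]), fun he => ?_⟩
    rw [neg_eq_self.1 he, norm_zero] at hu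
    exact zero_ne_one hu
  have hG : ContinuousOn (fun p : ℝ × ℂ => J p.1 p.2 - J p.1 (-p.2))
      (Icc (0 : ℝ) 1 ×ˢ Metric.sphere (0 : ℂ) 1) :=
    (hJ.continuousOn.mono (prod_mono le_rfl Metric.sphere_subset_closedBall)).sub
      (hJ.continuousOn.comp (f := fun p : ℝ × ℂ => (p.1, -p.2)) (by fun_prop)
        fun p hp => ⟨hp.1, (hd _ hp.2).2.1⟩)
  obtain ⟨p₀, hp₀, hmin⟩ := hS.exists_isMinOn ⟨((0 : ℝ), (1 : ℂ)), by simp⟩ hG.norm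
  have hpos : 0 < ‖J p₀.1 p₀.2 - J p₀.1 (-p₀.2)‖ := norm_pos_iff.2 (sub_ne_zero.2
    (hJ.ne hp₀.1 (hd _ hp₀.2).1 (hd _ hp₀.2).2.1 (hd _ hp₀.2).2.2.symm))
  obtain ⟨δ, hδ, hu⟩ := Metric.uniformContinuousOn_iff.1
    (hS.uniformContinuousOn_of_continuous hG) _ hpos
  obtain ⟨N, hN⟩ := exists_nat_one_div_lt hδ
  refine ⟨N + 1, fun u hu1 => ?_⟩
  have hum : u ∈ Metric.sphere (0 : ℂ) 1 := by simpa using hu1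
  refine abs_angleVariation_le ((hJ.continuousOn_path (hd u hum).1).sub
    (hJ.continuousOn_path (hd u hum).2.1)) (N + 1) (by omega) fun s hs t ht hst => ?_
  have h1 := hu (s, u) ⟨hs, hum⟩ (t, u) ⟨ht, hum⟩ (by
    rw [Prod.dist_eq, dist_self, max_eq_left dist_nonneg, Real.dist_eq]
    push_cast at hst
    exact hst.trans_lt hN)
  rw [dist_eq_norm] at h1
  exact h1.trans_le (isMinOn_iff.1 hmin (s, u) ⟨hs, hum⟩)

end

/-- The difference quotients of a `C¹` diffeomorphism turn a bounded number of times along the path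
of pairs that spreads two points apart. -/
theorem IsSymplecticDiffeo.exists_bound_quotient {f : ℂ → ℂ} (hf : IsSymplecticDiffeo f) :
    ∃ N : ℕ, ∀ (a : ℝ → ℂ) (δ : ℝ → ℝ) (u : ℂ), ‖u‖ = 1 → Continuous a → Continuous δ →
      (∀ r ∈ Icc (0 : ℝ) 1, a r ∈ disk ∧ a r + δ r * u ∈ disk ∧ 0 < δ r) →
      (∀ r ∈ Icc (0 : ℝ) 1, ∀ t ∈ Icc (0 : ℝ) 1, ‖a r - a t‖ ≤ 2 * |r - t| ∧
        |δ r - δ t| ≤ 2 * |r - t|) →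
      |angleVariation fun r => f (a r + δ r * u) - f (a r)| ≤ N := by
  -- The inverse is Lipschitz, so the difference quotients are bounded away from `0`.
  obtain ⟨L, hL0, hL⟩ : ∃ L > 0, ∀ z ∈ disk, ∀ w ∈ disk, ‖w - z‖ ≤ L * ‖f w - f z‖ := by
    obtain ⟨g, hgf, hg⟩ := hf.contDiffOn_inv
    obtain ⟨C, hC⟩ := isCompact_disk.exists_bound_of_continuousOn
      (hg.continuousOn_fderivWithin uniqueDiffOn_disk le_rfl)
    refine ⟨max C 1, lt_max_of_lt_right one_pos, fun z hz w hw => ?_⟩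
    have := convex_disk.norm_image_sub_le_of_norm_fderivWithin_le (𝕜 := ℝ) (C := max C 1)
      (hg.differentiableOn one_ne_zero) (fun x hx => (hC x hx).trans (le_max_left _ _))
      (hf.bijOn.mapsTo hz) (hf.bijOn.mapsTo hw)
    rwa [hgf.1 hz, hgf.1 hw] at this
  have huc := isCompact_disk.uniformContinuousOn_of_continuous
    (hf.contDiffOn.continuousOn_fderivWithin uniqueDiffOn_disk le_rfl)
  obtain ⟨d, hd, hud⟩ := Metric.uniformContinuousOn_iff.1 huc (1 / (2 * L)) (by positivity)
  obtain ⟨N, hN⟩ := exists_nat_one_div_lt (show 0 < d / 4 by positivity)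
  refine ⟨N + 1, fun a δ u hu ha hδ hmem hlip => ?_⟩
  have hfc := hf.contDiffOn.continuousOn
  have hwc : ContinuousOn (fun r => f (a r + δ r * u) - f (a r)) (Icc 0 1) :=
    (hfc.comp (f := fun r => a r + δ r * u) (by fun_prop) fun r hr => (hmem r hr).2.1).sub
      (hfc.comp ha.continuousOn fun r hr => (hmem r hr).1)
  have hδc : ContinuousOn (fun r => (δ r : ℂ)) (Icc 0 1) := by fun_prop
  have hδ0 : ∀ r ∈ Icc (0 : ℝ) 1, (δ r : ℂ) ≠ 0 := fun r hr => by
    exact_mod_cast (hmem r hr).2.2.ne'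
  set Q : ℝ → ℂ := fun r => (f (a r + δ r * u) - f (a r)) / δ r with hQ
  have hQc : ContinuousOn Q (Icc 0 1) := hwc.div hδc hδ0
  have hQn : ∀ r ∈ Icc (0 : ℝ) 1, 1 / L ≤ ‖Q r‖ := fun r hr => by
    have h1 := hL _ (hmem r hr).1 _ (hmem r hr).2.1
    have hp := (hmem r hr).2.2
    rw [add_sub_cancel_left, norm_mul, hu, mul_one, Complex.norm_real, Real.norm_eq_abs,
      abs_of_pos hp] at h1
    rw [hQ, norm_div, Complex.norm_real, Real.norm_eq_abs, abs_of_pos hp, div_le_div_iff₀ hL0 hp]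
    linarith
  have hQ0 : ∀ r ∈ Icc (0 : ℝ) 1, Q r ≠ 0 := fun r hr h0 => by
    have := hQn r hr
    rw [h0, norm_zero] at this
    exact this.not_gt (by positivity)
  have hw : angleVariation (fun r => f (a r + δ r * u) - f (a r)) = angleVariation Q := by
    rw [angleVariation_congr (δ := fun r => Q r * δ r)
      (fun r hr => (div_mul_cancel₀ _ (hδ0 r hr)).symm), angleVariation_mul hQc hQ0 hδc hδ0,
      angleVariation_of_slitPlane hδc (fun r hr => Or.inl (by
        rw [Complex.ofReal_re]; exact (hmem r hr).2.2)),
      Complex.arg_ofReal_of_nonneg (hmem 0 (by simp)).2.2.le,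
      Complex.arg_ofReal_of_nonneg (hmem 1 (by simp)).2.2.le]
    simp
  rw [hw]
  refine abs_angleVariation_le hQc (N + 1) (by omega) fun r hr t ht hrt => ?_
  have hrt' : 4 * |r - t| < d := by
    push_cast at hrt
    linarith
  -- Compare the two difference quotients by the mean value inequality.
  have hseg : ∀ r ∈ Icc (0 : ℝ) 1, ∀ τ ∈ Icc (0 : ℝ) 1, a r + τ * (δ r * u) ∈ disk := by
    intro r hr τ hτ
    have := convex_disk.add_smul_mem (hmem r hr).1 (hmem r hr).2.1 hτ
    simpa using this
  have hder : ∀ r ∈ Icc (0 : ℝ) 1, ∀ τ ∈ Icc (0 : ℝ) 1,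
      HasDerivWithinAt (fun τ : ℝ => f (a r + τ * (δ r * u)) / δ r)
        (fderivWithin ℝ f disk (a r + τ * (δ r * u)) u) (Icc 0 1) τ := by
    intro r hr τ hτ
    have h1 : HasDerivWithinAt (fun τ : ℝ => a r + τ * (δ r * u)) (δ r * u) (Icc 0 1) τ := by
      have h0 : HasDerivWithinAt (fun τ : ℝ => (τ : ℂ)) 1 (Icc 0 1) τ :=
        (hasDerivAt_id τ).ofReal_comp.hasDerivWithinAt
      simpa using (h0.mul_const (δ r * u : ℂ)).const_add (a r)
    have h2 := ((hf.hasFDerivWithinAt (hseg r hr τ hτ)).comp_hasDerivWithinAt τ h1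
      (fun x hx => hseg r hr x hx)).div_const (δ r : ℂ)
    have e : ∀ D : ℂ →L[ℝ] ℂ, D (δ r * u) / δ r = D u := fun D => by
      rw [← Complex.real_smul, map_smul, Complex.real_smul, mul_div_cancel_left₀ _ (hδ0 r hr)]
    exact h2.congr_deriv (e _)
  have hdiff := Convex.norm_image_sub_le_of_norm_hasDerivWithin_le (C := 1 / (2 * L))
    (fun τ hτ => (hder r hr τ hτ).sub (hder t ht τ hτ)) (fun τ hτ => by
      have h1 := (hud _ (hseg r hr τ hτ) _ (hseg t ht τ hτ) (by
        rw [dist_eq_norm]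
        have e : a r + τ * (δ r * u) - (a t + τ * (δ t * u)) =
          (a r - a t) + (τ * ((δ r - δ t : ℝ) : ℂ)) * u := by push_cast; ring
        have h2 := hlip r hr t ht
        have h3 : ‖((τ : ℂ) * ((δ r - δ t : ℝ) : ℂ)) * u‖ ≤ 2 * |r - t| := by
          rw [norm_mul, hu, mul_one, norm_mul, Complex.norm_real, Complex.norm_real,
            Real.norm_eq_abs, Real.norm_eq_abs, abs_of_nonneg hτ.1]
          exact (mul_le_of_le_one_left (abs_nonneg _) hτ.2).trans h2.2
        rw [e]
        linarith [norm_add_le (a r - a t) ((τ * ((δ r - δ t : ℝ) : ℂ)) * u), h2.1])).le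
      rw [dist_eq_norm] at h1
      rw [← sub_apply]
      refine (ContinuousLinearMap.le_opNorm _ _).trans ?_
      rwa [hu, mul_one]) (convex_Icc 0 1) (left_mem_Icc.2 zero_le_one) (right_mem_Icc.2 zero_le_one)
  have hQd : Q r - Q t = (f (a r + (1 : ℝ) * (δ r * u)) / δ r - f (a t + (1 : ℝ) * (δ t * u)) / δ t) -
      (f (a r + (0 : ℝ) * (δ r * u)) / δ r - f (a t + (0 : ℝ) * (δ t * u)) / δ t) := by
    simp only [hQ]
    push_cast
    rw [one_mul, one_mul, zero_mul, zero_mul, add_zero, add_zero]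
    ring
  have h5 : ‖Q r - Q t‖ ≤ 1 / (2 * L) := by
    rw [hQd]
    simpa using hdiff
  refine h5.trans_lt (lt_of_lt_of_le ?_ (hQn r hr))
  rw [div_lt_div_iff₀ (by positivity) hL0]
  linarith

/-- The angular function of an isotopy that ends at a `C¹` diffeomorphism is bounded: spreading the two
points apart to opposite points of the circle leads to a compact set of pairs, and the end of the
isotopy turns the segment a bounded number of times meanwhile. -/
theorem IsIdentityIsotopy.exists_bound_ang {J : ℝ → ℂ → ℂ} {f : ℂ → ℂ} (hJ : IsIdentityIsotopy J f)
    (hf : IsSymplecticDiffeo f) :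
    ∃ C : ℝ, ∀ z ∈ disk, ∀ z' ∈ disk, z ≠ z' → |ang J z z'| ≤ C := by
  obtain ⟨N₁, h₁⟩ := hJ.exists_bound_ang_antipodal
  obtain ⟨N₂, h₂⟩ := hf.exists_bound_quotient
  refine ⟨N₁ + N₂, fun z hz z' hz' hne => ?_⟩
  have hd : 0 < ‖z' - z‖ := norm_pos_iff.2 (sub_ne_zero.2 hne.symm)
  set ρ : ℝ := ‖z' - z‖ with hρ
  have hρ2 : ρ ≤ 2 := by
    rw [mem_disk_iff] at hz hz'
    linarith [norm_sub_le z' z]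
  set u : ℂ := (z' - z) / ρ with hu
  have hρ0 : (ρ : ℂ) ≠ 0 := by exact_mod_cast hd.ne'
  have hu1 : ‖u‖ = 1 := by
    rw [hu, norm_div, Complex.norm_real, Real.norm_eq_abs, abs_of_pos hd, ← hρ, div_self hd.ne']
  have hz'eq : z' = z + ρ * u := by rw [hu, mul_div_cancel₀ _ hρ0]; ring
  have hud : u ∈ disk := mem_disk_iff.2 hu1.le
  have hud' : -u ∈ disk := mem_disk_iff.2 (by rw [norm_neg, hu1])
  -- Spread the two points apart, keeping their direction.
  set a : ℝ → ℂ := fun r => z + r * (-u - z) with ha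
  set δ : ℝ → ℝ := fun r => ρ + r * (2 - ρ) with hδ
  have hδpos : ∀ r ∈ Icc (0 : ℝ) 1, 0 < δ r := fun r hr => by
    simp only [hδ]
    nlinarith [hr.1, hr.2]
  have hmem : ∀ r ∈ Icc (0 : ℝ) 1, a r ∈ disk ∧ a r + δ r * u ∈ disk ∧ 0 < δ r := by
    intro r hr
    refine ⟨by simpa [ha] using convex_disk.add_smul_sub_mem hz hud' hr, ?_, hδpos r hr⟩
    have := convex_disk.add_smul_sub_mem hz' hud hr
    have e : a r + δ r * u = z' + r • (u - z') := by
      simp only [ha, hδ, Complex.real_smul]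
      rw [hz'eq]
      push_cast
      ring
    rwa [e]
  have hlip : ∀ r ∈ Icc (0 : ℝ) 1, ∀ t ∈ Icc (0 : ℝ) 1, ‖a r - a t‖ ≤ 2 * |r - t| ∧
      |δ r - δ t| ≤ 2 * |r - t| := by
    intro r hr t ht
    constructor
    · have e : a r - a t = ((r - t : ℝ) : ℂ) * (-u - z) := by
        simp only [ha]; push_cast; ring
      rw [e, norm_mul, Complex.norm_real, Real.norm_eq_abs, mul_comm]
      refine mul_le_mul_of_nonneg_right ?_ (abs_nonneg _)
      have := norm_sub_le (-u) z
      rw [norm_neg, hu1] at this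
      linarith [mem_disk_iff.1 hz]
    · have e : δ r - δ t = (r - t) * (2 - ρ) := by simp only [hδ]; ring
      rw [e, abs_mul, mul_comm, abs_of_nonneg (by linarith)]
      exact mul_le_mul_of_nonneg_right (by linarith) (abs_nonneg _)
  have hac : Continuous a := by fun_prop
  have hδc : Continuous δ := by fun_prop
  have hne' : ∀ r ∈ Icc (0 : ℝ) 1, a r ≠ a r + δ r * u := fun r hr he => by
    have h0 : (δ r : ℂ) * u = 0 := by simpa using he
    have := congrArg norm h0
    rw [norm_mul, hu1, mul_one, norm_zero, Complex.norm_real, Real.norm_eq_abs,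
      abs_of_pos (hδpos r hr)] at this
    exact (hδpos r hr).ne' this
  have hsq := angleVariation_square (H := fun r s => J s (a r + δ r * u) - J s (a r))
    ((hJ.continuousOn.comp (f := fun x : ℝ × ℝ => (x.2, a x.1 + δ x.1 * u)) (by fun_prop)
        fun x hx => ⟨hx.2, (hmem _ hx.1).2.1⟩).sub
      (hJ.continuousOn.comp (f := fun x : ℝ × ℝ => (x.2, a x.1)) (by fun_prop)
        fun x hx => ⟨hx.2, (hmem _ hx.1).1⟩))
    (fun r hr s hs => sub_ne_zero.2 (hJ.ne hs (hmem r hr).1 (hmem r hr).2.1 (hne' r hr)).symm)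
  have e0 : a 0 = z ∧ a 0 + δ 0 * u = z' := by
    refine ⟨by simp [ha], ?_⟩
    rw [hz'eq]
    simp [ha, hδ]
  have e1 : a 1 = -u ∧ a 1 + δ 1 * u = u := by
    refine ⟨by simp [ha], ?_⟩
    simp only [ha, hδ]
    push_cast
    ring
  rw [e0.2, e0.1, e1.2, e1.1] at hsq
  have hfin : angleVariation (fun r => J 1 (a r + δ r * u) - J 1 (a r)) =
      angleVariation (fun r => f (a r + δ r * u) - f (a r)) :=
    angleVariation_congr fun r hr => by
      simp only [hJ.finish _ (hmem r hr).1, hJ.finish _ (hmem r hr).2.1]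
  have hst : angleVariation (fun r => J 0 (a r + δ r * u) - J 0 (a r)) = 0 := by
    have hδc' : ContinuousOn (fun r => (δ r : ℂ)) (Icc 0 1) := by fun_prop
    rw [angleVariation_congr (δ := fun r => (δ r : ℂ) * u) (fun r hr => by
      simp only [hJ.start _ (hmem r hr).1, hJ.start _ (hmem r hr).2.1, add_sub_cancel_left]),
      angleVariation_mul hδc' (fun r hr => by exact_mod_cast (hδpos r hr).ne') continuousOn_const
        (fun r _ h0 => by rw [h0, norm_zero] at hu1; exact zero_ne_one hu1),
      angleVariation_const (fun h0 => by rw [h0, norm_zero] at hu1; exact zero_ne_one hu1),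
      angleVariation_of_slitPlane hδc' (fun r hr => Or.inl (by
        rw [Complex.ofReal_re]; exact hδpos r hr)),
      Complex.arg_ofReal_of_nonneg (hδpos 0 (by simp)).le,
      Complex.arg_ofReal_of_nonneg (hδpos 1 (by simp)).le]
    simp
  rw [hfin, hst, zero_add] at hsq
  have h3 := h₁ u hu1
  have h4 := h₂ a δ u hu1 hac hδc hmem hlip
  have h5 : ang J z z' = ang J (-u) u -
      angleVariation (fun r => f (a r + δ r * u) - f (a r)) := by
    rw [ang, ang, ← hsq]
    ring
  rw [h5]
  exact (abs_sub _ _).trans (add_le_add h3 h4)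

/-! ### Invariance under homotopy -/

theorem IsotopyHomotopic.ang_eq {I J : ℝ → ℂ → ℂ} (h : IsotopyHomotopic I J) {z z' : ℂ}
    (hz : z ∈ disk) (hz' : z' ∈ disk) (hne : z ≠ z') : ang I z z' = ang J z z' := by
  obtain ⟨K, hK, hb, hKIJ, hKe⟩ := h
  have hn : ∀ r ∈ Icc (0 : ℝ) 1, ∀ s ∈ Icc (0 : ℝ) 1, K r s z' - K r s z ≠ 0 := fun r hr s hs =>
    sub_ne_zero.2 fun he => hne ((hb r hr s hs).injOn hz' hz he).symm
  have hsq := angleVariation_square (H := fun r s => K r s z' - K r s z)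
    ((hK.comp (f := fun x : ℝ × ℝ => (x.1, x.2, z')) (by fun_prop) fun x hx => ⟨hx.1, hx.2, hz'⟩).sub
      (hK.comp (f := fun x : ℝ × ℝ => (x.1, x.2, z)) (by fun_prop) fun x hx => ⟨hx.1, hx.2, hz⟩)) hn
  have h0 : (0 : ℝ) ∈ Icc (0 : ℝ) 1 := by simp
  have h1 : (1 : ℝ) ∈ Icc (0 : ℝ) 1 := by simp
  have c0 : angleVariation (fun r => K r 0 z' - K r 0 z) = 0 := by
    rw [angleVariation_congr (δ := fun _ => I 0 z' - I 0 z) (fun r hr => by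
      simp only [(hKe r hr z hz).1, (hKe r hr z' hz').1])]
    refine angleVariation_const ?_
    rw [← (hKe 0 h0 z hz).1, ← (hKe 0 h0 z' hz').1]
    exact hn 0 h0 0 h0
  have c1 : angleVariation (fun r => K r 1 z' - K r 1 z) = 0 := by
    rw [angleVariation_congr (δ := fun _ => I 1 z' - I 1 z) (fun r hr => by
      simp only [(hKe r hr z hz).2, (hKe r hr z' hz').2])]
    refine angleVariation_const ?_
    rw [← (hKe 0 h0 z hz).2, ← (hKe 0 h0 z' hz').2]
    exact hn 0 h0 1 h1
  rw [c0, c1, add_zero, zero_add] at hsq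
  rw [ang, ang, angleVariation_congr (δ := fun s => K 0 s z' - K 0 s z) (fun s hs => by
    simp only [(hKIJ s hs z hz).1, (hKIJ s hs z' hz').1]), hsq]
  exact angleVariation_congr fun s hs => by simp only [(hKIJ s hs z hz).2, (hKIJ s hs z' hz').2]

theorem IsotopyHomotopic.calabi_eq {I J : ℝ → ℂ → ℂ} (h : IsotopyHomotopic I J) :
    calabi I = calabi J := by
  rw [calabi_eq_integral, calabi_eq_integral]
  refine integral_congr_ae ?_
  filter_upwards [ae_mem_pairs] with p hp
  exact h.ang_eq (diskStar_subset_disk hp.1) (diskStar_subset_disk hp.2.1) hp.2.2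

/-! ### The mean of `Λ` -/

/-- The first formula: `Λ` and the bounded function `ang` differ by a coboundary, which is then
integrable and has mean zero. -/
theorem calabi_eq_integral_Lam {I : ℝ → ℂ → ℂ} {f ft : ℂ → ℂ} (hf : IsSymplecticDiffeo f)
    (hft : IsNaturalLift I f ft) {φ : Set ℂ} (hφ : φ ∈ F.leaves)
    (hm : Integrable (fun z => (displacement ft φ z : ℝ)) muOmega)
    (hl : IntegrableOn (fun p : ℂ × ℂ => lam F f p.1 p.2) pairs (muOmega.prod muOmega)) :
    calabi I = ∫ p in pairs, Lam F φ f ft p.1 p.2 ∂(muOmega.prod muOmega) := by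
  obtain ⟨J, Jt, hJ, hJ0, hIJ, hJt, hft⟩ := hft
  have hJs := hJ.star hJ0 hJt
  obtain ⟨η, hη, hηφ⟩ : ∃ η ∈ cover, Complex.exp η ∈ φ := by
    obtain ⟨γ, hγ, rfl⟩ := F.exists_ray φ hφ
    refine ⟨_, log_mem_cover (hγ.mem 0), 0, ?_⟩
    rw [Complex.exp_log (ne_zero_of_mem_diskStar (hγ.mem 0))]
  set ν := muOmega.prod muOmega with hν
  rw [hIJ.calabi_eq, calabi_eq_integral, restrict_pairs]
  rw [IntegrableOn, restrict_pairs] at hl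
  have hLam : Integrable (fun p : ℂ × ℂ => Lam F φ f ft p.1 p.2) ν := hl.add (hm.comp_fst muOmega)
  have hT := hf.measurePreserving.prod hf.measurePreserving
  set T := Prod.map (extend f) (extend f) with hTdef
  set U : ℂ × ℂ → ℝ := fun p => F.beta p.1 p.2 - F.sheet η p.1 with hU
  have hUm : AEMeasurable U ν := by
    have := F.aemeasurable_beta ν
    rw [restrict_pairs] at this
    exact this.sub ((F.measurable_sheet hη).comp measurable_fst).aemeasurable
  have hdec : (fun p : ℂ × ℂ => ang J p.1 p.2) =ᵐ[ν]
      fun p => Lam F φ f ft p.1 p.2 - (U p - U (T p)) := by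
    filter_upwards [ae_mem_pairs] with p hp
    rw [Lam_eq hJs hJt hft hφ hη hηφ hp.1 hp.2.1 hp.2.2]
    simp only [hU, hTdef, Prod.map, extend_eqOn f (diskStar_subset_disk hp.1),
      extend_eqOn f (diskStar_subset_disk hp.2.1)]
    ring
  have hUT : AEMeasurable (fun p => U p - U (T p)) ν :=
    hUm.sub (hUm.comp_quasiMeasurePreserving hT.quasiMeasurePreserving)
  obtain ⟨C, hC⟩ := hJ.exists_bound_ang hf
  have hang : Integrable (fun p : ℂ × ℂ => ang J p.1 p.2) ν := by
    refine Integrable.of_bound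
      ((hLam.aestronglyMeasurable.sub hUT.aestronglyMeasurable).congr hdec.symm) C ?_
    filter_upwards [ae_mem_pairs] with p hp
    exact hC _ (diskStar_subset_disk hp.1) _ (diskStar_subset_disk hp.2.1) hp.2.2
  have hcob : Integrable (fun p => U p - U (T p)) ν := by
    refine (hLam.sub hang).congr ?_
    filter_upwards [hdec] with p hp
    simp only [Pi.sub_apply, hp]
    ring
  have h0 := integral_coboundary hT hUm hcob
  rw [integral_congr_ae hdec, integral_sub hLam hcob, h0, sub_zero]

/-! ### Integration over the disk in polar coordinates -/

theorem polarCoord_symm_eq_circleMap (p : ℝ × ℝ) :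
    Complex.polarCoord.symm p = circleMap 0 p.1 p.2 := by
  rw [Complex.polarCoord_symm_apply, circleMap_zero, Complex.exp_mul_I]
  push_cast
  rfl

theorem integrableOn_polarCoord {E : Type*} [NormedAddCommGroup E] [NormedSpace ℝ E] {f : ℂ → E}
    (hm : StronglyMeasurable f) (hf : Integrable f) :
    IntegrableOn (fun p : ℝ × ℝ => p.1 • f (circleMap 0 p.1 p.2)) (Ioi 0 ×ˢ Ioo (-π) π) := by
  have hc : Continuous fun p : ℝ × ℝ => circleMap 0 p.1 p.2 := by
    unfold circleMap
    fun_prop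
  refine ⟨(measurable_fst.stronglyMeasurable.smul
    (hm.comp_measurable hc.measurable)).aestronglyMeasurable, ?_⟩
  refine lt_of_le_of_lt (le_of_eq ?_) hf.2
  rw [← Complex.lintegral_comp_polarCoord_symm, polarCoord_target]
  refine setLIntegral_congr_fun (measurableSet_Ioi.prod measurableSet_Ioo) fun p hp => ?_
  have hp0 : 0 < p.1 := hp.1
  simp only [polarCoord_symm_eq_circleMap, enorm_smul, Real.enorm_of_nonneg hp0.le, smul_eq_mul]

/-- Integration over the disk in polar coordinates, as an integral over a rectangle. -/
theorem setIntegral_disk {E : Type*} [NormedAddCommGroup E] [NormedSpace ℝ E]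
    {f : ℂ → E} (hm : StronglyMeasurable (disk.indicator f)) (hf : IntegrableOn f disk) :
    IntegrableOn (fun p : ℝ × ℝ => p.1 • f (circleMap 0 p.1 p.2)) (Ioc 0 1 ×ˢ Ioo (-π) π) ∧
    ∫ z in disk, f z = ∫ p in Ioc (0 : ℝ) 1 ×ˢ Ioo (-π) π, p.1 • f (circleMap 0 p.1 p.2) := by
  have hi := integrableOn_polarCoord hm ((integrable_indicator_iff measurableSet_disk).2 hf)
  have hS : MeasurableSet (Ioc (0 : ℝ) 1 ×ˢ Ioo (-π) π) := measurableSet_Ioc.prod measurableSet_Ioo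
  have hsub : Ioc (0 : ℝ) 1 ×ˢ Ioo (-π) π ⊆ Ioi 0 ×ˢ Ioo (-π) π :=
    prod_mono Ioc_subset_Ioi_self le_rfl
  have hmem : ∀ p ∈ Ioi (0 : ℝ) ×ˢ Ioo (-π) π, (circleMap 0 p.1 p.2 ∈ disk ↔ p.1 ≤ 1) :=
    fun p hp => by rw [mem_disk_iff, norm_circleMap_zero, abs_of_pos hp.1]
  have hon : EqOn (fun p : ℝ × ℝ => p.1 • disk.indicator f (circleMap 0 p.1 p.2))
      (fun p : ℝ × ℝ => p.1 • f (circleMap 0 p.1 p.2)) (Ioc 0 1 ×ˢ Ioo (-π) π) := fun p hp => by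
    simp only [indicator_of_mem ((hmem p (hsub hp)).2 hp.1.2)]
  refine ⟨(hi.mono_set hsub).congr_fun hon hS, ?_⟩
  rw [← setIntegral_congr_fun hS hon, ← integral_indicator measurableSet_disk,
    ← Complex.integral_comp_polarCoord_symm, polarCoord_target]
  simp only [polarCoord_symm_eq_circleMap]
  refine setIntegral_eq_of_subset_of_forall_sdiff_eq_zero
    (measurableSet_Ioi.prod measurableSet_Ioo) hsub fun p hp => ?_
  rw [indicator_of_notMem, smul_zero]
  intro h
  exact hp.2 ⟨⟨hp.1.1, (hmem p hp.1).1 h⟩, hp.1.2⟩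

theorem stronglyMeasurable_indicator_disk {f : ℂ → ℝ} (hf : ContinuousOn f disk) :
    StronglyMeasurable (disk.indicator f) := by
  classical
  rw [← piecewise_eq_indicator]
  exact (hf.measurable_piecewise continuousOn_const measurableSet_disk).stronglyMeasurable

theorem setIntegral_disk_circleAverage {E : Type*} [NormedAddCommGroup E] [NormedSpace ℝ E]
    {f : ℂ → E} (hm : StronglyMeasurable (disk.indicator f)) (hf : IntegrableOn f disk) :
    ∫ z in disk, f z = ∫ r in Ioc (0 : ℝ) 1, (2 * π * r) • Real.circleAverage f 0 r := by
  obtain ⟨hi, he⟩ := setIntegral_disk hm hf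
  rw [he, Measure.volume_eq_prod, setIntegral_prod _ hi]
  refine setIntegral_congr_fun measurableSet_Ioc fun r hr => ?_
  have hp : Function.Periodic (fun θ => f (circleMap 0 r θ)) (2 * π) := fun θ => by
    simp only [periodic_circleMap 0 r θ]
  have h1 := hp.intervalIntegral_add_eq (-π) 0
  rw [zero_add, show -π + 2 * π = π by ring] at h1
  simp only
  rw [integral_smul, ← integral_Ioc_eq_integral_Ioo,
    ← intervalIntegral.integral_of_le (by linarith [Real.pi_pos]), h1, Real.circleAverage_def,
    smul_smul]
  congr 1
  field_simp

/-! ### The Cauchy kernel -/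

theorem circleAverage_cauchy_of_lt {w : ℂ} {r : ℝ} (hr : 0 < r) (h : r < ‖w‖) :
    Real.circleAverage (fun z => w / (w - z)) 0 r = 1 := by
  have hw : w ≠ 0 := norm_pos_iff.1 (hr.trans h)
  have hd : DiffContOnCl ℂ (fun z => w / (w - z)) (Metric.ball 0 |r|) := by
    refine DifferentiableOn.diffContOnCl fun z hz => ?_
    rw [closure_ball _ (abs_pos.2 hr.ne').ne', mem_closedBall_zero_iff, abs_of_pos hr] at hz
    refine DifferentiableAt.differentiableWithinAt ?_
    refine (differentiableAt_const w).div (by fun_prop) (sub_ne_zero.2 ?_)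
    rintro rfl
    exact h.not_ge hz
  rw [hd.circleAverage, sub_zero, div_self hw]

/-- Outside the pole the average vanishes, as `w / (w - z) = 1 - z / (z - w)` on the circle. -/
theorem circleAverage_cauchy_of_gt {w : ℂ} {r : ℝ} (h : ‖w‖ < r) :
    Real.circleAverage (fun z => w / (w - z)) 0 r = 0 := by
  have hr : 0 < r := (norm_nonneg w).trans_lt h
  have h1 := DiffContOnCl.circleAverage_smul_div (f := fun _ => (1 : ℂ)) (c := 0) (R := r) (w := w)
    diffContOnCl_const (by rwa [mem_ball_zero_iff, abs_of_pos hr])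
  have hne : ∀ z ∈ Metric.sphere (0 : ℂ) |r|, z - w ≠ 0 := fun z hz h0 => by
    rw [mem_sphere_zero_iff_norm, abs_of_pos hr, sub_eq_zero.1 h0] at hz
    exact h.ne hz
  have hci : CircleIntegrable (fun z => ((z - 0) / (z - w)) • (1 : ℂ)) 0 r := by
    refine ContinuousOn.circleIntegrable' ?_
    exact ((by fun_prop : ContinuousOn (fun z : ℂ => z - 0) (Metric.sphere 0 |r|)).div (by fun_prop) hne).smul
      continuousOn_const
  have h2 := Real.circleAverage_fun_sub (f₁ := fun _ => (1 : ℂ)) (circleIntegrable_const 1 0 r) hci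
  rw [h1, Real.circleAverage_const, sub_self] at h2
  refine Eq.trans (Real.circleAverage_congr_sphere fun z hz => ?_) h2
  have h3 := hne z hz
  have h4 : w - z ≠ 0 := fun h0 => h3 (by rw [← neg_sub, h0, neg_zero])
  simp only [smul_eq_mul, mul_one, sub_zero]
  field_simp
  ring

/-- The Cauchy kernel is integrable on the disk, uniformly in the position of the pole. -/
theorem lintegral_cauchy_le (w : ℂ) (hw : w ∈ disk) :
    ∫⁻ z in disk, ‖(w - z)⁻¹‖ₑ ≤ volume (Ioc (0 : ℝ) 2 ×ˢ Ioo (-π) π) := by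
  have h1 : ∫⁻ z in disk, ‖(w - z)⁻¹‖ₑ ≤
      ∫⁻ z, (Metric.closedBall (0 : ℂ) 2).indicator (fun u => ‖u⁻¹‖ₑ) (z - w) := by
    rw [← lintegral_indicator measurableSet_disk]
    refine lintegral_mono fun z => ?_
    by_cases hz : z ∈ disk
    · have : z - w ∈ Metric.closedBall (0 : ℂ) 2 := by
        rw [mem_closedBall_zero_iff]
        rw [mem_disk_iff] at hz hw
        linarith [norm_sub_le z w]
      rw [indicator_of_mem hz, indicator_of_mem this, ← neg_sub, inv_neg, enorm_neg]
    · rw [indicator_of_notMem hz]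
      exact zero_le
  refine h1.trans ?_
  rw [lintegral_sub_right_eq_self, ← Complex.lintegral_comp_polarCoord_symm,
    polarCoord_target, ← setLIntegral_one]
  have hS : MeasurableSet (Ioc (0 : ℝ) 2 ×ˢ Ioo (-π) π) := measurableSet_Ioc.prod measurableSet_Ioo
  rw [← lintegral_indicator hS, ← lintegral_indicator (measurableSet_Ioi.prod measurableSet_Ioo)]
  refine lintegral_mono fun p => ?_
  by_cases hp : p ∈ Ioi (0 : ℝ) ×ˢ Ioo (-π) π
  · have hp0 : 0 < p.1 := hp.1
    rw [indicator_of_mem hp, polarCoord_symm_eq_circleMap]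
    by_cases h2 : p.1 ≤ 2
    · rw [indicator_of_mem (show p ∈ Ioc (0 : ℝ) 2 ×ˢ Ioo (-π) π from ⟨⟨hp0, h2⟩, hp.2⟩),
        indicator_of_mem (by rwa [mem_closedBall_zero_iff, norm_circleMap_zero, abs_of_pos hp0]),
        ← ofReal_norm, norm_inv, norm_circleMap_zero, abs_of_pos hp0, smul_eq_mul,
        ← ENNReal.ofReal_mul hp0.le, mul_inv_cancel₀ hp0.ne', ENNReal.ofReal_one]
    · rw [indicator_of_notMem (s := Metric.closedBall (0 : ℂ) 2) (by
        rwa [mem_closedBall_zero_iff, norm_circleMap_zero, abs_of_pos hp0]), smul_zero]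
      exact zero_le
  · rw [indicator_of_notMem hp]
    exact zero_le

theorem measure_rectangle_lt_top : volume (Ioc (0 : ℝ) 2 ×ˢ Ioo (-π) π) < ⊤ := by
  rw [Measure.volume_eq_prod, Measure.prod_prod, Real.volume_Ioc, Real.volume_Ioo]
  exact ENNReal.mul_lt_top ENNReal.ofReal_lt_top ENNReal.ofReal_lt_top

theorem integrableOn_cauchy {w : ℂ} (hw : w ∈ disk) : IntegrableOn (fun z => (w - z)⁻¹) disk :=
  ⟨(by fun_prop : Measurable fun z => (w - z)⁻¹).aestronglyMeasurable,
    (lintegral_cauchy_le w hw).trans_lt measure_rectangle_lt_top⟩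

/-- The Cauchy transform of the area form of the disk. -/
theorem integral_cauchy {w : ℂ} (hw : w ∈ disk) (hw0 : w ≠ 0) :
    ∫ z in disk, (w - z)⁻¹ = π * (starRingEnd ℂ) w := by
  have hn : 0 < ‖w‖ := norm_pos_iff.2 hw0
  have hn1 := mem_disk_iff.1 hw
  have h1 : ∫ z in disk, w / (w - z) = π * ‖w‖ ^ 2 := by
    simp only [div_eq_mul_inv]
    rw [setIntegral_disk_circleAverage
      ((by fun_prop : Measurable fun z => w * (w - z)⁻¹).stronglyMeasurable.indicator
        measurableSet_disk) ((integrableOn_cauchy hw).const_mul w)]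
    have h2 : ∫ r in Ioc (0 : ℝ) 1, (2 * π * r) • Real.circleAverage (fun z => w * (w - z)⁻¹) 0 r =
        ∫ r in Ioc (0 : ℝ) 1, (Ioo 0 ‖w‖).indicator (fun r => ((2 * π * r : ℝ) : ℂ)) r := by
      refine integral_congr_ae ?_
      have hae : ∀ᵐ r : ℝ ∂(volume.restrict (Ioc 0 1)), r ≠ ‖w‖ :=
        ae_restrict_of_ae (by simp [ae_iff])
      filter_upwards [ae_restrict_mem measurableSet_Ioc, hae] with r hr hrw
      rcases lt_or_gt_of_ne hrw with h | h
      · rw [indicator_of_mem (show r ∈ Ioo 0 ‖w‖ from ⟨hr.1, h⟩)]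
        have := circleAverage_cauchy_of_lt hr.1 h
        simp only [div_eq_mul_inv] at this
        rw [this]
        simp
      · rw [indicator_of_notMem (fun h' => h.not_gt h'.2)]
        have := circleAverage_cauchy_of_gt h
        simp only [div_eq_mul_inv] at this
        rw [this, smul_zero]
    rw [h2, setIntegral_indicator measurableSet_Ioo,
      inter_eq_self_of_subset_right (show Ioo 0 ‖w‖ ⊆ Ioc (0 : ℝ) 1 from
        fun r hr => ⟨hr.1, hr.2.le.trans hn1⟩),
      ← integral_Ioc_eq_integral_Ioo, ← intervalIntegral.integral_of_le hn.le,
      intervalIntegral.integral_ofReal, intervalIntegral.integral_const_mul, integral_id]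
    push_cast
    ring
  simp only [div_eq_mul_inv] at h1
  rw [integral_const_mul] at h1
  have h3 : (‖w‖ : ℂ) ^ 2 = w * (starRingEnd ℂ) w := by
    rw [Complex.mul_conj, Complex.normSq_eq_norm_sq]
    push_cast
    rfl
  refine mul_left_cancel₀ hw0 ?_
  rw [h1, h3]
  ring

/-! ### The angular function of a Hamiltonian isotopy -/

/-- Along a differentiable path the angle varies at the rate `Im (γ' / γ)`. -/
theorem angleVariation_of_hasDerivWithinAt {γ γ' : ℝ → ℂ}
    (hγ : ∀ s ∈ Icc (0 : ℝ) 1, HasDerivWithinAt γ (γ' s) (Icc 0 1) s)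
    (h0 : ∀ s ∈ Icc (0 : ℝ) 1, γ s ≠ 0) (hc : ContinuousOn γ' (Icc 0 1)) :
    angleVariation γ = (∫ s in (0 : ℝ)..1, (γ' s / γ s).im) / (2 * π) := by
  have hγc : ContinuousOn γ (Icc 0 1) := fun s hs => (hγ s hs).continuousWithinAt
  have hq : ContinuousOn (fun s => γ' s / γ s) (Icc 0 1) := hc.div hγc h0
  -- The primitive `L` of `γ' / γ` is a logarithm of `γ`, since `exp (-L) γ` has derivative zero.
  set G : ℝ → ℂ := IccExtend zero_le_one ((Icc 0 1).domRestrict fun s => γ' s / γ s) with hG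
  have hGc : Continuous G := (continuousOn_iff_continuous_domRestrict.1 hq).Icc_extend'
  have hGe : ∀ s ∈ Icc (0 : ℝ) 1, G s = γ' s / γ s := fun s hs => by
    rw [hG, IccExtend_of_mem _ _ hs, domRestrict_apply]
  set L : ℝ → ℂ := fun s => Complex.log (γ 0) + ∫ t in (0 : ℝ)..s, G t with hL
  have hLd : ∀ s, HasDerivAt L (G s) s := fun s =>
    (hGc.integral_hasStrictDerivAt 0 s).hasDerivAt.const_add _
  have hz : (0 : ℝ) ∈ Icc (0 : ℝ) 1 := by simp
  have hexp : ∀ s ∈ Icc (0 : ℝ) 1, Complex.exp (L s) = γ s := by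
    intro s hs
    have hd : ∀ t ∈ Icc (0 : ℝ) 1,
        HasDerivWithinAt (fun t => Complex.exp (-L t) * γ t) 0 (Icc 0 1) t := fun t ht => by
      refine ((hLd t).hasDerivWithinAt.fun_neg.cexp.mul (hγ t ht)).congr_deriv ?_
      rw [hGe t ht]
      have := h0 t ht
      field_simp
      ring
    have h1 := Convex.norm_image_sub_le_of_norm_hasDerivWithin_le (C := 0) hd (by simp)
      (convex_Icc 0 1) hz hs
    rw [zero_mul, norm_le_zero_iff, sub_eq_zero] at h1
    simp only [hL, intervalIntegral.integral_same, add_zero, Complex.exp_neg,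
      Complex.exp_log (h0 0 hz), inv_mul_cancel₀ (h0 0 hz)] at h1
    rw [inv_mul_eq_div, div_eq_one_iff_eq (Complex.exp_ne_zero _)] at h1
    exact h1.symm
  rw [angleVariation_of_log (fun s _ => (hLd s).continuousAt.continuousWithinAt) hexp]
  congr 1
  simp only [hL, intervalIntegral.integral_same, add_zero, Complex.add_im, add_sub_cancel_left]
  have h2 := Complex.imCLM.intervalIntegral_comp_comm (hGc.intervalIntegrable (μ := volume) 0 1)
  simp only [Complex.imCLM_apply] at h2
  rw [← h2]
  refine intervalIntegral.integral_congr fun s hs => ?_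
  rw [uIcc_of_le zero_le_one] at hs
  simp only [hGe s hs]

section

variable {J X : ℝ → ℂ → ℂ} {H : ℝ → ℂ → ℝ} (h : IsHamiltonianIsotopy J X H)
include h

theorem IsHamiltonianIsotopy.exists_bound_field :
    ∃ M, 0 ≤ M ∧ ∀ s ∈ Icc (0 : ℝ) 1, ∀ z ∈ disk, ‖X s z‖ ≤ M := by
  obtain ⟨M, hM⟩ := (isCompact_Icc.prod isCompact_disk).exists_bound_of_continuousOn
    h.field_continuousOn
  exact ⟨max M 0, le_max_right _ _, fun s hs z hz => (hM (s, z) ⟨hs, hz⟩).trans (le_max_left _ _)⟩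

theorem IsHamiltonianIsotopy.exists_lipschitz_field :
    ∃ C, 0 ≤ C ∧ ∀ s ∈ Icc (0 : ℝ) 1, ∀ z ∈ disk, ∀ w ∈ disk,
      ‖X s w - X s z‖ ≤ C * ‖w - z‖ := by
  obtain ⟨C, hC⟩ := (isCompact_Icc.prod isCompact_disk).exists_bound_of_continuousOn
    h.field_fderiv_continuousOn
  refine ⟨max C 0, le_max_right _ _, fun s hs z hz w hw => ?_⟩
  exact convex_disk.norm_image_sub_le_of_norm_fderivWithin_le (𝕜 := ℝ)
    ((h.field_contDiffOn s hs).differentiableOn one_ne_zero)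
    (fun x hx => (hC (s, x) ⟨hs, hx⟩).trans (le_max_left _ _)) hz hw

/-- A Hamiltonian isotopy is jointly continuous: it is Lipschitz in time, as the field is bounded. -/
theorem IsHamiltonianIsotopy.isIdentityIsotopy : IsIdentityIsotopy J (J 1) := by
  refine ⟨?_, fun s hs => (h.symplectic s hs).bijOn, h.start, fun _ _ => rfl⟩
  obtain ⟨M, hM0, hM⟩ := h.exists_bound_field
  refine continuousOn_prod_of_continuousOn_lipschitzOnWith (fun p : ℝ × ℂ => J p.1 p.2)
    (Real.toNNReal M) (fun s hs => (h.symplectic s hs).contDiffOn.continuousOn) fun z hz => ?_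
  refine (convex_Icc (0 : ℝ) 1).lipschitzOnWith_of_nnnorm_hasDerivWithin_le
    (fun s hs => h.flow s hs z hz) fun s hs => ?_
  rw [← NNReal.coe_le_coe, coe_nnnorm, Real.coe_toNNReal _ hM0]
  exact hM s hs _ ((h.symplectic s hs).bijOn.mapsTo hz)

theorem IsHamiltonianIsotopy.ang_eq {z z' : ℂ} (hz : z ∈ disk) (hz' : z' ∈ disk) (hne : z ≠ z') :
    ang J z z' = (∫ s in (0 : ℝ)..1,
      ((X s (J s z') - X s (J s z)) / (J s z' - J s z)).im) / (2 * π) := by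
  have hJ := h.isIdentityIsotopy
  have hc : ∀ w ∈ disk, ContinuousOn (fun s => X s (J s w)) (Icc 0 1) := fun w hw =>
    h.field_continuousOn.comp (continuousOn_id.prodMk (hJ.continuousOn_path hw))
      fun s hs => ⟨hs, (hJ.bijOn s hs).mapsTo hw⟩
  exact angleVariation_of_hasDerivWithinAt
    (fun s hs => (h.flow s hs z' hz').sub (h.flow s hs z hz))
    (fun s hs => sub_ne_zero.2 (hJ.ne hs hz hz' hne).symm) ((hc z' hz').sub (hc z hz))

end

/-- The rate at which the vector field `Y` turns the segment from `p.1` to `p.2`. -/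
def turningRate (Y : ℂ → ℂ) (p : ℂ × ℂ) : ℝ := ((Y p.2 - Y p.1) / (p.2 - p.1)).im

theorem abs_turningRate_le {Y : ℂ → ℂ} {C : ℝ} (hC : 0 ≤ C) {p : ℂ × ℂ}
    (h : ‖Y p.2 - Y p.1‖ ≤ C * ‖p.2 - p.1‖) : |turningRate Y p| ≤ C := by
  refine (Complex.abs_im_le_norm _).trans ?_
  rw [norm_div]
  exact div_le_of_le_mul₀ (norm_nonneg _) hC h

theorem pairs_subset : pairs ⊆ disk ×ˢ disk := fun _ hp =>
  ⟨diskStar_subset_disk hp.1, diskStar_subset_disk hp.2.1⟩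

theorem continuousOn_turningRate {Y : ℂ → ℂ} (hY : ContinuousOn Y disk) :
    ContinuousOn (turningRate Y) pairs := by
  refine Complex.continuous_im.comp_continuousOn (ContinuousOn.div
    ((hY.comp continuousOn_snd fun p hp => (pairs_subset hp).2).sub
      (hY.comp continuousOn_fst fun p hp => (pairs_subset hp).1))
    (continuousOn_snd.sub continuousOn_fst) fun p hp => sub_ne_zero.2 hp.2.2.symm)

theorem aestronglyMeasurable_turningRate {Y : ℂ → ℂ} (hY : ContinuousOn Y disk) :
    AEStronglyMeasurable (turningRate Y) (muOmega.prod muOmega) := by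
  rw [← restrict_pairs]
  exact (continuousOn_turningRate hY).aestronglyMeasurable isOpen_pairs.measurableSet

/-- The variation of the angles of all pairs, by Fubini's theorem and the invariance of the area. -/
theorem IsHamiltonianIsotopy.calabi_eq_integral_turningRate {J X : ℝ → ℂ → ℂ} {H : ℝ → ℂ → ℝ}
    (h : IsHamiltonianIsotopy J X H) :
    calabi J = (∫ s in (0 : ℝ)..1, ∫ p, turningRate (X s) p ∂(muOmega.prod muOmega)) /
      (2 * π) := by
  have hJ := h.isIdentityIsotopy
  obtain ⟨C, hC0, hC⟩ := h.exists_lipschitz_field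
  set ν := muOmega.prod muOmega with hν
  set G : ℝ → ℂ × ℂ → ℝ := fun s p =>
    ((X s (J s p.2) - X s (J s p.1)) / (J s p.2 - J s p.1)).im with hG
  have h1 : calabi J = (∫ p, (∫ s in (0 : ℝ)..1, G s p) ∂ν) / (2 * π) := by
    rw [calabi_eq_integral, ← integral_div]
    refine integral_congr_ae ?_
    filter_upwards [ae_mem_pairs] with p hp
    exact h.ang_eq (pairs_subset hp).1 (pairs_subset hp).2 hp.2.2
  have hmaps : ∀ s ∈ Icc (0 : ℝ) 1, ∀ z ∈ disk, J s z ∈ disk :=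
    fun s hs z hz => (hJ.bijOn s hs).mapsTo hz
  have hcont : ContinuousOn (Function.uncurry G) (Ioc 0 1 ×ˢ pairs) := by
    have c1 : ContinuousOn (fun x : ℝ × ℂ × ℂ => J x.1 x.2.1) (Ioc 0 1 ×ˢ pairs) :=
      hJ.continuousOn.comp (f := fun x : ℝ × ℂ × ℂ => (x.1, x.2.1)) (by fun_prop)
        fun x hx => ⟨Ioc_subset_Icc_self hx.1, (pairs_subset hx.2).1⟩
    have c2 : ContinuousOn (fun x : ℝ × ℂ × ℂ => J x.1 x.2.2) (Ioc 0 1 ×ˢ pairs) :=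
      hJ.continuousOn.comp (f := fun x : ℝ × ℂ × ℂ => (x.1, x.2.2)) (by fun_prop)
        fun x hx => ⟨Ioc_subset_Icc_self hx.1, (pairs_subset hx.2).2⟩
    have d1 : ContinuousOn (fun x : ℝ × ℂ × ℂ => X x.1 (J x.1 x.2.1)) (Ioc 0 1 ×ˢ pairs) :=
      h.field_continuousOn.comp (continuousOn_fst.prodMk c1) fun x hx =>
        ⟨Ioc_subset_Icc_self hx.1, hmaps _ (Ioc_subset_Icc_self hx.1) _ (pairs_subset hx.2).1⟩
    have d2 : ContinuousOn (fun x : ℝ × ℂ × ℂ => X x.1 (J x.1 x.2.2)) (Ioc 0 1 ×ˢ pairs) :=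
      h.field_continuousOn.comp (continuousOn_fst.prodMk c2) fun x hx =>
        ⟨Ioc_subset_Icc_self hx.1, hmaps _ (Ioc_subset_Icc_self hx.1) _ (pairs_subset hx.2).2⟩
    exact Complex.continuous_im.comp_continuousOn ((d2.sub d1).div (c2.sub c1) fun x hx =>
      sub_ne_zero.2 (hJ.ne (Ioc_subset_Icc_self hx.1) (pairs_subset hx.2).1
        (pairs_subset hx.2).2 hx.2.2.2).symm)
  have hint : Integrable (Function.uncurry G) ((volume.restrict (Ioc (0 : ℝ) 1)).prod ν) := by
    have hr : (volume.restrict (Ioc (0 : ℝ) 1)).prod ν =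
        (volume.prod ν).restrict (Ioc 0 1 ×ˢ pairs) := by
      rw [← Measure.prod_restrict, restrict_pairs]
    have hS := measurableSet_Ioc.prod (isOpen_pairs.measurableSet) (s := Ioc (0 : ℝ) 1)
    have : IsFiniteMeasure ((volume.prod ν).restrict (Ioc (0 : ℝ) 1 ×ˢ pairs)) := by
      rw [← hr]; infer_instance
    rw [hr]
    refine Integrable.of_bound (hcont.aestronglyMeasurable hS) C ?_
    filter_upwards [ae_restrict_mem hS] with x hx
    exact abs_turningRate_le (p := (J x.1 x.2.1, J x.1 x.2.2)) hC0 (hC x.1 (Ioc_subset_Icc_self hx.1)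
      _ (hmaps _ (Ioc_subset_Icc_self hx.1) _ (pairs_subset hx.2).1)
      _ (hmaps _ (Ioc_subset_Icc_self hx.1) _ (pairs_subset hx.2).2))
  rw [h1]
  congr 1
  simp only [intervalIntegral.integral_of_le zero_le_one]
  rw [← integral_integral_swap hint]
  refine setIntegral_congr_fun measurableSet_Ioc fun s hs => ?_
  have hs' := Ioc_subset_Icc_self hs
  have hf := h.symplectic s hs'
  have hT := hf.measurePreserving.prod hf.measurePreserving
  have hm := aestronglyMeasurable_turningRate (h.field_contDiffOn s hs').continuousOn
  have h2 := integral_map hT.measurable.aemeasurable (f := turningRate (X s))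
    (by rw [hT.map_eq]; exact hm)
  rw [hT.map_eq] at h2
  rw [h2]
  refine integral_congr_ae ?_
  filter_upwards [ae_mem_pairs] with p hp
  simp only [hG, turningRate, Prod.map, extend_eqOn (J s) (pairs_subset hp).1,
    extend_eqOn (J s) (pairs_subset hp).2]

/-! ### The mean turning rate of a vector field -/

theorem integrable_cauchy :
    Integrable (fun p : ℂ × ℂ => (p.2 - p.1)⁻¹) (muOmega.prod muOmega) := by
  have hm : Measurable fun p : ℂ × ℂ => (p.2 - p.1)⁻¹ := by fun_prop
  refine ⟨hm.aestronglyMeasurable, ?_⟩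
  rw [HasFiniteIntegral, lintegral_prod_symm' _ hm.enorm]
  calc ∫⁻ w, ∫⁻ z, ‖(w - z)⁻¹‖ₑ ∂muOmega ∂muOmega
      ≤ ∫⁻ _, volume (Ioc (0 : ℝ) 2 ×ˢ Ioo (-π) π) ∂muOmega := by
        refine lintegral_mono_ae ?_
        filter_upwards [ae_mem_disk] with w hw
        rw [muOmega_eq]
        exact lintegral_cauchy_le w hw
    _ < ⊤ := by
        rw [lintegral_const]
        exact ENNReal.mul_lt_top measure_rectangle_lt_top (measure_lt_top _ _)

/-- The mean turning rate of a vector field on the disk: the segment is turned as much by either of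
its ends, and the mean action on the end `w` is given by the Cauchy transform of the area form. -/
theorem integral_turningRate {Y : ℂ → ℂ} (hY : ContinuousOn Y disk) :
    ∫ p, turningRate Y p ∂(muOmega.prod muOmega) = 2 * π * ∫ w in disk, omega w (Y w) := by
  set ν := muOmega.prod muOmega with hν
  set E : ℂ × ℂ → ℂ := fun p => extend Y p.2 * (p.2 - p.1)⁻¹ with hE
  obtain ⟨M, hM⟩ := isCompact_disk.exists_bound_of_continuousOn hY
  have hEi : Integrable E ν := by
    refine integrable_cauchy.bdd_mul (c := M)
      ((measurable_extend hY).comp measurable_snd).aestronglyMeasurable ?_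
    filter_upwards [ae_mem_pairs] with p hp
    simp only [extend_eqOn Y (pairs_subset hp).2]
    exact hM _ (pairs_subset hp).2
  -- The turning rate is the sum of the contributions of both ends, exchanged by `(z, z') ↦ (z', z)`.
  have h1 : ∫ p, turningRate Y p ∂ν = ∫ p, ((E p).im + (E p.swap).im) ∂ν := by
    refine integral_congr_ae ?_
    filter_upwards [ae_mem_pairs] with p hp
    have e : (p.1 - p.2)⁻¹ = -(p.2 - p.1)⁻¹ := by rw [← neg_sub, inv_neg]
    simp only [hE, turningRate, Prod.snd_swap, Prod.fst_swap, extend_eqOn Y (pairs_subset hp).1,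
      extend_eqOn Y (pairs_subset hp).2, e, div_eq_mul_inv, sub_mul, Complex.sub_im, mul_neg,
      Complex.neg_im]
    ring
  have h2 : ∫ p, (E p.swap).im ∂ν = ∫ p, (E p).im ∂ν := by
    rw [hν]
    exact integral_prod_swap fun p => (E p).im
  have h5 : ∫ p, ((E p).im + (E p.swap).im) ∂ν = ∫ p, (E p).im ∂ν + ∫ p, (E p.swap).im ∂ν :=
    integral_add hEi.im hEi.swap.im
  rw [h1, h5, h2, ← two_mul, mul_assoc]
  congr 1
  have h3 : ∫ p, (E p).im ∂ν = (∫ p, E p ∂ν).im := integral_im hEi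
  rw [h3, integral_prod_symm _ hEi]
  have h4 : ∀ᵐ w ∂muOmega, ∫ z, E (z, w) ∂muOmega = π * (Y w * (starRingEnd ℂ) w) := by
    filter_upwards [ae_mem_disk, (ae_restrict_mem isOpen_diskStar.measurableSet :
      ∀ᵐ w ∂muOmega, w ∈ diskStar)] with w hw hw'
    simp only [hE, extend_eqOn Y hw]
    rw [integral_const_mul, muOmega_eq, integral_cauchy hw (ne_zero_of_mem_diskStar hw')]
    ring
  rw [integral_congr_ae h4, integral_const_mul, Complex.im_ofReal_mul, muOmega_eq]
  congr 1
  have hi : IntegrableOn (fun w => Y w * (starRingEnd ℂ) w) disk :=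
    (hY.mul (by fun_prop)).integrableOn_compact isCompact_disk
  refine (integral_im hi).symm.trans (integral_congr_ae (Eventually.of_forall fun w => ?_))
  simp [omega]
  ring

/-! ### The radial derivative of a Hamiltonian function -/

/-- Integration by parts along the rays. -/
theorem integral_fderivWithin_self {K : ℂ → ℝ} (hK : ContDiffOn ℝ 1 K disk)
    (h0 : ∀ z : ℂ, ‖z‖ = 1 → K z = 0) :
    ∫ z in disk, fderivWithin ℝ K disk z z = -2 * ∫ z in disk, K z := by
  have hKc := hK.continuousOn
  have hDc : ContinuousOn (fun z => fderivWithin ℝ K disk z z) disk :=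
    (hK.continuousOn_fderivWithin uniqueDiffOn_disk le_rfl).clm_apply continuousOn_id
  set f : ℂ → ℝ := fun z => fderivWithin ℝ K disk z z + 2 * K z with hf
  have hfc : ContinuousOn f disk := hDc.add (continuousOn_const.mul hKc)
  have hint := hfc.integrableOn_compact (μ := volume) isCompact_disk
  have hDi := hDc.integrableOn_compact (μ := volume) isCompact_disk
  have hKi := hKc.integrableOn_compact (μ := volume) isCompact_disk
  suffices hz : ∫ z in disk, f z = 0 by
    rw [hf, integral_add hDi (hKi.const_mul 2), integral_const_mul] at hz
    linarith
  obtain ⟨hi, he⟩ := setIntegral_disk (stronglyMeasurable_indicator_disk hfc) hint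
  rw [Measure.volume_eq_prod] at hi
  rw [he, Measure.volume_eq_prod, ← Measure.prod_restrict, integral_prod_symm _ (by
    rw [Measure.prod_restrict]; exact hi)]
  refine integral_eq_zero_of_ae (Eventually.of_forall fun θ => ?_)
  have hmem : ∀ r ∈ Icc (0 : ℝ) 1, circleMap 0 r θ ∈ disk := fun r hr => by
    rw [mem_disk_iff, norm_circleMap_zero, abs_of_nonneg hr.1]
    exact hr.2
  have hcc : Continuous fun r : ℝ => circleMap 0 r θ := by
    unfold circleMap
    fun_prop
  have hcont : ContinuousOn (fun r => r * f (circleMap 0 r θ)) (Icc 0 1) :=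
    continuousOn_id.mul (hfc.comp hcc.continuousOn hmem)
  -- On the ray of angle `θ` the integrand is the derivative of `r² K(r e^{iθ})`, which vanishes at both
  -- ends.
  have hd : ∀ r ∈ Ioo (0 : ℝ) 1, HasDerivAt (fun r => r ^ 2 * K (circleMap 0 r θ))
      (r * f (circleMap 0 r θ)) r := fun r hr => by
    have hr' := Ioo_subset_Icc_self hr
    have hn : disk ∈ 𝓝 (circleMap 0 r θ) := by
      refine mem_of_superset (Metric.isOpen_ball.mem_nhds ?_) Metric.ball_subset_closedBall
      rw [mem_ball_zero_iff, norm_circleMap_zero, abs_of_pos hr.1]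
      exact hr.2
    have h1 : HasFDerivAt K (fderivWithin ℝ K disk (circleMap 0 r θ)) (circleMap 0 r θ) :=
      (((hK.differentiableOn one_ne_zero) _ (hmem r hr')).hasFDerivWithinAt).hasFDerivAt hn
    have h2 : HasDerivAt (fun r : ℝ => circleMap 0 r θ) (Complex.exp (θ * Complex.I)) r := by
      simp only [circleMap_zero]
      simpa using (hasDerivAt_id r).ofReal_comp.mul_const (Complex.exp (θ * Complex.I))
    refine ((hasDerivAt_pow 2 r).mul (h1.comp_hasDerivAt r h2)).congr_deriv ?_
    have e : circleMap 0 r θ = r • Complex.exp (θ * Complex.I) := by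
      rw [circleMap_zero, Complex.real_smul]
    have e2 : fderivWithin ℝ K disk (circleMap 0 r θ) (circleMap 0 r θ) =
        r * fderivWithin ℝ K disk (circleMap 0 r θ) (Complex.exp (θ * Complex.I)) := by
      conv_lhs => rw [e, map_smul, ← e]
      rfl
    simp only [hf, e2, Function.comp_apply]
    push_cast
    ring
  have hftc := intervalIntegral.integral_eq_sub_of_hasDerivAt_of_le zero_le_one
    ((continuousOn_pow 2).mul (hKc.comp hcc.continuousOn hmem)) hd
    (hcont.intervalIntegrable_of_Icc zero_le_one)
  rw [intervalIntegral.integral_of_le zero_le_one] at hftc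
  simp only [smul_eq_mul, Pi.zero_apply]
  rw [hftc]
  simp [h0 (circleMap 0 1 θ) (by simp)]

/-- The mean turning rate of `X_s` is `2π ∫ ω(z, X_s(z)) = 2π ∫ dH_s(z) z`, and `dH_s(z) z` has the
integral of `-2 H_s`. -/
theorem IsHamiltonianIsotopy.calabi_eq {J X : ℝ → ℂ → ℂ} {H : ℝ → ℂ → ℝ}
    (h : IsHamiltonianIsotopy J X H) : hamiltonianCalabi H = calabi J := by
  rw [h.calabi_eq_integral_turningRate, hamiltonianCalabi, ← intervalIntegral.integral_const_mul,
    ← intervalIntegral.integral_div]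
  refine intervalIntegral.integral_congr fun s hs => ?_
  rw [uIcc_of_le zero_le_one] at hs
  rw [integral_turningRate (h.field_contDiffOn s hs).continuousOn,
    mul_div_cancel_left₀ _ (by positivity), ← integral_fderivWithin_self
      ((h.ham_contDiffOn s hs).of_le (by norm_num)) (h.ham_boundary s hs)]
  exact setIntegral_congr_fun measurableSet_disk fun z hz => h.ham_fderiv s hs z hz z

end CalabiRadial

end

theorem mainTheorem2
    (f : ℂ → ℂ) (hf : CalabiRadial.IsSymplecticDiffeo f) (hf0 : f 0 = 0)
    (I : ℝ → ℂ → ℂ) (hI : CalabiRadial.IsIdentityIsotopy I f)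
    (ft : ℂ → ℂ) (hft : CalabiRadial.IsNaturalLift I f ft)
    (F : CalabiRadial.RadialFoliation) (φ : Set ℂ) (hφ : φ ∈ F.leaves)
    (hm : Integrable (fun z => (CalabiRadial.displacement ft φ z : ℝ)) CalabiRadial.muOmega)
    (hl : IntegrableOn (fun p : ℂ × ℂ => CalabiRadial.lam F f p.1 p.2) CalabiRadial.pairs
      (CalabiRadial.muOmega.prod CalabiRadial.muOmega)) :
    CalabiRadial.calabi I =
        ∫ p in CalabiRadial.pairs, CalabiRadial.Lam F φ f ft p.1 p.2
          ∂(CalabiRadial.muOmega.prod CalabiRadial.muOmega) ∧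
      ∀ (J X : ℝ → ℂ → ℂ) (H : ℝ → ℂ → ℝ), CalabiRadial.IsHamiltonianIsotopy J X H →
        CalabiRadial.IsotopyHomotopic I J →
        CalabiRadial.hamiltonianCalabi H =
          ∫ p in CalabiRadial.pairs, CalabiRadial.Lam F φ f ft p.1 p.2
            ∂(CalabiRadial.muOmega.prod CalabiRadial.muOmega) := by
  have h := CalabiRadial.calabi_eq_integral_Lam hf hft hφ hm hl
  exact ⟨h, fun J X H hJ hIJ => hJ.calabi_eq.trans (hIJ.calabi_eq.symm.trans h)⟩
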